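/- Let $N\ge 2$, $n\ge 2$, and let $\Omega\subset\mathbb{R}^N$ be a smooth ($C^\infty$) bounded domain (open and connected) with boundary $\Gamma=\partial\Omega$. Let $a_1,\dots,a_n\in\Gamma$ be pairwise distinct points and set $$V(x)=\sum_{1\le i<j\le n}\frac{|a_i-a_j|^2}{|x-a_i|^2\,|x-a_j|^2},\qquad \mu^\star(\Omega)=\inf_{u\in H^1_0(\Omega)\setminus\{0\}}\frac{\int_\Omega|\nabla u|^2\,dx}{\int_\Omega V u^2\,dx}.$$ Then: (i) $\displaystyle \frac{(N-2)^2}{n^2}<\mu^\star(\Omega)\le\frac{N^2}{4n-4}.$ (ii) For every real $\mu<\frac{N^2}{4n-4}$ there is a constant $c_\mu\in\mathbb{R}$, depending on $\Omega$ and $a_1,\dots,a_n$ (and $\mu$), such that $$c_\mu\int_\Omega u^2\,dx+\int_\Omega|\nabla u|^2\,dx\ge\mu\int_\Omega V u^2\,dx\qquad\text{for all }u\in C_0^\infty(\Omega).$$ (iii) For every $\mu>\frac{N^2}{4n-4}$ and every $\lambda\in\mathbb{R}$ there is $u_{\lambda,\mu}\in C_0^\infty(\Omega)$ such that $$\lambda\int_\Omega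 u_{\lambda,\mu}^2\,dx+\int_\Omega|\nabla u_{\lambda,\mu}|^2\,dx<\mu\int_\Omega V u_{\lambda,\mu}^2\,dx.$$ (iv) If $\mu^\star(\Omega)<\frac{N^2}{4n-4}$, then $\mu^\star(\Omega)$ is attained in $H^1_0(\Omega)$, i.e. the infimum is attained by some $u\in H^1_0(\Omega)\setminus\{0\}$. -/

import Mathlib

open MeasureTheory Filter Topology
open scoped ENNReal ContDiff

noncomputable section

namespace MultipolarHardy

/-- `ℝ^N` with its Euclidean norm and Lebesgue measure. -/
abbrev E (N : ℕ) : Type := EuclideanSpace ℝ (Fin N)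

/-- A smooth bounded domain: a bounded, open, connected, nonempty set which near every boundary
point is the positivity set of a `C^∞` function that vanishes at that point and whose derivative
does not vanish there (so the boundary is a smooth hypersurface with the set on one side). -/
structure IsSmoothBoundedDomain {N : ℕ} (Ω : Set (E N)) : Prop where
  isOpen : IsOpen Ω
  isConnected : IsConnected Ω
  isBounded : Bornology.IsBounded Ω
  smooth_boundary : ∀ p ∈ frontier Ω, ∃ (U : Set (E N)) (ρ : E N → ℝ),
    IsOpen U ∧ p ∈ U ∧ ContDiffOn ℝ ∞ ρ U ∧ ρ p = 0 ∧ fderiv ℝ ρ p ≠ 0 ∧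
      ∀ x ∈ U, (x ∈ Ω ↔ 0 < ρ x)

/-- `u ∈ C_0^∞(Ω)`: smooth with compact support contained in `Ω` (extended by zero to `ℝ^N`). -/
structure IsTestFunction {N : ℕ} (Ω : Set (E N)) (u : E N → ℝ) : Prop where
  contDiff : ContDiff ℝ ∞ u
  hasCompactSupport : HasCompactSupport u
  tsupport_subset : tsupport u ⊆ Ω

/-- The multipolar potential `V(x) = ∑_{i<j} |a_i - a_j|² / (|x - a_i|² |x - a_j|²)`. -/
def V {N n : ℕ} (a : Fin n → E N) (x : E N) : ℝ :=
  ∑ i : Fin n, ∑ j ∈ Finset.Ioi i, ‖a i - a j‖ ^ 2 / (‖x - a i‖ ^ 2 * ‖x - a j‖ ^ 2)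

/-- `G` is the weak (distributional) gradient of `u` in `Ω`. -/
def HasWeakGradient {N : ℕ} (Ω : Set (E N)) (u : E N → ℝ) (G : E N → E N) : Prop :=
  ∀ φ : E N → ℝ, IsTestFunction Ω φ →
    ∫ x in Ω, u x • gradient φ x = - ∫ x in Ω, φ x • G x

/-- `u ∈ H¹₀(Ω)` with weak gradient `G`: `u` and `G` are square integrable on `Ω`, `G` is the weak
gradient of `u`, and `u` is the limit in `H¹(Ω)` of functions of `C_0^∞(Ω)`. -/
structure MemH10 {N : ℕ} (Ω : Set (E N)) (u : E N → ℝ) (G : E N → E N) : Prop where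
  memLp : MemLp u 2 (volume.restrict Ω)
  memLp_grad : MemLp G 2 (volume.restrict Ω)
  weakGradient : HasWeakGradient Ω u G
  approx : ∃ φ : ℕ → E N → ℝ, (∀ k, IsTestFunction Ω (φ k)) ∧
    Tendsto (fun k => eLpNorm (fun x => φ k x - u x) 2 (volume.restrict Ω)) atTop (𝓝 0) ∧
    Tendsto (fun k => eLpNorm (fun x => gradient (φ k) x - G x) 2 (volume.restrict Ω))
      atTop (𝓝 0)

/-- The quotient `∫_Ω |∇u|² / ∫_Ω V u²`, with `G` in the place of `∇u`, in `[0, ∞]`. -/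
def hardyQuotient {N n : ℕ} (Ω : Set (E N)) (a : Fin n → E N)
    (u : E N → ℝ) (G : E N → E N) : ℝ≥0∞ :=
  (∫⁻ x in Ω, ENNReal.ofReal (‖G x‖ ^ 2)) / (∫⁻ x in Ω, ENNReal.ofReal (V a x * u x ^ 2))

/-- `u` (with weak gradient `G`) is a nonzero element of `H¹₀(Ω)`. -/
def Admissible {N : ℕ} (Ω : Set (E N)) (u : E N → ℝ) (G : E N → E N) : Prop :=
  MemH10 Ω u G ∧ ¬ (u =ᵐ[volume.restrict Ω] 0)

/-- The Hardy constant `μ*(Ω; a_1, …, a_n)`: the infimum of the quotient over the nonzero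
elements of `H¹₀(Ω)`. -/
def hardyConst {N n : ℕ} (Ω : Set (E N)) (a : Fin n → E N) : ℝ≥0∞ :=
  ⨅ (u : E N → ℝ) (G : E N → E N) (_ : Admissible Ω u G), hardyQuotient Ω a u G

end MultipolarHardy

end

/-!
The basic inequalities `∫ |∇u|² ≥ ∫ W u²` all come from a vector field `X`: expanding
`|∇u - u X|² ≥ 0` and integrating by parts gives them with `W = -div X - |X|²`.

For `X = -(N - 2) / n ∑ᵢ ∇ log |x - aᵢ|` this yields `W = ((N - 2) / n)² V`, because
`|a - b|² / (|x - a|² |x - b|²)` is the squared distance of the log-gradients at `a` and `b`. The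
discarded square is itself bounded below, through Poincaré's inequality, by a positive weight; at a
minimizer this makes the lower bound strict.

Near the pole `aₖ` the potential behaves like `(n - 1) / |x - aₖ|²`, while a boundary point of class
`C²` has the Hardy constant `N² / 4` of a half-space, up to lower order terms. Localizing at the
poles gives the threshold `N² / (4 (n - 1))`: below it the inequality holds modulo `∫ u²`, and above
it rescaled near-optimal functions of the half-space violate it for any multiple of `∫ u²`. If the
infimum lies below the threshold, the parallelogram identity and Rellich's theorem make a
minimizing sequence converge strongly, so the infimum is attained.
-/

noncomputable section

namespace MultipolarHardy

open scoped RealInnerProductSpace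

/-! ### Gradients and divergences in inner product spaces -/

section Gradient

variable {F : Type*} [NormedAddCommGroup F] [InnerProductSpace ℝ F] [CompleteSpace F]
  {u v : F → ℝ} {g g' x : F}

lemma hasGradientAt_iff_hasFDerivAt_innerSL :
    HasGradientAt u g x ↔ HasFDerivAt u (innerSL ℝ g) x := Iff.rfl

lemma norm_gradient (u : F → ℝ) (x : F) : ‖gradient u x‖ = ‖fderiv ℝ u x‖ := by
  simp [gradient]

lemma contDiffAt_gradient {m k : WithTop ℕ∞} (h : ContDiffAt ℝ m u x) (hk : k + 1 ≤ m) :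
    ContDiffAt ℝ k (gradient u) x :=
  (InnerProductSpace.toDual ℝ F).symm.contDiff.contDiffAt.comp x (h.fderiv_right hk)

lemma gradient_eq_zero_of_notMem_tsupport (hx : x ∉ tsupport u) : gradient u x = 0 := by
  simp [gradient, Function.notMem_support.1 fun h => hx (support_fderiv_subset ℝ h)]

lemma gradient_fun_add (hu : DifferentiableAt ℝ u x) (hv : DifferentiableAt ℝ v x) :
    gradient (fun y => u y + v y) x = gradient u x + gradient v x := by
  simp [gradient, fderiv_fun_add hu hv]

lemma gradient_fun_sub (hu : DifferentiableAt ℝ u x) (hv : DifferentiableAt ℝ v x) :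
    gradient (fun y => u y - v y) x = gradient u x - gradient v x := by
  simp [gradient, fderiv_fun_sub hu hv]

lemma gradient_fun_const_mul (hu : DifferentiableAt ℝ u x) (c : ℝ) :
    gradient (fun y => c * u y) x = c • gradient u x := by
  simp [gradient, fderiv_const_mul hu c]

lemma hasGradientAt_comp {f : ℝ → ℝ} {f' : ℝ} (hf : HasDerivAt f f' (u x))
    (hu : HasGradientAt u g x) : HasGradientAt (fun y => f (u y)) (f' • g) x := by
  rw [hasGradientAt_iff_hasFDerivAt_innerSL] at *
  rw [map_smul]
  exact hf.comp_hasFDerivAt x hu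

lemma hasGradientAt_mul (hu : HasGradientAt u g x) (hv : HasGradientAt v g' x) :
    HasGradientAt (fun y => u y * v y) (u x • g' + v x • g) x := by
  rw [hasGradientAt_iff_hasFDerivAt_innerSL] at *
  rw [map_add, map_smul, map_smul]
  exact hu.mul hv

lemma hasGradientAt_sum {ι : Type*} (s : Finset ι) {w : ι → F → ℝ} {G : ι → F}
    (h : ∀ i ∈ s, HasGradientAt (w i) (G i) x) :
    HasGradientAt (fun y => ∑ i ∈ s, w i y) (∑ i ∈ s, G i) x := by
  rw [hasGradientAt_iff_hasFDerivAt_innerSL, map_sum]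
  exact HasFDerivAt.fun_sum h

lemma hasGradientAt_inner_left (ν x : F) : HasGradientAt (fun y => ⟪ν, y⟫) ν x :=
  (innerSL ℝ ν).hasFDerivAt

lemma hasGradientAt_norm_sub_sq (a x : F) :
    HasGradientAt (fun y => ‖y - a‖ ^ 2) ((2 : ℝ) • (x - a)) x := by
  rw [hasGradientAt_iff_hasFDerivAt_innerSL, map_smul]
  refine ((hasFDerivAt_id x).sub_const a).norm_sq.congr_fderiv ?_
  ext v
  simp [two_smul]

end Gradient

section Divergence

/-- The divergence of a vector field, as the trace of its derivative. -/
def divergence {F : Type*} [NormedAddCommGroup F] [NormedSpace ℝ F] (X : F → F) (x : F) : ℝ :=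
  LinearMap.trace ℝ F (fderiv ℝ X x : F →ₗ[ℝ] F)

section NormedSpace

variable {F : Type*} [NormedAddCommGroup F] [NormedSpace ℝ F] {X Y : F → F} {x : F}

lemma divergence_add (hX : DifferentiableAt ℝ X x) (hY : DifferentiableAt ℝ Y x) :
    divergence (fun y => X y + Y y) x = divergence X x + divergence Y x := by
  rw [divergence, fderiv_fun_add hX hY]
  simp [divergence]

lemma divergence_const_smul (hX : DifferentiableAt ℝ X x) (c : ℝ) :
    divergence (fun y => c • X y) x = c * divergence X x := by
  rw [divergence, fderiv_fun_const_smul hX]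
  simp [divergence]

lemma divergence_sum {ι : Type*} (s : Finset ι) {Z : ι → F → F}
    (hZ : ∀ i ∈ s, DifferentiableAt ℝ (Z i) x) :
    divergence (fun y => ∑ i ∈ s, Z i y) x = ∑ i ∈ s, divergence (Z i) x := by
  rw [divergence, fderiv_fun_sum hZ]
  simp [divergence]

lemma divergence_sub_const [FiniteDimensional ℝ F] (a x : F) :
    divergence (fun y => y - a) x = Module.finrank ℝ F := by
  rw [divergence, fderiv_sub_const, fderiv_fun_id]
  exact LinearMap.trace_id ℝ F

lemma integral_fderiv_apply_eq_zero [FiniteDimensional ℝ F]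
    [MeasurableSpace F] [BorelSpace F] (μ : Measure F) [μ.IsAddHaarMeasure] {f : F → ℝ}
    (hf : ContDiff ℝ 1 f) (hc : HasCompactSupport f) (v : F) : ∫ x, fderiv ℝ f x v ∂μ = 0 := by
  have hcf : Continuous fun x => fderiv ℝ f x v :=
    (hf.continuous_fderiv one_ne_zero).clm_apply continuous_const
  simpa using integral_smul_fderiv_eq_neg_fderiv_smul_of_integrable (μ := μ)
    (f := fun _ : F => (1 : ℝ)) (g := f) (v := v) (by simp)
    (by simpa using hcf.integrable_of_hasCompactSupport (hc.fderiv_apply ℝ v))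
    (by simpa using hf.continuous.integrable_of_hasCompactSupport hc)
    (fun x _ => differentiableAt_const _) (fun x _ => hf.differentiable one_ne_zero x)

end NormedSpace

variable {F : Type*} [NormedAddCommGroup F] [InnerProductSpace ℝ F] [FiniteDimensional ℝ F]
  {X : F → F} {x : F}

lemma divergence_eq_sum_inner (X : F → F) (x : F) :
    divergence X x =
      ∑ i, ⟪stdOrthonormalBasis ℝ F i, fderiv ℝ X x (stdOrthonormalBasis ℝ F i)⟫ :=
  LinearMap.trace_eq_sum_inner _ (stdOrthonormalBasis ℝ F)

lemma trace_smulRight_innerSL (v w : F) :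
    LinearMap.trace ℝ F (((innerSL ℝ v).smulRight w : F →L[ℝ] F) : F →ₗ[ℝ] F) = ⟪v, w⟫ := by
  rw [LinearMap.trace_eq_sum_inner _ (stdOrthonormalBasis ℝ F)]
  simp only [ContinuousLinearMap.coe_coe, ContinuousLinearMap.smulRight_apply,
    innerSL_apply_apply, real_inner_smul_right]
  exact (stdOrthonormalBasis ℝ F).sum_inner_mul_inner v w

lemma divergence_smul {f : F → ℝ} {g : F} (hf : HasGradientAt f g x)
    (hX : DifferentiableAt ℝ X x) :
    divergence (fun y => f y • X y) x = ⟪g, X x⟫ + f x * divergence X x := by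
  rw [divergence,
    ((hasGradientAt_iff_hasFDerivAt_innerSL.1 hf).fun_smul hX.hasFDerivAt).fderiv, divergence,
    add_comm, ← trace_smulRight_innerSL]
  simp only [ContinuousLinearMap.toLinearMap_add, ContinuousLinearMap.toLinearMap_smul, map_add,
    map_smul, smul_eq_mul]

lemma continuousOn_divergence {s : Set F} (hs : IsOpen s) (hX : ContDiffOn ℝ 1 X s) :
    ContinuousOn (divergence X) s := by
  simp only [funext (divergence_eq_sum_inner X)]
  exact continuousOn_finsetSum _ fun i _ => continuousOn_const.inner
    ((hX.continuousOn_fderiv_of_isOpen hs le_rfl).clm_apply continuousOn_const)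

variable [MeasurableSpace F] [BorelSpace F] (μ : Measure F) [μ.IsAddHaarMeasure]

lemma integral_divergence_eq_zero (hX : ContDiff ℝ 1 X) (hc : HasCompactSupport X) :
    ∫ x, divergence X x ∂μ = 0 := by
  have hinner : ∀ (e x : F), ⟪e, fderiv ℝ X x e⟫ = fderiv ℝ (fun y => ⟪e, X y⟫) x e := by
    intro e x
    have h : HasFDerivAt (fun y => ⟪e, X y⟫) ((innerSL ℝ e).comp (fderiv ℝ X x)) x :=
      (innerSL ℝ e).hasFDerivAt.comp x (hX.differentiable one_ne_zero x).hasFDerivAt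
    simp [h.fderiv]
  have hC1 : ∀ e : F, ContDiff ℝ 1 fun y => ⟪e, X y⟫ := fun e => contDiff_const.inner ℝ hX
  have hcs : ∀ e : F, HasCompactSupport fun y => ⟪e, X y⟫ := fun e =>
    hc.comp_left (g := fun y => ⟪e, y⟫) (inner_zero_right e)
  simp only [divergence_eq_sum_inner, hinner]
  rw [integral_finsetSum]
  · exact Finset.sum_eq_zero fun i _ => integral_fderiv_apply_eq_zero μ (hC1 _) (hcs _) _
  · exact fun i _ => Continuous.integrable_of_hasCompactSupport
      (((hC1 _).continuous_fderiv one_ne_zero).clm_apply continuous_const)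
      ((hcs _).fderiv_apply ℝ _)

end Divergence

section LogGrad

variable {F : Type*} [NormedAddCommGroup F] [InnerProductSpace ℝ F] {a b x : F}

/-- The gradient of `y ↦ log ‖y - a‖`; the junk value at the pole is `logGrad a a = 0`. -/
def logGrad (a x : F) : F := (‖x - a‖ ^ 2)⁻¹ • (x - a)

omit [InnerProductSpace ℝ F] in
lemma norm_sub_sq_pos (h : x ≠ a) : 0 < ‖x - a‖ ^ 2 :=
  pow_pos (norm_pos_iff.2 (sub_ne_zero.2 h)) 2

lemma contDiffAt_norm_sub_sq {m : WithTop ℕ∞} (a x : F) :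
    ContDiffAt ℝ m (fun y : F => ‖y - a‖ ^ 2) x :=
  (contDiffAt_id.sub contDiffAt_const).norm_sq ℝ

lemma contDiffAt_logGrad {m : WithTop ℕ∞} (h : x ≠ a) : ContDiffAt ℝ m (logGrad a) x :=
  ((contDiffAt_norm_sub_sq a x).inv (norm_sub_sq_pos h).ne').smul
    (contDiffAt_id.sub contDiffAt_const)

lemma contDiffAt_log_norm_sub {m : WithTop ℕ∞} (h : x ≠ a) :
    ContDiffAt ℝ m (fun y => Real.log ‖y - a‖) x :=
  ((contDiffAt_id.sub contDiffAt_const).norm ℝ (sub_ne_zero.2 h)).log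
    (norm_ne_zero_iff.2 (sub_ne_zero.2 h))

lemma hasGradientAt_log_norm_sub [CompleteSpace F] (h : x ≠ a) :
    HasGradientAt (fun y => Real.log ‖y - a‖) (logGrad a x) x := by
  have hlog : ∀ y, Real.log ‖y - a‖ = 2⁻¹ * Real.log (‖y - a‖ ^ 2) := fun y => by
    rw [Real.log_pow]; push_cast; ring
  simp only [hlog]
  convert hasGradientAt_comp (u := fun y => ‖y - a‖ ^ 2)
    ((Real.hasDerivAt_log (norm_sub_sq_pos h).ne').const_mul 2⁻¹)
    (hasGradientAt_norm_sub_sq a x) using 1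
  rw [logGrad, smul_smul]
  congr 1
  ring

lemma norm_logGrad (a x : F) : ‖logGrad a x‖ = ‖x - a‖⁻¹ := by
  rw [logGrad, norm_smul, norm_inv, norm_pow, norm_norm]
  rcases eq_or_ne ‖x - a‖ 0 with h | h
  · simp [h]
  · field_simp

lemma norm_logGrad_sq (a x : F) : ‖logGrad a x‖ ^ 2 = (‖x - a‖ ^ 2)⁻¹ := by
  rw [norm_logGrad, inv_pow]

lemma divergence_logGrad [FiniteDimensional ℝ F] (h : x ≠ a) :
    divergence (logGrad a) x = (Module.finrank ℝ F - 2) * (‖x - a‖ ^ 2)⁻¹ := by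
  have h0 := norm_sub_sq_pos h
  have hinv : HasGradientAt (fun y => (‖y - a‖ ^ 2)⁻¹)
      (-((‖x - a‖ ^ 2) ^ 2)⁻¹ • (2 : ℝ) • (x - a)) x :=
    hasGradientAt_comp (hasDerivAt_inv h0.ne') (hasGradientAt_norm_sub_sq a x)
  have hdiv := divergence_smul (X := fun y => y - a) hinv (by fun_prop)
  rw [divergence_sub_const, real_inner_smul_left, real_inner_smul_left,
    real_inner_self_eq_norm_sq] at hdiv
  refine hdiv.trans ?_
  field_simp
  ring

/- The difference of two log-gradients produces exactly one summand of `V`. -/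
lemma norm_logGrad_sub_sq (ha : x ≠ a) (hb : x ≠ b) :
    ‖logGrad a x - logGrad b x‖ ^ 2 = ‖a - b‖ ^ 2 / (‖x - a‖ ^ 2 * ‖x - b‖ ^ 2) := by
  have h1 := norm_pos_iff.2 (sub_ne_zero.2 ha)
  have h2 := norm_pos_iff.2 (sub_ne_zero.2 hb)
  have hab : a - b = (x - b) - (x - a) := by abel
  rw [norm_sub_sq_real, norm_logGrad_sq, norm_logGrad_sq, hab, norm_sub_sq_real (x - b),
    logGrad, logGrad, real_inner_smul_left, real_inner_smul_right, real_inner_comm (x - b)]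
  field_simp

end LogGrad

variable {N n : ℕ}

/-! ### Test functions -/

lemma contDiff_of_contDiffAt_tsupport {F G : Type*} [NormedAddCommGroup F] [NormedSpace ℝ F]
    [NormedAddCommGroup G] [NormedSpace ℝ G] {m : WithTop ℕ∞} {f : F → G}
    (hf : ∀ x ∈ tsupport f, ContDiffAt ℝ m f x) : ContDiff ℝ m f := by
  refine contDiff_iff_contDiffAt.2 fun x => ?_
  by_cases hx : x ∈ tsupport f
  · exact hf x hx
  · exact contDiffAt_const.congr_of_eventuallyEq (notMem_tsupport_iff_eventuallyEq.1 hx)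

namespace IsTestFunction

variable {Ω : Set (E N)} {u v : E N → ℝ}

lemma continuous (hu : IsTestFunction Ω u) : Continuous u := hu.contDiff.continuous

lemma differentiable (hu : IsTestFunction Ω u) : Differentiable ℝ u :=
  hu.contDiff.differentiable (by simp)

lemma hasGradientAt (hu : IsTestFunction Ω u) (x : E N) : HasGradientAt u (gradient u x) x :=
  (hu.differentiable x).hasGradientAt

lemma continuous_gradient (hu : IsTestFunction Ω u) : Continuous (gradient u) :=
  (InnerProductSpace.toDual ℝ (E N)).symm.continuous.comp (hu.contDiff.continuous_fderiv (by simp))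

lemma eq_zero_of_notMem (hu : IsTestFunction Ω u) {x : E N} (hx : x ∉ Ω) : u x = 0 :=
  image_eq_zero_of_notMem_tsupport fun h => hx (hu.tsupport_subset h)

lemma gradient_eq_zero_of_notMem (hu : IsTestFunction Ω u) {x : E N} (hx : x ∉ Ω) :
    gradient u x = 0 :=
  gradient_eq_zero_of_notMem_tsupport fun h => hx (hu.tsupport_subset h)

lemma sub (hu : IsTestFunction Ω u) (hv : IsTestFunction Ω v) :
    IsTestFunction Ω (fun x => u x - v x) :=
  ⟨hu.contDiff.sub hv.contDiff, hu.hasCompactSupport.sub hv.hasCompactSupport,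
    (tsupport_sub u v).trans (Set.union_subset hu.tsupport_subset hv.tsupport_subset)⟩

lemma add (hu : IsTestFunction Ω u) (hv : IsTestFunction Ω v) :
    IsTestFunction Ω (fun x => u x + v x) :=
  ⟨hu.contDiff.add hv.contDiff, hu.hasCompactSupport.add hv.hasCompactSupport,
    (tsupport_add u v).trans (Set.union_subset hu.tsupport_subset hv.tsupport_subset)⟩

lemma const_mul (hu : IsTestFunction Ω u) (c : ℝ) : IsTestFunction Ω (fun x => c * u x) :=
  ⟨contDiff_const.mul hu.contDiff, hu.hasCompactSupport.mul_left,
    tsupport_mul_subset_right.trans hu.tsupport_subset⟩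

lemma mul_contDiffOn (hΩ : IsOpen Ω) (hu : IsTestFunction Ω u) {g : E N → ℝ}
    (hg : ContDiffOn ℝ ∞ g Ω) : IsTestFunction Ω (fun x => u x * g x) := by
  refine ⟨contDiff_of_contDiffAt_tsupport fun x hx => ?_, hu.hasCompactSupport.mul_right,
    tsupport_mul_subset_left.trans hu.tsupport_subset⟩
  exact hu.contDiff.contDiffAt.mul
    (hg.contDiffAt (hΩ.mem_nhds (hu.tsupport_subset (tsupport_mul_subset_left hx))))

lemma integrable_of_continuousOn (hΩ : IsOpen Ω) (hu : IsTestFunction Ω u)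
    {f : E N → ℝ} (hf : ContinuousOn f Ω) (h0 : ∀ x ∉ tsupport u, f x = 0) : Integrable f := by
  have hsupp : tsupport f ⊆ tsupport u :=
    closure_minimal (fun x hx => by_contra fun h => hx (h0 x h)) (isClosed_tsupport u)
  refine Continuous.integrable_of_hasCompactSupport (continuous_of_tsupport fun x hx => ?_)
    (HasCompactSupport.intro hu.hasCompactSupport fun x hx => h0 x hx)
  exact hf.continuousAt (hΩ.mem_nhds (hu.tsupport_subset (hsupp hx)))

lemma integrable (hu : IsTestFunction Ω u) : Integrable u :=
  hu.continuous.integrable_of_hasCompactSupport hu.hasCompactSupport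

lemma integrable_mul_sq (hΩ : IsOpen Ω) (hu : IsTestFunction Ω u)
    {f : E N → ℝ} (hf : ContinuousOn f Ω) : Integrable fun x => f x * u x ^ 2 :=
  hu.integrable_of_continuousOn hΩ (hf.mul (hu.continuous.pow 2).continuousOn)
    fun x hx => by simp [image_eq_zero_of_notMem_tsupport hx]

lemma integrable_sq (hu : IsTestFunction Ω u) : Integrable fun x => u x ^ 2 :=
  (hu.continuous.pow 2).integrable_of_hasCompactSupport
    (HasCompactSupport.intro hu.hasCompactSupport fun x hx => by
      simp [image_eq_zero_of_notMem_tsupport hx])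

lemma integrable_mul_inner_gradient (hΩ : IsOpen Ω) (hu : IsTestFunction Ω u) {X : E N → E N}
    (hX : ContinuousOn X Ω) : Integrable fun x => 2 * u x * ⟪gradient u x, X x⟫ :=
  hu.integrable_of_continuousOn hΩ
    ((continuous_const.mul hu.continuous).continuousOn.mul
      (hu.continuous_gradient.continuousOn.inner hX))
    fun x hx => by simp [image_eq_zero_of_notMem_tsupport hx]

lemma integrable_norm_gradient_sq (hu : IsTestFunction Ω u) :
    Integrable fun x => ‖gradient u x‖ ^ 2 :=
  (hu.continuous_gradient.norm.pow 2).integrable_of_hasCompactSupport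
    (HasCompactSupport.intro hu.hasCompactSupport fun x hx => by
      simp [gradient_eq_zero_of_notMem_tsupport hx])

lemma setIntegral_mul_sq (hu : IsTestFunction Ω u) (f : E N → ℝ) :
    ∫ x in Ω, f x * u x ^ 2 = ∫ x, f x * u x ^ 2 :=
  setIntegral_eq_integral_of_forall_compl_eq_zero fun x hx => by simp [hu.eq_zero_of_notMem hx]

lemma setIntegral_sq (hu : IsTestFunction Ω u) : ∫ x in Ω, u x ^ 2 = ∫ x, u x ^ 2 :=
  setIntegral_eq_integral_of_forall_compl_eq_zero fun x hx => by simp [hu.eq_zero_of_notMem hx]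

lemma setIntegral_norm_gradient_sq (hu : IsTestFunction Ω u) :
    ∫ x in Ω, ‖gradient u x‖ ^ 2 = ∫ x, ‖gradient u x‖ ^ 2 :=
  setIntegral_eq_integral_of_forall_compl_eq_zero fun x hx => by
    simp [hu.gradient_eq_zero_of_notMem hx]

end IsTestFunction

/-! ### Hardy inequalities from vector fields -/

section VectorField

variable {Ω : Set (E N)} {u : E N → ℝ} {X : E N → E N}

lemma integral_two_mul_inner_gradient (hΩ : IsOpen Ω) (hu : IsTestFunction Ω u)
    (hX : ContDiffOn ℝ 1 X Ω) :
    ∫ x, 2 * u x * ⟪gradient u x, X x⟫ = -∫ x, divergence X x * u x ^ 2 := by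
  have hsupp : tsupport (fun x => u x ^ 2 • X x) ⊆ tsupport u :=
    closure_mono fun x hx h => hx (by simp [h])
  have hC1 : ContDiff ℝ 1 fun x => u x ^ 2 • X x := contDiff_of_contDiffAt_tsupport fun x hx =>
    ((hu.contDiff.of_le (by simp)).pow 2).contDiffAt.smul
      (hX.contDiffAt (hΩ.mem_nhds (hu.tsupport_subset (hsupp hx))))
  have hcs : HasCompactSupport fun x => u x ^ 2 • X x :=
    hu.hasCompactSupport.of_isClosed_subset (isClosed_tsupport _) hsupp
  have hdiv : ∀ x, divergence (fun x => u x ^ 2 • X x) x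
      = 2 * u x * ⟪gradient u x, X x⟫ + divergence X x * u x ^ 2 := by
    intro x
    by_cases hx : x ∈ Ω
    · rw [divergence_smul (hasGradientAt_comp (hasDerivAt_pow 2 (u x)) (hu.hasGradientAt x))
        ((hX.contDiffAt (hΩ.mem_nhds hx)).differentiableAt one_ne_zero), real_inner_smul_left]
      ring
    · have h0 : fderiv ℝ (fun x => u x ^ 2 • X x) x = 0 := Function.notMem_support.1 fun h =>
        hx (hu.tsupport_subset (hsupp (support_fderiv_subset ℝ h)))
      simp [divergence, h0, hu.eq_zero_of_notMem hx]
  have h0 := integral_divergence_eq_zero volume hC1 hcs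
  simp only [hdiv] at h0
  rw [integral_add (hu.integrable_mul_inner_gradient hΩ hX.continuousOn)
    (hu.integrable_mul_sq hΩ (continuousOn_divergence hΩ hX))] at h0
  linarith

lemma integral_norm_gradient_sub_smul_sq (hΩ : IsOpen Ω) (hu : IsTestFunction Ω u)
    (hX : ContDiffOn ℝ 1 X Ω) :
    ∫ x, ‖gradient u x - u x • X x‖ ^ 2 =
      (∫ x, ‖gradient u x‖ ^ 2) + ∫ x, (divergence X x + ‖X x‖ ^ 2) * u x ^ 2 := by
  have hi1 := hu.integrable_mul_inner_gradient hΩ hX.continuousOn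
  have hi2 := hu.integrable_mul_sq hΩ (continuousOn_divergence hΩ hX)
  have hi3 := hu.integrable_mul_sq hΩ (f := fun x => ‖X x‖ ^ 2) (hX.continuousOn.norm.pow 2)
  have hexpand : ∀ x, ‖gradient u x - u x • X x‖ ^ 2 =
      ‖gradient u x‖ ^ 2 - 2 * u x * ⟪gradient u x, X x⟫ + ‖X x‖ ^ 2 * u x ^ 2 := by
    intro x
    rw [norm_sub_sq_real, real_inner_smul_right, norm_smul, mul_pow, Real.norm_eq_abs, sq_abs]
    ring
  simp only [hexpand, add_mul]
  rw [integral_add (by exact hu.integrable_norm_gradient_sq.sub hi1) hi3,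
    integral_sub hu.integrable_norm_gradient_sq hi1, integral_add hi2 hi3,
    integral_two_mul_inner_gradient hΩ hu hX]
  ring

lemma integral_mul_sq_le_of_divergence (hΩ : IsOpen Ω) (hu : IsTestFunction Ω u)
    (hX : ContDiffOn ℝ 1 X Ω) {W : E N → ℝ} (hWc : ContinuousOn W Ω)
    (hW : ∀ x ∈ Ω, W x ≤ -(divergence X x + ‖X x‖ ^ 2)) :
    ∫ x, W x * u x ^ 2 ≤ ∫ x, ‖gradient u x‖ ^ 2 := by
  have hc := (continuousOn_divergence hΩ hX).add (hX.continuousOn.norm.pow 2)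
  calc ∫ x, W x * u x ^ 2
      ≤ ∫ x, -((divergence X x + ‖X x‖ ^ 2) * u x ^ 2) := by
        refine integral_mono (hu.integrable_mul_sq hΩ hWc) (hu.integrable_mul_sq hΩ hc).neg
          fun x => ?_
        by_cases hx : x ∈ Ω
        · simpa only [neg_mul] using mul_le_mul_of_nonneg_right (hW x hx) (sq_nonneg (u x))
        · simp [hu.eq_zero_of_notMem hx]
    _ = (∫ x, ‖gradient u x‖ ^ 2) - ∫ x, ‖gradient u x - u x • X x‖ ^ 2 := by
        rw [integral_neg, integral_norm_gradient_sub_smul_sq hΩ hu hX]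
        ring
    _ ≤ ∫ x, ‖gradient u x‖ ^ 2 :=
        sub_le_self _ (integral_nonneg fun x => sq_nonneg _)

lemma poincare_of_norm_le {R : ℝ} (hΩ : IsOpen Ω) (hΩR : ∀ x ∈ Ω, ‖x‖ ≤ R)
    (hu : IsTestFunction Ω u) :
    (N / (2 * R)) ^ 2 * ∫ x, u x ^ 2 ≤ ∫ x, ‖gradient u x‖ ^ 2 := by
  rw [← integral_const_mul]
  refine integral_mul_sq_le_of_divergence hΩ hu (X := fun x => (-(N / (2 * R ^ 2)) : ℝ) • (x - 0))
    (by fun_prop) continuousOn_const fun x hx => ?_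
  rw [divergence_const_smul (by fun_prop), divergence_sub_const, finrank_euclideanSpace_fin,
    sub_zero, norm_smul, mul_pow, Real.norm_eq_abs, sq_abs]
  have hxR : ‖x‖ ^ 2 ≤ R ^ 2 := by gcongr; exact hΩR x hx
  rcases eq_or_ne R 0 with rfl | hR
  · simp
  · calc (N / (2 * R)) ^ 2
        = N / (2 * R ^ 2) * N - (-(N / (2 * R ^ 2))) ^ 2 * R ^ 2 := by field_simp; ring
      _ ≤ N / (2 * R ^ 2) * N - (-(N / (2 * R ^ 2))) ^ 2 * ‖x‖ ^ 2 := by gcongr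
      _ = _ := by ring

end VectorField

/-! ### Rellich's theorem -/

section Variance

variable {α : Type*} [MeasurableSpace α] {μ : Measure α} {f : α → ℝ}

lemma ofReal_integral_le_lintegral (hf : ∀ x, 0 ≤ f x) :
    ENNReal.ofReal (∫ x, f x ∂μ) ≤ ∫⁻ x, ENNReal.ofReal (f x) ∂μ := by
  have h := enorm_integral_le_lintegral_enorm (μ := μ) f
  rw [Real.enorm_of_nonneg (integral_nonneg hf)] at h
  exact h.trans_eq (lintegral_congr fun x => Real.enorm_of_nonneg (hf x))

lemma integral_integral_sub_sq [IsFiniteMeasure μ] (hf : MemLp f 2 μ) :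
    ∫ x, ∫ y, (f y - f x) ^ 2 ∂μ ∂μ =
      2 * (μ.real Set.univ * ∫ x, f x ^ 2 ∂μ - (∫ x, f x ∂μ) ^ 2) := by
  have hf1 : Integrable f μ := hf.integrable one_le_two
  have hf2 : Integrable (fun x => f x ^ 2) μ := hf.integrable_sq
  have hinner : ∀ x, ∫ y, (f y - f x) ^ 2 ∂μ =
      ∫ y, f y ^ 2 ∂μ - 2 * (∫ y, f y ∂μ) * f x + μ.real Set.univ * f x ^ 2 := by
    intro x
    have hmul : Integrable (fun y => 2 * f y * f x) μ := (hf1.const_mul 2).mul_const _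
    simp only [sub_sq]
    rw [integral_add (by exact hf2.sub hmul) (integrable_const _), integral_sub hf2 hmul,
      integral_mul_const, integral_const_mul, integral_const, smul_eq_mul]
  simp only [hinner]
  rw [integral_add (by exact (integrable_const _).sub (hf1.const_mul _)) (hf2.const_mul _),
    integral_sub (integrable_const _) (hf1.const_mul _), integral_const_mul, integral_const_mul,
    integral_const, smul_eq_mul]
  ring

end Variance

section Translation

variable {F : Type*} [NormedAddCommGroup F] [NormedSpace ℝ F] {u : F → ℝ}

lemma sq_sub_le_integral_fderiv_sq (hu : ContDiff ℝ 1 u) (x h : F) :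
    (u (x + h) - u x) ^ 2 ≤ ∫ t in Set.Ioc (0 : ℝ) 1, fderiv ℝ u (x + t • h) h ^ 2 := by
  have hderiv : ∀ t : ℝ, HasDerivAt (fun t : ℝ => u (x + t • h)) (fderiv ℝ u (x + t • h) h) t := by
    intro t
    have hline : HasDerivAt (fun t : ℝ => x + t • h) h t := by
      simpa using ((hasDerivAt_id t).smul_const h).const_add x
    exact (hu.differentiable one_ne_zero _).hasFDerivAt.comp_hasDerivAt t hline
  have hcont : Continuous fun t : ℝ => fderiv ℝ u (x + t • h) h :=
    ((hu.continuous_fderiv one_ne_zero).comp (by fun_prop)).clm_apply continuous_const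
  have hftc : ∫ t in Set.Ioc (0 : ℝ) 1, fderiv ℝ u (x + t • h) h = u (x + h) - u x := by
    rw [← intervalIntegral.integral_of_le zero_le_one,
      intervalIntegral.integral_eq_sub_of_hasDerivAt (fun t _ => hderiv t)
        (hcont.intervalIntegrable _ _)]
    simp
  have hprob : IsProbabilityMeasure (volume.restrict (Set.Ioc (0 : ℝ) 1)) := ⟨by simp⟩
  rw [← hftc]
  exact even_two.convexOn_pow.map_integral_le (continuous_pow 2).continuousOn isClosed_univ
    (by simp) (hcont.integrableOn_Ioc) ((hcont.pow 2).integrableOn_Ioc)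

variable [FiniteDimensional ℝ F] [MeasurableSpace F] [BorelSpace F]
  (μ : Measure F) [μ.IsAddHaarMeasure]

lemma lintegral_sq_sub_le (hu : ContDiff ℝ 1 u) (h : F) :
    ∫⁻ x, ENNReal.ofReal ((u (x + h) - u x) ^ 2) ∂μ ≤
      ∫⁻ x, ENNReal.ofReal (fderiv ℝ u x h ^ 2) ∂μ := by
  have hcont : Continuous fun x => fderiv ℝ u x h :=
    (hu.continuous_fderiv one_ne_zero).clm_apply continuous_const
  calc ∫⁻ x, ENNReal.ofReal ((u (x + h) - u x) ^ 2) ∂μ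
      ≤ ∫⁻ x, (∫⁻ t in Set.Ioc (0 : ℝ) 1, ENNReal.ofReal (fderiv ℝ u (x + t • h) h ^ 2)) ∂μ :=
        lintegral_mono fun x =>
          (ENNReal.ofReal_le_ofReal (sq_sub_le_integral_fderiv_sq hu x h)).trans
            (ofReal_integral_le_lintegral fun t => sq_nonneg _)
    _ = ∫⁻ t in Set.Ioc (0 : ℝ) 1, ∫⁻ x, ENNReal.ofReal (fderiv ℝ u (x + t • h) h ^ 2) ∂μ := by
        refine lintegral_lintegral_swap (Continuous.measurable ?_).aemeasurable
        exact ENNReal.continuous_ofReal.comp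
          ((hcont.comp (f := fun p : F × ℝ => p.1 + p.2 • h) (by fun_prop)).pow 2)
    _ = ∫⁻ _ in Set.Ioc (0 : ℝ) 1, ∫⁻ x, ENNReal.ofReal (fderiv ℝ u x h ^ 2) ∂μ :=
        lintegral_congr fun t => lintegral_add_right_eq_self
          (fun x => ENNReal.ofReal (fderiv ℝ u x h ^ 2)) (t • h)
    _ = ∫⁻ x, ENNReal.ofReal (fderiv ℝ u x h ^ 2) ∂μ := by simp

lemma lintegral_closedBall_lintegral_sq_sub_le (hu : ContDiff ℝ 1 u) {δ : ℝ} :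
    ∫⁻ x, ∫⁻ h in Metric.closedBall 0 δ, ENNReal.ofReal ((u (x + h) - u x) ^ 2) ∂μ ∂μ ≤
      ENNReal.ofReal (δ ^ 2) * (∫⁻ x, ENNReal.ofReal (‖fderiv ℝ u x‖ ^ 2) ∂μ) *
        μ (Metric.closedBall 0 δ) := by
  have hcont := hu.continuous
  have hmeas : Measurable fun p : F × F => ENNReal.ofReal ((u (p.1 + p.2) - u p.1) ^ 2) :=
    (ENNReal.continuous_ofReal.comp (by fun_prop)).measurable
  rw [lintegral_lintegral_swap hmeas.aemeasurable,
    ← setLIntegral_const, ← lintegral_const_mul' _ _ ENNReal.ofReal_ne_top]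
  refine setLIntegral_mono' Metric.isClosed_closedBall.measurableSet fun h hh => ?_
  refine (lintegral_sq_sub_le μ hu h).trans (lintegral_mono fun x => ?_)
  rw [← ENNReal.ofReal_mul (sq_nonneg δ), ← mul_pow, ← sq_abs, mul_comm]
  refine ENNReal.ofReal_le_ofReal (pow_le_pow_left₀ (abs_nonneg _) ?_ 2)
  exact ((fderiv ℝ u x).le_opNorm h).trans
    (mul_le_mul_of_nonneg_left (mem_closedBall_zero_iff.1 hh) (norm_nonneg _))

variable {ι : Type*} {S : Finset ι} {Q : ι → Set F} {δ : ℝ}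

lemma sum_integral_integral_sub_sq_le (hu : ContDiff ℝ 1 u) (hc : HasCompactSupport u)
    (hQ : ∀ i ∈ S, MeasurableSet (Q i)) (hdisj : (S : Set ι).PairwiseDisjoint Q)
    (hdiam : ∀ i ∈ S, ∀ x ∈ Q i, ∀ y ∈ Q i, dist x y ≤ δ) :
    ∑ i ∈ S, ∫ x in Q i, ∫ y in Q i, (u y - u x) ^ 2 ∂μ ∂μ ≤
      δ ^ 2 * (∫ x, ‖fderiv ℝ u x‖ ^ 2 ∂μ) * μ.real (Metric.closedBall 0 δ) := by
  have hgrad : Integrable (fun x => ‖fderiv ℝ u x‖ ^ 2) μ :=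
    ((hu.continuous_fderiv one_ne_zero).norm.pow 2).integrable_of_hasCompactSupport
      (HasCompactSupport.intro (hc.fderiv ℝ) fun x hx => by
        simp [image_eq_zero_of_notMem_tsupport hx])
  have hfin : μ (Metric.closedBall 0 δ) ≠ ⊤ := measure_closedBall_lt_top.ne
  have hshift : ∀ i ∈ S, ∀ x ∈ Q i, ∫⁻ y in Q i, ENNReal.ofReal ((u y - u x) ^ 2) ∂μ ≤
      ∫⁻ h in Metric.closedBall 0 δ, ENNReal.ofReal ((u (x + h) - u x) ^ 2) ∂μ := by
    intro i hi x hx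
    rw [← lintegral_indicator (hQ i hi),
      ← lintegral_indicator Metric.isClosed_closedBall.measurableSet,
      ← lintegral_add_left_eq_self _ x]
    refine lintegral_mono fun h => Set.indicator_apply_le' (fun hh => ?_) fun _ => zero_le
    rw [Set.indicator_of_mem]
    simpa using hdiam i hi _ hh x hx
  have hnonneg : ∀ i x, 0 ≤ ∫ y in Q i, (u y - u x) ^ 2 ∂μ :=
    fun i x => integral_nonneg fun y => sq_nonneg _
  refine (ENNReal.ofReal_le_ofReal_iff (by positivity)).1 ?_
  rw [ENNReal.ofReal_sum_of_nonneg fun i _ => integral_nonneg (hnonneg i),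
    ENNReal.ofReal_mul (by positivity), ENNReal.ofReal_mul (by positivity),
    ofReal_integral_eq_lintegral_ofReal hgrad (ae_of_all _ fun x => sq_nonneg _),
    ofReal_measureReal hfin]
  calc ∑ i ∈ S, ENNReal.ofReal (∫ x in Q i, ∫ y in Q i, (u y - u x) ^ 2 ∂μ ∂μ)
      ≤ ∑ i ∈ S, ∫⁻ x in Q i,
          ∫⁻ h in Metric.closedBall 0 δ, ENNReal.ofReal ((u (x + h) - u x) ^ 2) ∂μ ∂μ :=
        Finset.sum_le_sum fun i hi => (ofReal_integral_le_lintegral (hnonneg i)).trans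
          (setLIntegral_mono' (hQ i hi) fun x hx =>
            (ofReal_integral_le_lintegral fun y => sq_nonneg _).trans (hshift i hi x hx))
    _ ≤ ∫⁻ x, ∫⁻ h in Metric.closedBall 0 δ, ENNReal.ofReal ((u (x + h) - u x) ^ 2) ∂μ ∂μ := by
        rw [← lintegral_biUnion_finset hdisj hQ]
        exact setLIntegral_le_lintegral _ _
    _ ≤ _ := lintegral_closedBall_lintegral_sq_sub_le μ hu

lemma mul_integral_sq_le_sum_sq_setIntegral (hu : ContDiff ℝ 1 u) (hc : HasCompactSupport u)
    (hQ : ∀ i ∈ S, MeasurableSet (Q i)) (hdisj : (S : Set ι).PairwiseDisjoint Q)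
    (hdiam : ∀ i ∈ S, ∀ x ∈ Q i, ∀ y ∈ Q i, dist x y ≤ δ)
    {m : ℝ} (hm : ∀ i ∈ S, μ.real (Q i) = m) (hcover : ∀ x ∉ ⋃ i ∈ S, Q i, u x = 0) :
    m * ∫ x, u x ^ 2 ∂μ ≤ ∑ i ∈ S, (∫ x in Q i, u x ∂μ) ^ 2 +
      δ ^ 2 * (∫ x, ‖fderiv ℝ u x‖ ^ 2 ∂μ) * μ.real (Metric.closedBall 0 δ) := by
  have hLp : MemLp u 2 μ := hu.continuous.memLp_of_hasCompactSupport hc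
  have hcell : ∀ i ∈ S, m * ∫ x in Q i, u x ^ 2 ∂μ ≤
      (∫ x in Q i, u x ∂μ) ^ 2 + ∫ x in Q i, ∫ y in Q i, (u y - u x) ^ 2 ∂μ ∂μ := by
    intro i hi
    have hbdd : Bornology.IsBounded (Q i) :=
      Metric.isBounded_iff.2 ⟨δ, fun x hx y hy => hdiam i hi x hx y hy⟩
    have hfin : IsFiniteMeasure (μ.restrict (Q i)) := ⟨by simpa using hbdd.measure_lt_top⟩
    have hvar := integral_integral_sub_sq (hLp.restrict (Q i))
    have hnonneg : 0 ≤ ∫ x in Q i, ∫ y in Q i, (u y - u x) ^ 2 ∂μ ∂μ :=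
      integral_nonneg fun x => integral_nonneg fun y => sq_nonneg _
    rw [measureReal_restrict_apply_univ, hm i hi] at hvar
    linarith
  have hsplit : ∫ x, u x ^ 2 ∂μ = ∑ i ∈ S, ∫ x in Q i, u x ^ 2 ∂μ := by
    rw [← integral_biUnion_finset S hQ hdisj fun i _ => hLp.integrable_sq.integrableOn]
    exact (setIntegral_eq_integral_of_forall_compl_eq_zero fun x hx => by
      simp [hcover x hx]).symm
  rw [hsplit, Finset.mul_sum]
  refine (Finset.sum_le_sum hcell).trans ?_
  rw [Finset.sum_add_distrib]
  exact add_le_add_right (sum_integral_integral_sub_sq_le μ hu hc hQ hdisj hdiam) _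

end Translation

section Rellich

open BoxIntegral

variable {Ω : Set (E N)}

lemma dist_le_sqrt_mul_dist_ofLp (x y : E N) :
    dist x y ≤ √N * dist (WithLp.ofLp x) (WithLp.ofLp y) := by
  rw [EuclideanSpace.dist_eq, ← Real.sqrt_sq dist_nonneg (x := dist x.ofLp y.ofLp),
    ← Real.sqrt_mul N.cast_nonneg]
  refine Real.sqrt_le_sqrt ((Finset.sum_le_card_nsmul _ _ _ fun i _ =>
    pow_le_pow_left₀ dist_nonneg (dist_le_pi_dist x.ofLp y.ofLp i) 2).trans_eq ?_)
  simp

lemma exists_finset_box_cover (hΩ : Bornology.IsBounded Ω) (m : ℕ) [NeZero m] :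
    ∃ S : Finset (Box (Fin N)),
      (S : Set (Box (Fin N))).PairwiseDisjoint
        (fun I => (WithLp.ofLp ⁻¹' (I : Set (Fin N → ℝ)) : Set (E N))) ∧
      (∀ I ∈ S, volume.real (WithLp.ofLp ⁻¹' (I : Set (Fin N → ℝ)) : Set (E N)) =
        ((m : ℝ) ^ N)⁻¹) ∧
      (∀ I ∈ S, ∀ x y : E N, x.ofLp ∈ I → y.ofLp ∈ I → dist x y ≤ √N / m) ∧
      Ω ⊆ ⋃ I ∈ S, WithLp.ofLp ⁻¹' (I : Set (Fin N → ℝ)) := by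
  obtain ⟨B, hB, hsub⟩ := le_hasIntegralVertices_of_isBounded
    ((PiLp.lipschitzWith_ofLp 2 fun _ : Fin N => ℝ).isBounded_image hΩ)
  have hbox : ∀ I ∈ (unitPartition.prepartition m B).boxes, ∃ ν, unitPartition.box m ν = I :=
    fun I hI => (unitPartition.mem_prepartition_iff.1 hI).imp fun ν => And.right
  refine ⟨(unitPartition.prepartition m B).boxes, fun I hI J hJ hIJ => ?_, fun I hI => ?_,
    fun I hI x y hx hy => ?_, fun x hx => ?_⟩
  · exact ((unitPartition.prepartition m B).pairwiseDisjoint hI hJ hIJ).preimage _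
  · obtain ⟨ν, rfl⟩ := hbox I hI
    rw [measureReal_def, (PiLp.volume_preserving_ofLp (Fin N)).measure_preimage
      (Box.measurableSet_coe _).nullMeasurableSet, unitPartition.volume_box]
    simp
  · obtain ⟨ν, rfl⟩ := hbox I hI
    refine (dist_le_sqrt_mul_dist_ofLp x y).trans ?_
    rw [div_eq_mul_one_div]
    refine mul_le_mul_of_nonneg_left ?_ (Real.sqrt_nonneg _)
    exact (Metric.dist_le_diam_of_mem (Box.isBounded_Icc _) (Box.coe_subset_Icc hx)
      (Box.coe_subset_Icc hy)).trans (unitPartition.diam_boxIcc m ν)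
  · have hpart := unitPartition.prepartition_isPartition m hB
    obtain ⟨I, hI, hxI⟩ := hpart x.ofLp (hsub (Set.mem_image_of_mem _ hx))
    exact Set.mem_biUnion hI hxI

lemma exists_integral_sq_le_sum_sq_setIntegral (hΩ : Bornology.IsBounded Ω) {ε : ℝ} (hε : 0 < ε) :
    ∃ (S : Finset (Box (Fin N))) (c : ℝ), ∀ u, IsTestFunction Ω u →
      ∫ x, u x ^ 2 ≤ c * ∑ I ∈ S, (∫ x in WithLp.ofLp ⁻¹' (I : Set (Fin N → ℝ)), u x) ^ 2 +
        ε * ∫ x, ‖gradient u x‖ ^ 2 := by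
  set κ : ℝ := √N ^ 2 * (√N ^ N * volume.real (Metric.ball (0 : E N) 1)) with hκ
  obtain ⟨m, hm⟩ : ∃ m : ℕ, κ / ε < m := exists_nat_gt _
  obtain ⟨S, hdisj, hvol, hdiam, hcover⟩ := exists_finset_box_cover hΩ (m + 1)
  refine ⟨S, ((m + 1 : ℕ) : ℝ) ^ N, fun u hu => ?_⟩
  have hmain := mul_integral_sq_le_sum_sq_setIntegral volume (hu.contDiff.of_le (by simp))
    hu.hasCompactSupport
    (fun I _ => (PiLp.continuous_ofLp 2 fun _ : Fin N => ℝ).measurable (Box.measurableSet_coe I))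
    hdisj (fun I hI x hx y hy => hdiam I hI x y hx hy) hvol
    (fun x hx => hu.eq_zero_of_notMem fun h => hx (hcover h))
  have ht1 : (1 : ℝ) ≤ (m + 1 : ℕ) := by simp
  have htκ : κ / ε ≤ (m + 1 : ℕ) := hm.le.trans (by simp)
  generalize ((m + 1 : ℕ) : ℝ) = t at *
  have ht : 0 < t := one_pos.trans_le ht1
  have hsmall : κ / t ^ 2 ≤ ε := by
    rw [div_le_iff₀ hε] at htκ
    rw [div_le_iff₀ (by positivity)]
    nlinarith [mul_pos ht hε]
  rw [measureReal_def, Measure.addHaar_closedBall _ _ (by positivity), ENNReal.toReal_mul,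
    ENNReal.toReal_ofReal (by positivity), finrank_euclideanSpace_fin, ← measureReal_def,
    inv_mul_le_iff₀ (by positivity), mul_add] at hmain
  simp only [← norm_gradient] at hmain
  refine hmain.trans (add_le_add_right ?_ _)
  calc _ = κ / t ^ 2 * ∫ x, ‖gradient u x‖ ^ 2 := by
        rw [hκ, div_pow, div_pow]
        field_simp
    _ ≤ ε * ∫ x, ‖gradient u x‖ ^ 2 :=
      mul_le_mul_of_nonneg_right hsmall (integral_nonneg fun x => sq_nonneg _)

lemma exists_strictMono_forall_tendsto {ι : Type*} [Countable ι] {l : ℕ → ι → ℝ} {B : ι → ℝ}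
    (hl : ∀ k i, |l k i| ≤ B i) :
    ∃ s : ℕ → ℕ, StrictMono s ∧
      ∃ L : ι → ℝ, ∀ i, Tendsto (fun k => l (s k) i) atTop (𝓝 (L i)) := by
  obtain ⟨L, -, s, hs, hL⟩ := (isCompact_univ_pi fun i : ι =>
    isCompact_Icc (a := -B i) (b := B i)).isSeqCompact (x := l) fun k i _ => abs_le.1 (hl k i)
  exact ⟨s, hs, L, tendsto_pi_nhds.1 hL⟩

lemma IsTestFunction.abs_setIntegral_le (hΩ : Bornology.IsBounded Ω) {u : E N → ℝ}
    (hu : IsTestFunction Ω u) (s : Set (E N)) :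
    |∫ x in s, u x| ≤ volume.real (closure Ω) + ∫ x, u x ^ 2 := by
  have hΩfin : volume (closure Ω) ≠ ⊤ := hΩ.closure.measure_lt_top.ne
  have hone : Integrable ((closure Ω).indicator fun _ => (1 : ℝ)) :=
    (integrableOn_const hΩfin).integrable_indicator isClosed_closure.measurableSet
  calc |∫ x in s, u x| ≤ ∫ x in s, |u x| := abs_integral_le_integral_abs
    _ ≤ ∫ x, |u x| := setIntegral_le_integral hu.integrable.abs (ae_of_all _ fun x => abs_nonneg _)
    _ ≤ ∫ x, ((closure Ω).indicator (fun _ => (1 : ℝ)) x + u x ^ 2) := by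
        refine integral_mono hu.integrable.abs (hone.add hu.integrable_sq) fun x => ?_
        by_cases hx : x ∈ Ω
        · simp only [Set.indicator_of_mem (subset_closure hx)]
          nlinarith [sq_nonneg (|u x| - 1), sq_abs (u x), abs_nonneg (u x)]
        · simpa [hu.eq_zero_of_notMem hx] using Set.indicator_nonneg (fun _ _ => zero_le_one) x
    _ = volume.real (closure Ω) + ∫ x, u x ^ 2 := by
        rw [integral_add hone hu.integrable_sq,
          integral_indicator isClosed_closure.measurableSet, setIntegral_const, smul_eq_mul,
          mul_one]

lemma IsTestFunction.integral_norm_gradient_sub_sq_le {u v : E N → ℝ} (hu : IsTestFunction Ω u)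
    (hv : IsTestFunction Ω v) :
    ∫ x, ‖gradient (fun y => u y - v y) x‖ ^ 2 ≤
      2 * ((∫ x, ‖gradient u x‖ ^ 2) + ∫ x, ‖gradient v x‖ ^ 2) := by
  rw [← integral_add hu.integrable_norm_gradient_sq hv.integrable_norm_gradient_sq,
    ← integral_const_mul]
  refine integral_mono (hu.sub hv).integrable_norm_gradient_sq
    ((hu.integrable_norm_gradient_sq.add hv.integrable_norm_gradient_sq).const_mul 2) fun x => ?_
  simp only [gradient_fun_sub (hu.differentiable x) (hv.differentiable x)]
  nlinarith [parallelogram_law_with_norm ℝ (gradient u x) (gradient v x),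
    mul_self_nonneg ‖gradient u x + gradient v x‖]

lemma exists_strictMono_tendsto_integral_sq_sub (hΩ : Bornology.IsBounded Ω) {φ : ℕ → E N → ℝ}
    (hφ : ∀ k, IsTestFunction Ω (φ k)) {A : ℝ} (h0 : ∀ k, ∫ x, φ k x ^ 2 ≤ A)
    (h1 : ∀ k, ∫ x, ‖gradient (φ k) x‖ ^ 2 ≤ A) :
    ∃ s : ℕ → ℕ, StrictMono s ∧
      Tendsto (fun p : ℕ × ℕ => ∫ x, (φ (s p.1) x - φ (s p.2) x) ^ 2) atTop (𝓝 0) := by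
  choose S c hSc using fun j : ℕ => exists_integral_sq_le_sum_sq_setIntegral hΩ
    (Nat.one_div_pos_of_nat (α := ℝ) (n := j))
  obtain ⟨s, hs, L, hL⟩ := exists_strictMono_forall_tendsto (ι := Σ j, S j)
    (l := fun k q => ∫ x in WithLp.ofLp ⁻¹' ((q.2 : Box (Fin N)) : Set (Fin N → ℝ)), φ k x)
    fun k q => ((hφ k).abs_setIntegral_le hΩ _).trans (add_le_add_right (h0 k) _)
  refine ⟨s, hs, tendsto_order.2 ⟨fun b hb => Eventually.of_forall fun p =>
    hb.trans_le (integral_nonneg fun x => sq_nonneg _), fun ε hε => ?_⟩⟩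
  obtain ⟨j, hj⟩ : ∃ j : ℕ, 1 / ((j : ℝ) + 1) * (4 * A) < ε / 2 := by
    have h := (tendsto_one_div_add_atTop_nhds_zero_nat (𝕜 := ℝ)).mul_const (4 * A)
    rw [zero_mul] at h
    exact (h.eventually (gt_mem_nhds (half_pos hε))).exists
  have hlim : Tendsto (fun p : ℕ × ℕ => c j * ∑ I ∈ (S j).attach,
      (∫ x in WithLp.ofLp ⁻¹' ((I : Box (Fin N)) : Set (Fin N → ℝ)),
        (φ (s p.1) x - φ (s p.2) x)) ^ 2) atTop (𝓝 0) := by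
    rw [← prod_atTop_atTop_eq]
    simp only [integral_sub (hφ _).integrable.integrableOn (hφ _).integrable.integrableOn]
    simpa using (tendsto_finsetSum (S j).attach fun I _ =>
      (((hL ⟨j, I⟩).comp tendsto_fst).sub ((hL ⟨j, I⟩).comp tendsto_snd)).pow 2).const_mul (c j)
  filter_upwards [hlim.eventually (gt_mem_nhds (half_pos hε))] with p hp
  have hgrad := (hφ (s p.1)).integral_norm_gradient_sub_sq_le (hφ (s p.2))
  have hest := hSc j _ ((hφ (s p.1)).sub (hφ (s p.2)))
  rw [← Finset.sum_attach] at hest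
  have hj0 : 0 ≤ 1 / ((j : ℝ) + 1) := by positivity
  nlinarith [h1 (s p.1), h1 (s p.2)]

end Rellich

/-! ### The multipolar potential -/

section Potential

variable {a : Fin n → E N} {x : E N}

lemma two_mul_V (a : Fin n → E N) (x : E N) :
    2 * V a x = ∑ i, ∑ j, ‖a i - a j‖ ^ 2 / (‖x - a i‖ ^ 2 * ‖x - a j‖ ^ 2) := by
  have h := Finset.sum_sum_Ioi_add_eq_sum_sum_off_diag
    fun i j => ‖a i - a j‖ ^ 2 / (‖x - a i‖ ^ 2 * ‖x - a j‖ ^ 2)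
  have hsymm : ∀ i j, ‖a j - a i‖ ^ 2 / (‖x - a j‖ ^ 2 * ‖x - a i‖ ^ 2) =
      ‖a i - a j‖ ^ 2 / (‖x - a i‖ ^ 2 * ‖x - a j‖ ^ 2) := fun i j => by
    rw [norm_sub_rev, mul_comm]
  simp only [hsymm, ← two_mul, ← Finset.mul_sum] at h
  rw [V, h]
  refine Finset.sum_congr rfl fun i _ => Finset.sum_subset (Finset.subset_univ _) fun j _ hj => ?_
  rw [Finset.mem_compl, Finset.mem_singleton, not_not] at hj
  simp [hj]

lemma V_nonneg (a : Fin n → E N) (x : E N) : 0 ≤ V a x :=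
  Finset.sum_nonneg fun i _ => Finset.sum_nonneg fun j _ => by positivity

lemma V_pos (hn : 2 ≤ n) (ha : Function.Injective a) (hx : ∀ i, x ≠ a i) : 0 < V a x := by
  have h : 0 < 2 * V a x := by
    rw [two_mul_V]
    refine Finset.sum_pos' (fun i _ => Finset.sum_nonneg fun j _ => by positivity)
      ⟨⟨0, by omega⟩, Finset.mem_univ _, Finset.sum_pos' (fun j _ => by positivity)
        ⟨⟨1, by omega⟩, Finset.mem_univ _, ?_⟩⟩
    exact div_pos (norm_sub_sq_pos (ha.ne (by simp)))
      (mul_pos (norm_sub_sq_pos (hx _)) (norm_sub_sq_pos (hx _)))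
  linarith

lemma continuousOn_V {Ω : Set (E N)} (haΩ : ∀ i, a i ∉ Ω) : ContinuousOn (V a) Ω :=
  continuousOn_finsetSum _ fun i _ => continuousOn_finsetSum _ fun j _ =>
    ContinuousOn.div (by fun_prop) (by fun_prop) fun _ hx =>
      (mul_pos (norm_sub_sq_pos (ne_of_mem_of_not_mem hx (haΩ i)))
        (norm_sub_sq_pos (ne_of_mem_of_not_mem hx (haΩ j)))).ne'

lemma measurable_V (a : Fin n → E N) : Measurable (V a) := by
  unfold V
  fun_prop

lemma V_eq (hx : ∀ i, x ≠ a i) :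
    V a x = n * ∑ i, (‖x - a i‖ ^ 2)⁻¹ - ‖∑ i, logGrad (a i) x‖ ^ 2 := by
  have hterm : ∀ i j, ‖a i - a j‖ ^ 2 / (‖x - a i‖ ^ 2 * ‖x - a j‖ ^ 2) =
      (‖x - a i‖ ^ 2)⁻¹ + (‖x - a j‖ ^ 2)⁻¹ - 2 * ⟪logGrad (a i) x, logGrad (a j) x⟫ := by
    intro i j
    rw [← norm_logGrad_sub_sq (hx i) (hx j), norm_sub_sq_real, norm_logGrad_sq, norm_logGrad_sq]
    ring
  refine mul_left_cancel₀ (two_ne_zero (α := ℝ)) ?_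
  rw [two_mul_V]
  simp only [hterm, Finset.sum_sub_distrib, Finset.sum_add_distrib, Finset.sum_const,
    ← Finset.mul_sum, ← inner_sum, ← sum_inner, Finset.card_univ, Fintype.card_fin, nsmul_eq_mul,
    real_inner_self_eq_norm_sq]
  ring

lemma exists_V_le (a : Fin n → E N) {r : ℝ} (hr : 0 < r) :
    ∃ C : ℝ, 0 ≤ C ∧ ∀ x, (∀ i, r ≤ ‖x - a i‖) → V a x ≤ C := by
  refine ⟨∑ i, ∑ j ∈ Finset.Ioi i, ‖a i - a j‖ ^ 2 / (r ^ 2 * r ^ 2),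
    Finset.sum_nonneg fun i _ => Finset.sum_nonneg fun j _ => by positivity, fun x hx => ?_⟩
  refine Finset.sum_le_sum fun i _ => Finset.sum_le_sum fun j _ => ?_
  gcongr
  exacts [hx i, hx j]

lemma eventually_forall_ne (ha : Function.Injective a) (k : Fin n) :
    ∀ᶠ x in 𝓝[≠] (a k), ∀ i, x ≠ a i := by
  refine eventually_all.2 fun i => ?_
  rcases eq_or_ne i k with rfl | hik
  · exact eventually_mem_nhdsWithin
  · exact (eventually_ne_nhds (ha.ne hik.symm)).filter_mono nhdsWithin_le_nhds

lemma tendsto_norm_sub_smul_logGrad {b c : E N} (h : b ≠ c) :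
    Tendsto (fun x => ‖x - b‖ • logGrad c x) (𝓝[≠] b) (𝓝 0) := by
  have hcont : ContinuousAt (fun x => ‖x - b‖ • logGrad c x) b :=
    (continuous_id.sub continuous_const).norm.continuousAt.smul
      (contDiffAt_logGrad (m := 0) h).continuousAt
  simpa using hcont.tendsto.mono_left nhdsWithin_le_nhds

/- After rescaling by `‖x - a k‖`, the log-gradient of the pole `a k` is a unit vector and those of
the other poles vanish in the limit; `V_eq` then gives `n * 1 - 1`. -/
lemma tendsto_norm_sub_sq_mul_V (ha : Function.Injective a) (k : Fin n) :
    Tendsto (fun x => ‖x - a k‖ ^ 2 * V a x) (𝓝[≠] (a k)) (𝓝 (n - 1)) := by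
  let e : Fin n → E N → E N := fun i x => ‖x - a k‖ • logGrad (a i) x
  have hsq : ∀ x i, ‖x - a k‖ ^ 2 * (‖x - a i‖ ^ 2)⁻¹ = ‖e i x‖ ^ 2 := fun x i => by
    rw [norm_smul, mul_pow, norm_norm, norm_logGrad_sq]
  have hunit : ∀ᶠ x in 𝓝[≠] (a k), ‖e k x‖ = 1 := by
    filter_upwards [eventually_mem_nhdsWithin] with x hx
    rw [norm_smul, norm_norm, norm_logGrad, mul_inv_cancel₀ (norm_ne_zero_iff.2 (sub_ne_zero.2 hx))]
  have hrest : ∀ i ∈ Finset.univ.erase k, Tendsto (e i) (𝓝[≠] (a k)) (𝓝 0) := fun i hi =>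
    tendsto_norm_sub_smul_logGrad (ha.ne (Finset.ne_of_mem_erase hi).symm)
  have hsum : Tendsto (fun x => ∑ i, ‖e i x‖ ^ 2) (𝓝[≠] (a k)) (𝓝 1) := by
    simp only [← Finset.add_sum_erase _ _ (Finset.mem_univ k)]
    have h1 : Tendsto (fun x => ‖e k x‖ ^ 2) (𝓝[≠] (a k)) (𝓝 1) :=
      tendsto_const_nhds.congr' (hunit.mono fun x hx => by simp [hx])
    simpa using h1.add (tendsto_finsetSum _ fun i hi => ((hrest i hi).norm.pow 2))
  have hnorm : Tendsto (fun x => ‖∑ i, e i x‖) (𝓝[≠] (a k)) (𝓝 1) := by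
    simp only [← Finset.add_sum_erase _ _ (Finset.mem_univ k)]
    have h0 : Tendsto (fun x => ‖∑ i ∈ Finset.univ.erase k, e i x‖) (𝓝[≠] (a k)) (𝓝 0) := by
      simpa using (tendsto_finsetSum _ hrest).norm
    have h1 : Tendsto (fun x => ‖e k x‖) (𝓝[≠] (a k)) (𝓝 1) :=
      tendsto_const_nhds.congr' (hunit.mono fun x hx => hx.symm)
    refine tendsto_of_tendsto_of_dist h1 (squeeze_zero (fun x => dist_nonneg) (fun x => ?_) h0)
    rw [dist_comm, Real.dist_eq]
    simpa using abs_norm_sub_norm_le (e k x + ∑ i ∈ Finset.univ.erase k, e i x) (e k x)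
  have hlim := (hsum.const_mul (n : ℝ)).sub (hnorm.pow 2)
  rw [mul_one, one_pow] at hlim
  refine hlim.congr' ?_
  filter_upwards [eventually_forall_ne ha k] with x hx
  rw [V_eq hx, ← Finset.smul_sum, norm_smul, mul_pow, norm_norm, mul_sub, mul_left_comm,
    Finset.mul_sum (f := fun i => (‖x - a i‖ ^ 2)⁻¹)]
  simp only [hsq]

end Potential

/-! ### The multipolar Hardy inequality with remainder -/

section Remainder

variable {Ω : Set (E N)} {a : Fin n → E N}

lemma IsTestFunction.integrable_norm_gradient_sub_smul_sq (hΩ : IsOpen Ω) {u : E N → ℝ}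
    (hu : IsTestFunction Ω u) {X : E N → E N} (hX : ContinuousOn X Ω) :
    Integrable fun x => ‖gradient u x - u x • X x‖ ^ 2 :=
  hu.integrable_of_continuousOn hΩ ((hu.continuous_gradient.continuousOn.sub
    (hu.continuous.continuousOn.smul hX)).norm.pow 2) fun x hx => by
      simp [image_eq_zero_of_notMem_tsupport hx, gradient_eq_zero_of_notMem_tsupport hx]

/- Since `X = -∇ log ψ`, the product `u ψ` has gradient `ψ (∇u - u X)`, and Poincaré's inequality
for `u ψ` bounds the square completed in the Hardy inequality from below. -/
lemma exists_integral_sq_mul_sq_le (hN : N ≠ 0) (hΩ : IsOpen Ω) (hb : Bornology.IsBounded Ω)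
    {ψ : E N → ℝ} {X : E N → E N} {M : ℝ} (hψ : ContDiffOn ℝ ∞ ψ Ω) (hX : ContinuousOn X Ω)
    (hψX : ∀ x ∈ Ω, HasGradientAt ψ (-(ψ x • X x)) x) (hM : ∀ x ∈ Ω, |ψ x| ≤ M) :
    ∃ c : ℝ, 0 < c ∧ ∀ u, IsTestFunction Ω u →
      c * ∫ x, ψ x ^ 2 * u x ^ 2 ≤ ∫ x, ‖gradient u x - u x • X x‖ ^ 2 := by
  obtain ⟨R, hR0, hR⟩ := hb.exists_pos_norm_le
  refine ⟨(N / (2 * R)) ^ 2 / (M ^ 2 + 1), by positivity, fun u hu => ?_⟩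
  have hv := hu.mul_contDiffOn hΩ hψ
  have hgrad : ∀ x, ‖gradient (fun y => u y * ψ y) x‖ ^ 2 ≤
      (M ^ 2 + 1) * ‖gradient u x - u x • X x‖ ^ 2 := by
    intro x
    by_cases hx : x ∈ Ω
    · have hprod : gradient (fun y => u y * ψ y) x = ψ x • (gradient u x - u x • X x) := by
        rw [(hasGradientAt_mul (hu.hasGradientAt x) (hψX x hx)).gradient]
        module
      rw [hprod, norm_smul, mul_pow, Real.norm_eq_abs]
      exact mul_le_mul_of_nonneg_right
        ((pow_le_pow_left₀ (abs_nonneg _) (hM x hx) 2).trans (lt_add_one _).le) (sq_nonneg _)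
    · rw [hv.gradient_eq_zero_of_notMem hx, norm_zero, zero_pow two_ne_zero]
      positivity
  rw [div_mul_eq_mul_div, div_le_iff₀' (by positivity)]
  calc (N / (2 * R)) ^ 2 * ∫ x, ψ x ^ 2 * u x ^ 2
      = (N / (2 * R)) ^ 2 * ∫ x, (u x * ψ x) ^ 2 := by simp only [mul_pow, mul_comm]
    _ ≤ ∫ x, ‖gradient (fun y => u y * ψ y) x‖ ^ 2 := poincare_of_norm_le hΩ hR hv
    _ ≤ ∫ x, (M ^ 2 + 1) * ‖gradient u x - u x • X x‖ ^ 2 :=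
        integral_mono hv.integrable_norm_gradient_sq
          ((hu.integrable_norm_gradient_sub_smul_sq hΩ hX).const_mul _) hgrad
    _ = (M ^ 2 + 1) * ∫ x, ‖gradient u x - u x • X x‖ ^ 2 := integral_const_mul _ _

lemma divergence_sum_logGrad {x : E N} (hx : ∀ i, x ≠ a i) :
    divergence (fun y => ∑ i, logGrad (a i) y) x = (N - 2) * ∑ i, (‖x - a i‖ ^ 2)⁻¹ := by
  rw [divergence_sum _ fun i _ => (contDiffAt_logGrad (m := 1) (hx i)).differentiableAt one_ne_zero,
    Finset.mul_sum]
  refine Finset.sum_congr rfl fun i _ => ?_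
  rw [divergence_logGrad (hx i), finrank_euclideanSpace_fin]

/- The constant `(N - 2) / n` is the one for which the poles `∑ i, ‖x - a i‖⁻²` in `V_eq` and in the
divergence cancel. -/
lemma divergence_add_norm_sq_sum_logGrad (hn : n ≠ 0) {x : E N} (hx : ∀ i, x ≠ a i) :
    divergence (fun y => (-((N - 2) / n : ℝ)) • ∑ i, logGrad (a i) y) x +
      ‖(-((N - 2) / n : ℝ)) • ∑ i, logGrad (a i) x‖ ^ 2 = -((N - 2) ^ 2 / n ^ 2 * V a x) := by
  rw [divergence_const_smul (DifferentiableAt.fun_sum fun i _ =>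
    (contDiffAt_logGrad (m := 1) (hx i)).differentiableAt one_ne_zero), divergence_sum_logGrad hx,
    V_eq hx, norm_smul, mul_pow, Real.norm_eq_abs, sq_abs]
  field_simp
  ring

lemma exists_multipolar_hardy_remainder (hN : 2 ≤ N) (hn : n ≠ 0) (hΩ : IsOpen Ω)
    (hb : Bornology.IsBounded Ω) (haΩ : ∀ i, a i ∉ Ω) :
    ∃ w : E N → ℝ, ContinuousOn w Ω ∧ (∀ x ∈ Ω, 0 < w x) ∧ ∀ u, IsTestFunction Ω u →
      (N - 2) ^ 2 / n ^ 2 * (∫ x, V a x * u x ^ 2) + ∫ x, w x * u x ^ 2 ≤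
        ∫ x, ‖gradient u x‖ ^ 2 := by
  obtain ⟨R, hR⟩ := hb.exists_norm_le
  have hne : ∀ x ∈ Ω, ∀ i, x ≠ a i := fun x hx i => ne_of_mem_of_not_mem hx (haΩ i)
  set β : ℝ := (N - 2) / n
  have hβ : 0 ≤ β := div_nonneg (sub_nonneg.2 (by exact_mod_cast hN)) n.cast_nonneg
  let ψ : E N → ℝ := fun x => Real.exp (β * ∑ i, Real.log ‖x - a i‖)
  let X : E N → E N := fun x => -β • ∑ i, logGrad (a i) x
  have hψ : ContDiffOn ℝ ∞ ψ Ω := fun x hx => (contDiffAt_const.mul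
    (ContDiffAt.sum fun i _ => contDiffAt_log_norm_sub (hne x hx i))).exp.contDiffWithinAt
  have hX : ContDiffOn ℝ 1 X Ω := fun x hx => ContDiffAt.contDiffWithinAt
    (.const_smul (-β) (.sum fun i _ => contDiffAt_logGrad (hne x hx i)))
  have hψX : ∀ x ∈ Ω, HasGradientAt ψ (-(ψ x • X x)) x := by
    intro x hx
    convert hasGradientAt_comp ((hasDerivAt_const_mul β).exp)
      (hasGradientAt_sum _ fun i _ => hasGradientAt_log_norm_sub (hne x hx i)) using 1
    simp only [X, smul_smul, ← neg_smul]
    congr 1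
    ring
  have hM : ∀ x ∈ Ω, |ψ x| ≤ Real.exp (β * ∑ i, Real.log (R + ‖a i‖)) := fun x hx => by
    rw [Real.abs_exp]
    gcongr with i
    · exact norm_pos_iff.2 (sub_ne_zero.2 (hne x hx i))
    · exact (norm_sub_le _ _).trans (by gcongr; exact hR x hx)
  obtain ⟨c, hc, hcu⟩ :=
    exists_integral_sq_mul_sq_le (by omega) hΩ hb hψ hX.continuousOn hψX hM
  refine ⟨fun x => c * ψ x ^ 2, continuousOn_const.mul (hψ.continuousOn.pow 2),
    fun x _ => by positivity, fun u hu => ?_⟩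
  have hV : ∫ x, (divergence X x + ‖X x‖ ^ 2) * u x ^ 2 =
      -((N - 2) ^ 2 / n ^ 2 * ∫ x, V a x * u x ^ 2) := by
    rw [← integral_const_mul, ← integral_neg]
    refine integral_congr_ae (ae_of_all _ fun x => ?_)
    by_cases hx : x ∈ Ω
    · simp only [X, β, divergence_add_norm_sq_sum_logGrad hn (hne x hx)]; ring
    · simp [hu.eq_zero_of_notMem hx]
  have hsquare := hcu u hu
  rw [integral_norm_gradient_sub_smul_sq hΩ hu hX, hV] at hsquare
  simp only [mul_assoc, integral_const_mul]
  linarith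

end Remainder

/-! ### The Hardy inequality with a pole on the boundary -/

lemma exists_eventually_norm_taylor_le {F G : Type*} [NormedAddCommGroup F] [NormedSpace ℝ F]
    [NormedAddCommGroup G] [NormedSpace ℝ G] {f : F → G} {p : F} (hf : ContDiffAt ℝ 2 f p) :
    ∃ K : ℝ, 0 ≤ K ∧ ∀ᶠ x in 𝓝 p, ‖f p - f x - fderiv ℝ f x (p - x)‖ ≤ K * ‖x - p‖ ^ 2 := by
  obtain ⟨K, t, ht, hlip⟩ :=
    (hf.fderiv_right (m := 1) (by norm_num)).exists_lipschitzOnWith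
  have hdiff : ∀ᶠ x in 𝓝 p, DifferentiableAt ℝ f x :=
    (hf.eventually (by simp)).mono fun x hx => hx.differentiableAt two_ne_zero
  obtain ⟨r, hr, hball⟩ := Metric.mem_nhds_iff.1 (inter_mem ht hdiff)
  refine ⟨2 * K, by positivity, ?_⟩
  filter_upwards [Metric.ball_mem_nhds p hr] with x hx
  have hsub : Metric.closedBall p ‖x - p‖ ⊆ Metric.ball p r :=
    Metric.closedBall_subset_ball (by rwa [← dist_eq_norm])
  have hmvt := (convex_closedBall p ‖x - p‖).norm_image_sub_le_of_norm_hasFDerivWithin_le'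
    (φ := fderiv ℝ f x) (C := K * (2 * ‖x - p‖))
    (fun z hz => (hball (hsub hz)).2.hasFDerivAt.hasFDerivWithinAt)
    (fun z hz => by
      rw [← dist_eq_norm]
      refine (hlip.dist_le_mul z (hball (hsub hz)).1 x (hball hx).1).trans ?_
      gcongr
      rw [two_mul, ← dist_eq_norm]
      exact (dist_triangle_right _ _ p).trans
        (add_le_add_left ((Metric.mem_closedBall.1 hz).trans_eq (dist_eq_norm _ _).symm) _))
    (x := x) (y := p) (by simp [dist_eq_norm]) (by simp)
  refine hmvt.trans_eq ?_
  rw [norm_sub_rev p x]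
  ring

section Gradient

variable {F : Type*} [NormedAddCommGroup F] [InnerProductSpace ℝ F] [FiniteDimensional ℝ F]
  {σ ρ : F → ℝ} {p x : F}

/- The field is the gradient of `log (σ / ‖· - p‖ ^ (d / 2))`, with `d` the dimension. -/
lemma divergence_add_norm_sq_inv_smul_gradient_sub_logGrad (hσ : ContDiffAt ℝ 2 σ x)
    (h0 : σ x ≠ 0) (hx : x ≠ p) :
    divergence (fun y => (σ y)⁻¹ • gradient σ y +
        (-(Module.finrank ℝ F / 2 : ℝ)) • logGrad p y) x +
      ‖(σ x)⁻¹ • gradient σ x + (-(Module.finrank ℝ F / 2 : ℝ)) • logGrad p x‖ ^ 2 =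
    (σ x)⁻¹ * (divergence (gradient σ) x -
        Module.finrank ℝ F * (⟪gradient σ x, x - p⟫ - σ x) * (‖x - p‖ ^ 2)⁻¹) -
      (Module.finrank ℝ F : ℝ) ^ 2 / 4 * (‖x - p‖ ^ 2)⁻¹ := by
  have hinv : HasGradientAt (fun y => (σ y)⁻¹) (-(σ x ^ 2)⁻¹ • gradient σ x) x :=
    hasGradientAt_comp (hasDerivAt_inv h0) (hσ.differentiableAt two_ne_zero).hasGradientAt
  have hgrad : DifferentiableAt ℝ (gradient σ) x :=
    (contDiffAt_gradient hσ (k := 1) (by norm_num)).differentiableAt one_ne_zero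
  have hlog : DifferentiableAt ℝ (logGrad p) x :=
    (contDiffAt_logGrad (m := 1) hx).differentiableAt one_ne_zero
  rw [divergence_add (hinv.differentiableAt.fun_smul hgrad) (hlog.fun_const_smul _),
    divergence_smul hinv hgrad, divergence_const_smul hlog, divergence_logGrad hx,
    norm_add_sq_real, norm_smul, norm_smul, mul_pow, mul_pow, norm_logGrad_sq,
    real_inner_smul_left, real_inner_smul_left, real_inner_smul_right, real_inner_self_eq_norm_sq,
    logGrad, real_inner_smul_right, Real.norm_eq_abs, Real.norm_eq_abs, sq_abs, sq_abs]
  field_simp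
  ring

lemma hasGradientAt_sub_const_mul_sq (hρ : DifferentiableAt ℝ ρ x) (M : ℝ) :
    HasGradientAt (fun y => ρ y - M * ρ y ^ 2) ((1 - 2 * M * ρ x) • gradient ρ x) x := by
  have h : HasDerivAt (fun t => t - M * t ^ 2) (1 - 2 * M * ρ x) (ρ x) :=
    ((hasDerivAt_id (ρ x)).sub ((hasDerivAt_pow 2 (ρ x)).const_mul M)).congr_deriv
      (by simp; ring)
  exact hasGradientAt_comp h hρ.hasGradientAt

lemma divergence_gradient_sub_const_mul_sq (hρ : ContDiffAt ℝ 2 ρ x) (M : ℝ) :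
    divergence (gradient fun y => ρ y - M * ρ y ^ 2) x =
      (1 - 2 * M * ρ x) * divergence (gradient ρ) x - 2 * M * ‖gradient ρ x‖ ^ 2 := by
  have heq : gradient (fun y => ρ y - M * ρ y ^ 2) =ᶠ[𝓝 x]
      fun y => (1 - 2 * M * ρ y) • gradient ρ y :=
    (hρ.eventually (by simp)).mono fun y hy =>
      (hasGradientAt_sub_const_mul_sq (hy.differentiableAt two_ne_zero) M).gradient
  have hcoeff : HasGradientAt (fun y => 1 - 2 * M * ρ y) ((-(2 * M)) • gradient ρ x) x :=
    hasGradientAt_comp (f := fun t => 1 - 2 * M * t) ((hasDerivAt_const_mul (2 * M)).const_sub 1)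
      (hρ.differentiableAt two_ne_zero).hasGradientAt
  rw [divergence, heq.fderiv_eq, ← divergence, divergence_smul hcoeff
    ((contDiffAt_gradient hρ (k := 1) (by norm_num)).differentiableAt one_ne_zero),
    real_inner_smul_left, real_inner_self_eq_norm_sq]
  ring

end Gradient

lemma exists_eventually_defining_bounds {F : Type*} [NormedAddCommGroup F] [InnerProductSpace ℝ F]
    [FiniteDimensional ℝ F] {ρ : F → ℝ} {p : F} (hρ : ContDiffAt ℝ 2 ρ p)
    (h0 : ρ p = 0) (hg : gradient ρ p ≠ 0) :
    ∃ c K : ℝ, 0 < c ∧ 0 ≤ K ∧ ∀ᶠ x in 𝓝 p, c ≤ ‖gradient ρ x‖ ^ 2 ∧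
      |divergence (gradient ρ) x| ≤ K ∧ |⟪gradient ρ x, x - p⟫ - ρ x| ≤ K * ‖x - p‖ ^ 2 := by
  obtain ⟨K, hK, htaylor⟩ := exists_eventually_norm_taylor_le hρ
  have hgrad : ContDiffAt ℝ 1 (gradient ρ) p := contDiffAt_gradient hρ (by norm_num)
  have hdiv : ContinuousAt (divergence (gradient ρ)) p := by
    obtain ⟨U, hU, hUo, hpU⟩ := eventually_nhds_iff.1 (hgrad.eventually (by simp))
    exact (continuousOn_divergence hUo fun x hx => (hU x hx).contDiffWithinAt).continuousAt
      (hUo.mem_nhds hpU)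
  have hpos : 0 < ‖gradient ρ p‖ ^ 2 := pow_pos (norm_pos_iff.2 hg) 2
  refine ⟨‖gradient ρ p‖ ^ 2 / 2, max (|divergence (gradient ρ) p| + 1) K, half_pos hpos,
    hK.trans (le_max_right _ _), ?_⟩
  filter_upwards [htaylor, (hgrad.continuousAt.norm.pow 2).eventually_const_lt (half_lt_self hpos),
    hdiv.abs.eventually_lt_const (lt_add_one _)] with x hx hc hd
  refine ⟨hc.le, hd.le.trans (le_max_left _ _), ?_⟩
  have hsymm : ρ p - ρ x - fderiv ℝ ρ x (p - x) = ⟪gradient ρ x, x - p⟫ - ρ x := by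
    rw [inner_gradient_left, h0, ← neg_sub x p, map_neg]
    ring
  rw [hsymm, Real.norm_eq_abs] at hx
  exact hx.trans (by gcongr; exact le_max_right _ _)

/- `σ = ρ - M ρ²` with `M` large: the term `-2 M ‖∇ρ‖²` in `Δσ` absorbs all second order errors,
and `-M ρ²` is small compared with `σ`. -/
lemma exists_superharmonic_defining {F : Type*} [NormedAddCommGroup F] [InnerProductSpace ℝ F]
    [FiniteDimensional ℝ F] {ρ : F → ℝ} {p : F} (hρ : ContDiffAt ℝ 2 ρ p)
    (h0 : ρ p = 0) (hg : gradient ρ p ≠ 0) {ν ε : ℝ} (hν : 0 ≤ ν) (hε : 0 < ε) :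
    ∃ σ : F → ℝ, ∀ᶠ x in 𝓝 p, ContDiffAt ℝ 2 σ x ∧ (0 < ρ x → 0 < σ x ∧
      ‖x - p‖ ^ 2 * divergence (gradient σ) x ≤
        ν * (⟪gradient σ x, x - p⟫ - σ x) + ε * σ x) := by
  obtain ⟨c, K, hc, hK, hbounds⟩ := exists_eventually_defining_bounds hρ h0 hg
  set M : ℝ := (K + ν * K) / (2 * c)
  have hM : 0 ≤ M := by positivity
  have hMc : 2 * M * c = K + ν * K := by simp only [M]; field_simp
  have hsmall : ∀ C : ℝ, ∀ δ > 0, ∀ᶠ x in 𝓝 p, C * ρ x < δ := fun C δ hδ =>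
    (hρ.continuousAt.const_mul C).eventually_lt_const (by simpa [h0] using hδ)
  refine ⟨fun x => ρ x - M * ρ x ^ 2, ?_⟩
  filter_upwards [hbounds, hρ.eventually (by simp), hsmall (2 * M) 1 one_pos,
    hsmall (ν * M) (ε / 2) (half_pos hε)] with x ⟨hcx, hdx, hmx⟩ hCx h2M hνM
  refine ⟨hCx.sub (contDiffAt_const.mul (hCx.pow 2)), fun ht => ?_⟩
  have hσ : ρ x / 2 ≤ ρ x - M * ρ x ^ 2 := by nlinarith
  refine ⟨(half_pos ht).trans_le hσ, ?_⟩
  rw [divergence_gradient_sub_const_mul_sq hCx,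
    (hasGradientAt_sub_const_mul_sq (hCx.differentiableAt two_ne_zero) M).gradient,
    real_inner_smul_left]
  set s := ‖x - p‖ ^ 2
  set m := ⟪gradient ρ x, x - p⟫
  have hs : 0 ≤ s := sq_nonneg _
  have hg0 : 0 ≤ 1 - 2 * M * ρ x := by linarith
  have hg1 : 1 - 2 * M * ρ x ≤ 1 := by linarith [mul_nonneg (mul_nonneg two_pos.le hM) ht.le]
  have hlaplace : (1 - 2 * M * ρ x) * divergence (gradient ρ) x - 2 * M * ‖gradient ρ x‖ ^ 2 ≤
      -(ν * K) := by
    have h1 : (1 - 2 * M * ρ x) * divergence (gradient ρ) x ≤ 1 * K :=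
      (mul_le_mul_of_nonneg_left (abs_le.1 hdx).2 hg0).trans (mul_le_mul_of_nonneg_right hg1 hK)
    have h2 : 2 * M * c ≤ 2 * M * ‖gradient ρ x‖ ^ 2 := by gcongr
    linarith
  have hradial : -(K * s) ≤ (1 - 2 * M * ρ x) * (m - ρ x) := by
    have h1 := mul_le_mul_of_nonneg_left (abs_le.1 hmx).1 hg0
    have h2 := mul_le_mul_of_nonneg_right hg1 (mul_nonneg hK hs)
    linarith
  calc _ ≤ s * -(ν * K) := mul_le_mul_of_nonneg_left hlaplace hs
    _ ≤ ν * ((1 - 2 * M * ρ x) * (m - ρ x)) + (ε / 2 - ν * M * ρ x) * ρ x := by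
        linarith [mul_le_mul_of_nonneg_left hradial hν, mul_nonneg (sub_nonneg.2 hνM.le) ht.le]
    _ ≤ _ := by linarith [mul_le_mul_of_nonneg_left hσ hε.le]

section

variable {Ω : Set (E N)} {p : E N}

lemma hardy_of_superharmonic (hΩ : IsOpen Ω) (hp : p ∉ Ω) {σ : E N → ℝ} {ε : ℝ}
    (hσ : ∀ x ∈ Ω, ContDiffAt ℝ 2 σ x) (hpos : ∀ x ∈ Ω, 0 < σ x)
    (hsuper : ∀ x ∈ Ω, ‖x - p‖ ^ 2 * divergence (gradient σ) x ≤
      N * (⟪gradient σ x, x - p⟫ - σ x) + ε * σ x) {u : E N → ℝ} (hu : IsTestFunction Ω u) :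
    ((N : ℝ) ^ 2 / 4 - ε) * ∫ x, (‖x - p‖ ^ 2)⁻¹ * u x ^ 2 ≤ ∫ x, ‖gradient u x‖ ^ 2 := by
  have hne : ∀ x ∈ Ω, x ≠ p := fun x hx h => hp (h ▸ hx)
  let X : E N → E N := fun x => (σ x)⁻¹ • gradient σ x + (-(N / 2 : ℝ)) • logGrad p x
  have hX : ContDiffOn ℝ 1 X Ω := fun x hx => ContDiffAt.contDiffWithinAt <|
    ((((hσ x hx).of_le one_le_two).inv (hpos x hx).ne').smul
      (contDiffAt_gradient (hσ x hx) (by norm_num))).add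
      ((contDiffAt_logGrad (hne x hx)).const_smul (-(N / 2 : ℝ)))
  have hW : ContinuousOn (fun x => ((N : ℝ) ^ 2 / 4 - ε) * (‖x - p‖ ^ 2)⁻¹) Ω :=
    continuousOn_const.mul (ContinuousOn.inv₀ (by fun_prop) fun x hx =>
      (norm_sub_sq_pos (hne x hx)).ne')
  have key : ∀ x ∈ Ω, ((N : ℝ) ^ 2 / 4 - ε) * (‖x - p‖ ^ 2)⁻¹ ≤ -(divergence X x + ‖X x‖ ^ 2) := by
    intro x hx
    have hs := norm_sub_sq_pos (hne x hx)
    have heq := divergence_add_norm_sq_inv_smul_gradient_sub_logGrad (hσ x hx) (hpos x hx).ne'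
      (hne x hx)
    rw [finrank_euclideanSpace_fin] at heq
    have hle : (σ x)⁻¹ * (divergence (gradient σ) x -
        N * (⟪gradient σ x, x - p⟫ - σ x) * (‖x - p‖ ^ 2)⁻¹) ≤ ε * (‖x - p‖ ^ 2)⁻¹ := by
      rw [inv_mul_le_iff₀ (hpos x hx), sub_le_iff_le_add, ← div_eq_mul_inv, ← div_eq_mul_inv,
        mul_div_assoc', ← add_div, le_div_iff₀ hs]
      linarith [hsuper x hx]
    simp only [X, heq]
    linarith
  rw [← integral_const_mul]
  simpa only [mul_assoc] using integral_mul_sq_le_of_divergence hΩ hu hX hW key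

/-- `p` is a boundary point of `Ω` near which `Ω` is the positivity set of a `C²` function whose
gradient does not vanish at `p`: the only regularity of `Ω` that Hardy inequalities with a pole
at `p` depend on. -/
def IsC2BoundaryPoint (Ω : Set (E N)) (p : E N) : Prop :=
  ∃ ρ : E N → ℝ, ContDiffAt ℝ 2 ρ p ∧ ρ p = 0 ∧ gradient ρ p ≠ 0 ∧
    ∀ᶠ x in 𝓝 p, (x ∈ Ω ↔ 0 < ρ x)

lemma IsC2BoundaryPoint.notMem (hp : IsC2BoundaryPoint Ω p) : p ∉ Ω := by
  obtain ⟨ρ, -, h0, -, hΩρ⟩ := hp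
  simp [hΩρ.self_of_nhds, h0]

lemma IsC2BoundaryPoint.eventually_hardy (hΩ : IsOpen Ω) (hp : IsC2BoundaryPoint Ω p) {ε : ℝ}
    (hε : 0 < ε) :
    ∀ᶠ r in 𝓝[>] (0 : ℝ), ∀ u : E N → ℝ, IsTestFunction (Ω ∩ Metric.ball p r) u →
      ((N : ℝ) ^ 2 / 4 - ε) * ∫ x, (‖x - p‖ ^ 2)⁻¹ * u x ^ 2 ≤ ∫ x, ‖gradient u x‖ ^ 2 := by
  have hpΩ := hp.notMem
  obtain ⟨ρ, hρ, h0, hg, hΩρ⟩ := hp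
  obtain ⟨σ, hσ⟩ := exists_superharmonic_defining hρ h0 hg N.cast_nonneg hε
  obtain ⟨r₀, hr₀, hball⟩ := Metric.eventually_nhds_iff_ball.1 (hσ.and hΩρ)
  filter_upwards [Ioo_mem_nhdsGT hr₀] with r hr u hu
  have hlocal : ∀ x ∈ Ω ∩ Metric.ball p r, ContDiffAt ℝ 2 σ x ∧ 0 < σ x ∧ _ := fun x hx =>
    have h := hball x (Metric.ball_subset_ball hr.2.le hx.2)
    ⟨h.1.1, h.1.2 (h.2.1 hx.1)⟩
  exact hardy_of_superharmonic (hΩ.inter Metric.isOpen_ball) (fun h => hpΩ h.1)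
    (fun x hx => (hlocal x hx).1) (fun x hx => (hlocal x hx).2.1)
    (fun x hx => (hlocal x hx).2.2) hu

end

/-! ### The subcritical inequality -/

lemma norm_add_sq_le_of_pos {F : Type*} [SeminormedAddCommGroup F] {ε : ℝ} (hε : 0 < ε) (x y : F) :
    ‖x + y‖ ^ 2 ≤ (1 + ε) * ‖x‖ ^ 2 + (1 + ε⁻¹) * ‖y‖ ^ 2 := by
  have hyoung : 2 * ‖x‖ * ‖y‖ ≤ ε * ‖x‖ ^ 2 + ε⁻¹ * ‖y‖ ^ 2 := by
    have h : 0 ≤ ε⁻¹ * (ε * ‖x‖ - ‖y‖) ^ 2 := by positivity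
    have heq : ε⁻¹ * (ε * ‖x‖ - ‖y‖) ^ 2 = ε * ‖x‖ ^ 2 + ε⁻¹ * ‖y‖ ^ 2 - 2 * ‖x‖ * ‖y‖ := by
      field_simp
      ring
    linarith
  linarith [pow_le_pow_left₀ (norm_nonneg _) (norm_add_le x y) 2, add_sq ‖x‖ ‖y‖]

lemma exists_forall_norm_gradient_le {u : E N → ℝ} (hu : ContDiff ℝ 1 u)
    (hc : HasCompactSupport u) : ∃ C : ℝ, ∀ x, ‖gradient u x‖ ≤ C := by
  simpa only [norm_gradient] using
    (hc.fderiv ℝ).exists_bound_of_continuous (hu.continuous_fderiv one_ne_zero)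

lemma eventually_forall_ball_disjoint {ι X : Type*} [Finite ι] [MetricSpace X] {a : ι → X}
    (ha : Function.Injective a) :
    ∀ᶠ r in 𝓝[>] (0 : ℝ), Pairwise fun i j => Disjoint (Metric.ball (a i) r)
      (Metric.ball (a j) r) := by
  refine eventually_all.2 fun i => eventually_all.2 fun j => ?_
  rcases eq_or_ne i j with hij | hij
  · exact Eventually.of_forall fun r h => absurd hij h
  · filter_upwards [Ioo_mem_nhdsGT (half_pos (dist_pos.2 (ha.ne hij)))] with r hr _
    exact Metric.ball_disjoint_ball (by linarith [hr.2])

lemma exists_disjoint_cutoff {ι : Type*} [Fintype ι] {a : ι → E N} (ha : Function.Injective a)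
    {r : ℝ} (hr : 0 < r) :
    ∃ η : ι → E N → ℝ, (∀ i, ContDiff ℝ ∞ (η i)) ∧ (∀ i, tsupport (η i) ⊆ Metric.ball (a i) r) ∧
      (∃ C : ℝ, ∀ i x, ‖gradient (η i) x‖ ≤ C) ∧ (∀ x, ∑ i, η i x ^ 2 ≤ 1) ∧
      ∃ δ > 0, ∀ i x, ‖x - a i‖ < δ → η i x = 1 := by
  obtain ⟨s, hdisj, hs⟩ := ((eventually_forall_ball_disjoint ha).and (Ioo_mem_nhdsGT hr)).exists
  let η : ∀ i, ContDiffBump (a i) := fun i => ⟨s / 2, s, half_pos hs.1, half_lt_self hs.1⟩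
  choose C hC using fun i =>
    exists_forall_norm_gradient_le (η i).contDiff (η i).hasCompactSupport
  refine ⟨fun i => η i, fun i => (η i).contDiff,
    fun i => (η i).tsupport_eq.subset.trans (Metric.closedBall_subset_ball hs.2),
    ⟨∑ i, |C i|, fun i x => ((hC i x).trans (le_abs_self _)).trans
      (Finset.single_le_sum (f := fun i => |C i|) (fun j _ => abs_nonneg _) (Finset.mem_univ i))⟩,
    fun x => ?_, s / 2, half_pos hs.1, fun i x hx =>
      (η i).one_of_mem_closedBall (mem_closedBall_iff_norm.2 hx.le)⟩
  by_cases h : ∃ i, x ∈ Metric.ball (a i) s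
  · obtain ⟨i, hi⟩ := h
    rw [Finset.sum_eq_single_of_mem i (Finset.mem_univ i) fun j _ hji => ?_]
    · exact pow_le_one₀ (η i).nonneg (η i).le_one
    · have hj : η j x = 0 :=
        (η j).zero_of_le_dist (not_lt.1 fun hj => (hdisj hji).notMem_of_mem_left hj hi)
      simp only [hj, zero_pow two_ne_zero]
  · push Not at h
    simp [fun i => (η i).zero_of_le_dist (not_lt.1 (h i))]

section Localization

variable {Ω : Set (E N)} {u : E N → ℝ} {ι : Type*} [Fintype ι] {η : ι → E N → ℝ}

lemma IsTestFunction.sum_integral_norm_gradient_mul_sq_le (hΩ : IsOpen Ω)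
    (hu : IsTestFunction Ω u) (hη : ∀ i, ContDiff ℝ ∞ (η i)) {C ε : ℝ}
    (hC : ∀ i x, ‖gradient (η i) x‖ ≤ C) (hsum : ∀ x, ∑ i, η i x ^ 2 ≤ 1) (hε : 0 < ε) :
    ∑ i, ∫ x, ‖gradient (fun y => u y * η i y) x‖ ^ 2 ≤
      (1 + ε) * (∫ x, ‖gradient u x‖ ^ 2) +
        Fintype.card ι * ((1 + ε⁻¹) * C ^ 2) * ∫ x, u x ^ 2 := by
  have hv : ∀ i, IsTestFunction Ω fun x => u x * η i x := fun i =>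
    hu.mul_contDiffOn hΩ (hη i).contDiffOn
  have hbound : ∀ i x, ‖gradient (fun y => u y * η i y) x‖ ^ 2 ≤
      (1 + ε) * ‖gradient u x‖ ^ 2 * η i x ^ 2 + (1 + ε⁻¹) * C ^ 2 * u x ^ 2 := by
    intro i x
    have hgrad := hasGradientAt_mul (hu.hasGradientAt x)
      ((hη i).differentiable (by simp) x).hasGradientAt
    have hC2 : ‖gradient (η i) x‖ ^ 2 ≤ C ^ 2 := pow_le_pow_left₀ (norm_nonneg _) (hC i x) 2
    rw [hgrad.gradient, add_comm]
    refine (norm_add_sq_le_of_pos hε _ _).trans ?_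
    rw [norm_smul, norm_smul, mul_pow, mul_pow, Real.norm_eq_abs, sq_abs, Real.norm_eq_abs, sq_abs,
      mul_assoc (1 + ε), mul_assoc (1 + ε⁻¹), mul_comm (‖gradient u x‖ ^ 2), mul_comm (C ^ 2)]
    gcongr
  rw [← integral_finsetSum _ fun i _ => (hv i).integrable_norm_gradient_sq,
    ← integral_const_mul, ← integral_const_mul, ← integral_add
      (hu.integrable_norm_gradient_sq.const_mul _) (hu.integrable_sq.const_mul _)]
  refine integral_mono (integrable_finsetSum _ fun i _ => (hv i).integrable_norm_gradient_sq)
    ((hu.integrable_norm_gradient_sq.const_mul _).add (hu.integrable_sq.const_mul _)) fun x => ?_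
  calc ∑ i, ‖gradient (fun y => u y * η i y) x‖ ^ 2
      ≤ ∑ i, ((1 + ε) * ‖gradient u x‖ ^ 2 * η i x ^ 2 + (1 + ε⁻¹) * C ^ 2 * u x ^ 2) :=
        Finset.sum_le_sum fun i _ => hbound i x
    _ = (1 + ε) * ‖gradient u x‖ ^ 2 * ∑ i, η i x ^ 2 +
        Fintype.card ι * ((1 + ε⁻¹) * C ^ 2) * u x ^ 2 := by
        rw [Finset.sum_add_distrib, ← Finset.mul_sum, Finset.sum_const, Finset.card_univ,
          nsmul_eq_mul, ← mul_assoc (Fintype.card ι : ℝ)]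
    _ ≤ _ := by
        exact add_le_add_left (mul_le_of_le_one_right (by positivity) (hsum x)) _

lemma IsTestFunction.integral_mul_sq_le_sum_add (hΩ : IsOpen Ω) (hu : IsTestFunction Ω u)
    (hη : ∀ i, ContDiff ℝ ∞ (η i)) {W : E N → ℝ} (hW : ContinuousOn W Ω) (hW0 : ∀ x, 0 ≤ W x)
    {C : ℝ} (hC : 0 ≤ C) (h : ∀ x, (∃ i, η i x = 1) ∨ W x ≤ C) :
    ∫ x, W x * u x ^ 2 ≤ (∑ i, ∫ x, W x * (u x * η i x) ^ 2) + C * ∫ x, u x ^ 2 := by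
  have hv : ∀ i, Integrable fun x => W x * (u x * η i x) ^ 2 := fun i =>
    (hu.mul_contDiffOn hΩ (hη i).contDiffOn).integrable_mul_sq hΩ hW
  have hsum := integrable_finsetSum Finset.univ fun i _ => hv i
  rw [← integral_finsetSum _ fun i _ => hv i, ← integral_const_mul,
    ← integral_add hsum (hu.integrable_sq.const_mul _)]
  refine integral_mono (hu.integrable_mul_sq hΩ hW) (hsum.add (hu.integrable_sq.const_mul _))
    fun x => ?_
  have hnonneg : ∀ i ∈ Finset.univ, 0 ≤ W x * (u x * η i x) ^ 2 := fun i _ =>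
    mul_nonneg (hW0 x) (sq_nonneg _)
  rcases h x with ⟨i, hi⟩ | hx
  · have hle := Finset.single_le_sum hnonneg (Finset.mem_univ i)
    rw [hi, mul_one] at hle
    exact le_add_of_le_of_nonneg hle (mul_nonneg hC (sq_nonneg _))
  · exact le_add_of_nonneg_of_le (Finset.sum_nonneg hnonneg)
      (mul_le_mul_of_nonneg_right hx (sq_nonneg _))

end Localization

section Subcritical

variable {Ω : Set (E N)} {a : Fin n → E N} {μ : ℝ}

lemma IsC2BoundaryPoint.eventually_hardy_V (hΩ : IsOpen Ω) (ha : Function.Injective a)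
    (haΩ : ∀ i, a i ∉ Ω) {k : Fin n} (hk : IsC2BoundaryPoint Ω (a k)) (hμ0 : 0 ≤ μ)
    (hμ : μ * (n - 1) < (N : ℝ) ^ 2 / 4) :
    ∀ᶠ r in 𝓝[>] (0 : ℝ), ∀ u : E N → ℝ, IsTestFunction (Ω ∩ Metric.ball (a k) r) u →
      μ * ∫ x, V a x * u x ^ 2 ≤ ∫ x, ‖gradient u x‖ ^ 2 := by
  have hne : ∀ x ∈ Ω, ∀ i, x ≠ a i := fun x hx i => ne_of_mem_of_not_mem hx (haΩ i)
  obtain ⟨ε, hε, hμε⟩ : ∃ ε > 0, μ * (n - 1 + ε) = (N : ℝ) ^ 2 / 4 - ε :=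
    ⟨((N : ℝ) ^ 2 / 4 - μ * (n - 1)) / (μ + 1), div_pos (sub_pos.2 hμ) (by linarith), by
      field_simp
      ring⟩
  have hV := (tendsto_norm_sub_sq_mul_V ha k).eventually_le_const (lt_add_of_pos_right _ hε)
  obtain ⟨r₀, hr₀, hball⟩ := Metric.eventually_nhds_iff_ball.1 (eventually_nhdsWithin_iff.1 hV)
  filter_upwards [hk.eventually_hardy hΩ hε, Ioo_mem_nhdsGT hr₀] with r hhardy hr u hu
  have hO : IsOpen (Ω ∩ Metric.ball (a k) r) := hΩ.inter Metric.isOpen_ball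
  have hpole : ContinuousOn (fun x => (‖x - a k‖ ^ 2)⁻¹) (Ω ∩ Metric.ball (a k) r) :=
    ContinuousOn.inv₀ (by fun_prop) fun x hx => (norm_sub_sq_pos (hne x hx.1 k)).ne'
  have hVle : ∫ x, V a x * u x ^ 2 ≤ (n - 1 + ε) * ∫ x, (‖x - a k‖ ^ 2)⁻¹ * u x ^ 2 := by
    rw [← integral_const_mul]
    refine integral_mono (hu.integrable_mul_sq hO (continuousOn_V fun i h => haΩ i h.1))
      ((hu.integrable_mul_sq hO hpole).const_mul _) fun x => ?_
    by_cases hx : x ∈ Ω ∩ Metric.ball (a k) r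
    · have hVx := hball x (Metric.ball_subset_ball hr.2.le hx.2) (hne x hx.1 k)
      rw [← mul_assoc, ← div_eq_mul_inv]
      gcongr
      rwa [le_div_iff₀' (norm_sub_sq_pos (hne x hx.1 k))]
    · simp [hu.eq_zero_of_notMem hx]
  calc μ * ∫ x, V a x * u x ^ 2
      ≤ μ * ((n - 1 + ε) * ∫ x, (‖x - a k‖ ^ 2)⁻¹ * u x ^ 2) := by gcongr
    _ = ((N : ℝ) ^ 2 / 4 - ε) * ∫ x, (‖x - a k‖ ^ 2)⁻¹ * u x ^ 2 := by rw [← mul_assoc, hμε]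
    _ ≤ _ := hhardy u hu

lemma integral_V_mul_sq_nonneg (a : Fin n → E N) (u : E N → ℝ) : 0 ≤ ∫ x, V a x * u x ^ 2 :=
  integral_nonneg fun x => mul_nonneg (V_nonneg a x) (sq_nonneg _)

lemma exists_hardy_subcritical (hΩ : IsOpen Ω) (ha : Function.Injective a)
    (haΩ : ∀ i, IsC2BoundaryPoint Ω (a i)) (hμ : μ * (n - 1) < (N : ℝ) ^ 2 / 4) :
    ∃ c : ℝ, ∀ u : E N → ℝ, IsTestFunction Ω u →
      μ * (∫ x, V a x * u x ^ 2) ≤ c * (∫ x, u x ^ 2) + ∫ x, ‖gradient u x‖ ^ 2 := by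
  rcases le_or_gt μ 0 with hμ0 | hμ0
  · refine ⟨0, fun u _ => ?_⟩
    rw [zero_mul, zero_add]
    exact (mul_nonpos_of_nonpos_of_nonneg hμ0 (integral_V_mul_sq_nonneg a u)).trans
      (integral_nonneg fun x => by positivity)
  obtain ⟨ε, hμε, hε⟩ : ∃ ε : ℝ, μ * (1 + ε) * (n - 1) < (N : ℝ) ^ 2 / 4 ∧ 0 < ε := by
    have hcont : ContinuousAt (fun ε : ℝ => μ * (1 + ε) * (n - 1)) 0 := by fun_prop
    exact (((hcont.eventually_lt_const (by simpa using hμ)).filter_mono nhdsWithin_le_nhds).and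
      (eventually_mem_nhdsWithin (s := Set.Ioi 0))).exists
  obtain ⟨r, hlocal, hr⟩ := ((eventually_all.2 fun i => (haΩ i).eventually_hardy_V hΩ ha
    (fun j => (haΩ j).notMem) (mul_nonneg hμ0.le (by linarith)) hμε).and
      eventually_mem_nhdsWithin).exists
  obtain ⟨η, hη, hηsupp, ⟨C, hC⟩, hηsum, δ, hδ, hη1⟩ := exists_disjoint_cutoff ha hr
  obtain ⟨C', hC', hVC'⟩ := exists_V_le a hδ
  refine ⟨n * ((1 + ε⁻¹) * C ^ 2) / (1 + ε) + μ * C', fun u hu => ?_⟩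
  have hV : ContinuousOn (V a) Ω := continuousOn_V fun i => (haΩ i).notMem
  have hsplit := hu.integral_mul_sq_le_sum_add hΩ hη hV (V_nonneg a) hC' fun x =>
    or_iff_not_imp_left.2 fun h => hVC' x fun i => not_lt.1 fun hi => h ⟨i, hη1 i x hi⟩
  have hgrad := hu.sum_integral_norm_gradient_mul_sq_le hΩ hη hC hηsum hε
  rw [Fintype.card_fin] at hgrad
  have hpoles : μ * (1 + ε) * ∑ i, ∫ x, V a x * (u x * η i x) ^ 2 ≤
      ∑ i, ∫ x, ‖gradient (fun y => u y * η i y) x‖ ^ 2 := by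
    rw [Finset.mul_sum]
    refine Finset.sum_le_sum fun i _ => hlocal i _ ?_
    have hv := hu.mul_contDiffOn hΩ (hη i).contDiffOn
    exact ⟨hv.contDiff, hv.hasCompactSupport, Set.subset_inter hv.tsupport_subset
      (tsupport_mul_subset_right.trans (hηsupp i))⟩
  refine le_of_mul_le_mul_left ?_ (by linarith : 0 < 1 + ε)
  calc (1 + ε) * (μ * ∫ x, V a x * u x ^ 2)
      ≤ μ * (1 + ε) * ((∑ i, ∫ x, V a x * (u x * η i x) ^ 2) + C' * ∫ x, u x ^ 2) := by
        rw [← mul_assoc, mul_comm (1 + ε)]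
        gcongr
    _ ≤ (1 + ε) * (∫ x, ‖gradient u x‖ ^ 2) + n * ((1 + ε⁻¹) * C ^ 2) * (∫ x, u x ^ 2) +
        μ * (1 + ε) * (C' * ∫ x, u x ^ 2) := by linarith
    _ = _ := by
        field_simp
        ring

end Subcritical

/-! ### Near-optimality of the half-space Hardy inequality -/

lemma setIntegral_Ioi_inv_mul_comp_log (g : ℝ → ℝ) :
    ∫ r in Set.Ioi (0 : ℝ), r⁻¹ * g (Real.log r) = ∫ s, g s := by
  rw [← Real.range_exp, ← Set.image_univ, integral_image_eq_integral_abs_deriv_smul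
    MeasurableSet.univ (fun x _ => (Real.hasDerivAt_exp x).hasDerivWithinAt)
    Real.exp_injective.injOn, setIntegral_univ]
  refine integral_congr_ae (Eventually.of_forall fun s => ?_)
  simp only [abs_of_pos (Real.exp_pos s), Real.log_exp, smul_eq_mul]
  rw [mul_inv_cancel_left₀ (Real.exp_pos s).ne']

lemma integral_volumeIoiPow {m : ℕ} (f : ℝ → ℝ) :
    ∫ r : Set.Ioi (0 : ℝ), f r ∂.volumeIoiPow m = ∫ r in Set.Ioi (0 : ℝ), r ^ m * f r := by
  simp only [Measure.volumeIoiPow, ENNReal.ofReal]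
  rw [integral_withDensity_eq_integral_smul (by fun_prop),
    integral_subtype_comap measurableSet_Ioi fun r : ℝ => Real.toNNReal (r ^ m) • f r]
  refine setIntegral_congr_fun measurableSet_Ioi fun r (hr : 0 < r) => ?_
  rw [NNReal.smul_def, Real.coe_toNNReal _ (pow_nonneg hr.le _), smul_eq_mul]

lemma integral_inv_norm_pow_finrank_mul {F : Type*} [NormedAddCommGroup F] [NormedSpace ℝ F]
    [FiniteDimensional ℝ F] [Nontrivial F] [MeasurableSpace F] [BorelSpace F] (μ : Measure F)
    [μ.IsAddHaarMeasure] (g : ℝ → ℝ) (k : F → ℝ) :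
    ∫ x, (‖x‖ ^ Module.finrank ℝ F)⁻¹ * (g (Real.log ‖x‖) * k (‖x‖⁻¹ • x)) ∂μ =
      (∫ θ : Metric.sphere (0 : F) 1, k θ ∂μ.toSphere) * ∫ s, g s := by
  set d := Module.finrank ℝ F
  have hd : 1 ≤ d := Module.finrank_pos
  let f : ℝ → ℝ := fun r => (r ^ d)⁻¹ * g (Real.log r)
  calc _ = ∫ x : ({0}ᶜ : Set F), (‖x.1‖ ^ d)⁻¹ * (g (Real.log ‖x.1‖) * k (‖x.1‖⁻¹ • x.1))
          ∂(μ.comap (↑)) := by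
        rw [integral_subtype_comap (measurableSet_singleton _).compl fun x : F =>
          (‖x‖ ^ d)⁻¹ * (g (Real.log ‖x‖) * k (‖x‖⁻¹ • x)), restrict_compl_singleton]
    _ = ∫ z, k z.1 * f z.2 ∂μ.toSphere.prod (.volumeIoiPow (d - 1)) := by
        rw [← μ.measurePreserving_homeomorphUnitSphereProd.integral_comp
          (Homeomorph.measurableEmbedding _) (fun z => k z.1 * f z.2)]
        refine integral_congr_ae (Eventually.of_forall fun x => ?_)
        simp only [homeomorphUnitSphereProd_apply_snd_coe, homeomorphUnitSphereProd_apply_fst_coe,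
          f]
        ring
    _ = (∫ θ, k θ ∂μ.toSphere) * ∫ r : Set.Ioi (0 : ℝ), f r ∂.volumeIoiPow (d - 1) :=
        integral_prod_mul (fun θ : Metric.sphere (0 : F) 1 => k θ)
          (fun r : Set.Ioi (0 : ℝ) => f r)
    _ = _ := by
        rw [← setIntegral_Ioi_inv_mul_comp_log, integral_volumeIoiPow]
        congr 1
        refine setIntegral_congr_fun measurableSet_Ioi fun r (hr : 0 < r) => ?_
        rw [← mul_assoc, pow_sub₀ r hr.ne' hd, pow_one]
        field_simp

lemma exists_hasCompactSupport_integral_deriv_sq_lt {ε : ℝ} (hε : 0 < ε) :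
    ∃ f : ℝ → ℝ, ContDiff ℝ ∞ f ∧ HasCompactSupport f ∧
      ∫ s, deriv f s ^ 2 < ε * ∫ s, f s ^ 2 := by
  let G : ContDiffBump (0 : ℝ) := ⟨1, 2, one_pos, one_lt_two⟩
  have hpos : 0 < ∫ s, G s ^ 2 := by
    refine Continuous.integral_pos_of_hasCompactSupport_nonneg_nonzero (x := (0 : ℝ))
      (G.continuous.pow 2) (G.hasCompactSupport.comp_left (g := fun t : ℝ => t ^ 2) (by simp))
      (fun s => sq_nonneg _) ?_
    simp [G.one_of_mem_closedBall (x := 0) (by simp [G])]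
  have hlim : Tendsto (fun k : ℝ => k⁻¹ ^ 2 * ∫ s, deriv G s ^ 2) atTop (𝓝 0) := by
    simpa using ((tendsto_inv_atTop_zero (𝕜 := ℝ)).pow 2).mul_const (∫ s, deriv G s ^ 2)
  obtain ⟨k, hk, hkε⟩ := ((eventually_gt_atTop 0).and
    (hlim.eventually (gt_mem_nhds (mul_pos hε hpos)))).exists
  have hderiv : ∀ s, deriv (fun s => G (k⁻¹ * s)) s = k⁻¹ * deriv G (k⁻¹ * s) := fun s => by
    rw [deriv_comp_mul_left k⁻¹ G s, smul_eq_mul]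
  refine ⟨fun s => G (k⁻¹ * s), G.contDiff.comp (contDiff_const.mul contDiff_id),
    G.hasCompactSupport.comp_homeomorph (Homeomorph.mulLeft₀ k⁻¹ (inv_ne_zero hk.ne')), ?_⟩
  simp only [hderiv, mul_pow, integral_const_mul]
  rw [Measure.integral_comp_mul_left (fun s => deriv G s ^ 2),
    Measure.integral_comp_mul_left (fun s => G s ^ 2), inv_inv, abs_of_pos hk, smul_eq_mul,
    smul_eq_mul]
  linarith [mul_lt_mul_of_pos_left hkε hk]

lemma deriv_smoothTransition_of_notMem {y : ℝ} (hy : y ∉ Set.Ioo 0 1) :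
    deriv Real.smoothTransition y = 0 := by
  rw [Set.mem_Ioo, not_and_or, not_lt, not_lt] at hy
  rcases hy with hy | hy
  · refine IsLocalMin.deriv_eq_zero (Eventually.of_forall fun z => ?_)
    rw [Real.smoothTransition.zero_of_nonpos hy]
    exact Real.smoothTransition.nonneg z
  · refine IsLocalMax.deriv_eq_zero (Eventually.of_forall fun z => ?_)
    rw [Real.smoothTransition.one_of_one_le hy]
    exact Real.smoothTransition.le_one z

lemma continuous_deriv_smoothTransition : Continuous (deriv Real.smoothTransition) :=
  (Real.smoothTransition.contDiff (n := 1)).continuous_deriv le_rfl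

lemma exists_abs_add_one_mul_deriv_smoothTransition_le :
    ∃ C : ℝ, ∀ y, |(y + 1) * deriv Real.smoothTransition y| ≤ C := by
  have hc : HasCompactSupport fun y => (y + 1) * deriv Real.smoothTransition y :=
    HasCompactSupport.intro (isCompact_Icc (a := 0) (b := 1)) fun y hy => by
      rw [deriv_smoothTransition_of_notMem fun h => hy (Set.Ioo_subset_Icc_self h), mul_zero]
  exact hc.exists_bound_of_continuous (.mul (by fun_prop) continuous_deriv_smoothTransition)

lemma eventually_div_sub_one_le_or_ge (t : ℝ) :
    ∀ᶠ δ in 𝓝[>] (0 : ℝ), t ≤ 0 ∧ t / δ - 1 ≤ 0 ∨ 0 < t ∧ 1 ≤ t / δ - 1 := by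
  rcases le_or_gt t 0 with ht | ht
  · filter_upwards [self_mem_nhdsWithin] with δ (hδ : 0 < δ)
    exact .inl ⟨ht, by linarith [div_nonpos_of_nonpos_of_nonneg ht hδ.le]⟩
  · filter_upwards [Ioo_mem_nhdsGT (half_pos ht)] with δ hδ
    refine .inr ⟨ht, ?_⟩
    rw [le_sub_iff_add_le, le_div_iff₀ hδ.1]
    linarith [hδ.2]

section AngularCutoff

variable {X : Type*} [MeasurableSpace X] {σ : Measure X} {t : X → ℝ}

lemma tendsto_integral_sq_mul_smoothTransition_sq (ht : MemLp t 2 σ) :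
    Tendsto (fun δ : ℝ => ∫ x, t x ^ 2 * Real.smoothTransition (t x / δ - 1) ^ 2 ∂σ) (𝓝[>] 0)
      (𝓝 (∫ x, max (t x) 0 ^ 2 ∂σ)) := by
  refine tendsto_integral_filter_of_dominated_convergence (fun x => t x ^ 2)
    (Eventually.of_forall fun δ => ?_) (Eventually.of_forall fun δ => .of_forall fun x => ?_)
    ht.integrable_sq (Eventually.of_forall fun x => ?_)
  · exact ((continuous_pow 2).mul ((Real.smoothTransition.continuous.comp
      (by fun_prop : Continuous fun s : ℝ => s / δ - 1)).pow 2)).comp_aestronglyMeasurable ht.1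
  · rw [Real.norm_of_nonneg (by positivity)]
    exact mul_le_of_le_one_right (sq_nonneg _)
      (pow_le_one₀ (Real.smoothTransition.nonneg _) (Real.smoothTransition.le_one _))
  · refine tendsto_const_nhds.congr' ?_
    filter_upwards [eventually_div_sub_one_le_or_ge (t x)] with δ hδ
    rcases hδ with ⟨h, hδ⟩ | ⟨h, hδ⟩
    · simp [max_eq_right h, Real.smoothTransition.zero_of_nonpos hδ]
    · simp [max_eq_left h.le, Real.smoothTransition.one_of_one_le hδ]

lemma tendsto_integral_sq_mul_deriv_smoothTransition_sq [IsFiniteMeasure σ]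
    (ht : AEStronglyMeasurable t σ) :
    Tendsto (fun δ : ℝ => ∫ x, t x ^ 2 * (deriv Real.smoothTransition (t x / δ - 1) / δ) ^ 2 ∂σ)
      (𝓝[>] 0) (𝓝 0) := by
  obtain ⟨C, hC⟩ := exists_abs_add_one_mul_deriv_smoothTransition_le
  suffices h : Tendsto (fun δ : ℝ => ∫ x, t x ^ 2 *
      (deriv Real.smoothTransition (t x / δ - 1) / δ) ^ 2 ∂σ) (𝓝[>] 0) (𝓝 (∫ _, (0 : ℝ) ∂σ)) by
    simpa only [integral_zero] using h
  refine tendsto_integral_filter_of_dominated_convergence (fun _ => C ^ 2)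
    (Eventually.of_forall fun δ => ?_) (Eventually.of_forall fun δ => .of_forall fun x => ?_)
    (integrable_const _) (Eventually.of_forall fun x => ?_)
  · exact ((continuous_pow 2).mul (((continuous_deriv_smoothTransition.comp
      (by fun_prop : Continuous fun s : ℝ => s / δ - 1)).div_const δ).pow 2)
      ).comp_aestronglyMeasurable ht
  · have heq : t x * (deriv Real.smoothTransition (t x / δ - 1) / δ) =
        (t x / δ - 1 + 1) * deriv Real.smoothTransition (t x / δ - 1) := by ring
    rw [Real.norm_of_nonneg (by positivity), ← mul_pow, heq, ← sq_abs]
    gcongr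
    exact hC _
  · refine tendsto_const_nhds.congr' ?_
    filter_upwards [eventually_div_sub_one_le_or_ge (t x)] with δ hδ
    rw [deriv_smoothTransition_of_notMem]
    · simp
    · rw [Set.mem_Ioo]
      rcases hδ with ⟨-, hδ⟩ | ⟨-, hδ⟩ <;> grind

lemma exists_integral_sq_mul_deriv_sq_lt [IsFiniteMeasure σ] (ht : MemLp t 2 σ)
    (hpos : 0 < ∫ x, max (t x) 0 ^ 2 ∂σ) {ε : ℝ} (hε : 0 < ε) :
    ∃ δ > 0, ∃ h : ℝ → ℝ, ContDiff ℝ ∞ h ∧ (∀ s < δ, h s = 0) ∧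
      ∫ x, t x ^ 2 * deriv h (t x) ^ 2 ∂σ < ε * ∫ x, t x ^ 2 * h (t x) ^ 2 ∂σ := by
  obtain ⟨δ, hδ, hlt⟩ := (eventually_mem_nhdsWithin.and
    ((tendsto_integral_sq_mul_deriv_smoothTransition_sq ht.1).eventually_lt
      ((tendsto_integral_sq_mul_smoothTransition_sq ht).const_mul ε)
      (mul_pos hε hpos))).exists
  have hδ : 0 < δ := hδ
  have hderiv : ∀ s, deriv (fun s => Real.smoothTransition (s / δ - 1)) s =
      deriv Real.smoothTransition (s / δ - 1) / δ := fun s => by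
    have h := (Real.smoothTransition.contDiff (n := 1)).differentiable one_ne_zero (s / δ - 1)
    exact ((h.hasDerivAt.comp s (((hasDerivAt_id s).div_const δ).sub_const 1)).congr_deriv
      (mul_one_div _ _)).deriv
  refine ⟨δ, hδ, fun s => Real.smoothTransition (s / δ - 1),
    (Real.smoothTransition.contDiff (n := ⊤)).comp ((contDiff_id.div_const δ).sub contDiff_const),
    fun s hs => Real.smoothTransition.zero_of_nonpos ?_, ?_⟩
  · rw [sub_nonpos, div_le_one hδ]
    exact hs.le
  · simpa only [hderiv] using hlt

end AngularCutoff

section AngularCoordinate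

variable {F : Type*} [NormedAddCommGroup F] [InnerProductSpace ℝ F] {ν x : F}

/-- The angular coordinate `⟪ν, x⟫ / |x|` on the half-space `⟪ν, x⟫ > 0`. -/
def angularCoord (ν x : F) : ℝ := ⟪ν, ‖x‖⁻¹ • x⟫

lemma ne_zero_of_inner_pos (hx : 0 < ⟪ν, x⟫) : x ≠ 0 := by
  rintro rfl
  simp at hx

lemma hasGradientAt_norm [CompleteSpace F] (hx : x ≠ 0) :
    HasGradientAt (fun y : F => ‖y‖) (‖x‖⁻¹ • x) x := by
  have h := hasGradientAt_comp (u := fun y => ‖y - 0‖ ^ 2)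
    (Real.hasDerivAt_sqrt (norm_sub_sq_pos hx).ne')
    (hasGradientAt_norm_sub_sq 0 x)
  simp only [sub_zero, Real.sqrt_sq (norm_nonneg _), smul_smul] at h
  convert h using 2
  field_simp

lemma contDiffAt_angularCoord {m : WithTop ℕ∞} (ν : F) (hx : x ≠ 0) :
    ContDiffAt ℝ m (angularCoord ν) x :=
  contDiffAt_const.inner ℝ (((contDiffAt_norm ℝ hx).inv (norm_ne_zero_iff.2 hx)).smul
    contDiffAt_id)

lemma hasGradientAt_angularCoord [CompleteSpace F] (ν : F) (hx : x ≠ 0) :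
    HasGradientAt (angularCoord ν) (‖x‖⁻¹ • (ν - ⟪ν, x⟫ • logGrad 0 x)) x := by
  have hinv := hasGradientAt_comp (hasDerivAt_inv (norm_ne_zero_iff.2 hx)) (hasGradientAt_norm hx)
  convert hasGradientAt_mul hinv (hasGradientAt_inner_left ν x) using 1
  · ext y
    rw [angularCoord, real_inner_smul_right]
  · rw [logGrad, sub_zero]
    module

lemma norm_sub_inner_smul_logGrad_sq_le (ν x : F) :
    ‖ν - ⟪ν, x⟫ • logGrad 0 x‖ ^ 2 ≤ ‖ν‖ ^ 2 := by
  have heq : ‖⟪ν, x⟫ • logGrad 0 x‖ ^ 2 = ⟪ν, ⟪ν, x⟫ • logGrad 0 x⟫ := by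
    rw [norm_smul, mul_pow, norm_logGrad_sq, logGrad, real_inner_smul_right,
      real_inner_smul_right, Real.norm_eq_abs, sq_abs, sub_zero]
    ring
  rw [norm_sub_sq_real, ← heq]
  linarith [sq_nonneg ‖⟪ν, x⟫ • logGrad 0 x‖]

lemma inner_sub_inner_smul_logGrad (ν : F) (hx : x ≠ 0) :
    ⟪ν - ⟪ν, x⟫ • logGrad 0 x, logGrad 0 x⟫ = 0 := by
  have h := norm_sub_sq_pos hx
  rw [inner_sub_left, real_inner_smul_left, real_inner_self_eq_norm_sq, norm_logGrad_sq, logGrad,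
    real_inner_smul_right, sub_zero] at *
  ring

end AngularCoordinate

section HalfspaceTrial

variable {ν x : E N} {f h : ℝ → ℝ}

/-- The virtual ground state `⟪ν, x⟫ |x|^{-N/2}` of the Hardy inequality on the half-space
`⟪ν, x⟫ > 0`. -/
def halfspaceState (ν x : E N) : ℝ := ⟪ν, x⟫ * ‖x‖ ^ (-(N / 2) : ℝ)

/-- The logarithmic gradient of `halfspaceState`. -/
def halfspaceField (ν x : E N) : E N := ⟪ν, x⟫⁻¹ • ν + (-(N / 2) : ℝ) • logGrad 0 x

/-- The virtual ground state cut off by `f` in the logarithmic radial coordinate and by `h` in the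
angular coordinate; these are the competitors showing optimality of the half-space constant. -/
def halfspaceTrial (ν : E N) (f h : ℝ → ℝ) (x : E N) : ℝ :=
  halfspaceState ν x * (f (Real.log ‖x‖) * h (angularCoord ν x))

lemma isOpen_inner_pos (ν : E N) : IsOpen {x | 0 < ⟪ν, x⟫} :=
  isOpen_lt continuous_const (by fun_prop)

lemma continuousOn_inv_norm_sq (ν : E N) :
    ContinuousOn (fun x => (‖x‖ ^ 2)⁻¹) {x | 0 < ⟪ν, x⟫} :=
  ContinuousOn.inv₀ (by fun_prop) fun x hx => by
    simpa using ne_zero_of_inner_pos (Set.mem_ofPred.1 hx)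

lemma hasGradientAt_halfspaceState (hx : 0 < ⟪ν, x⟫) :
    HasGradientAt (halfspaceState ν) (halfspaceState ν x • halfspaceField ν x) x := by
  have hx0 := ne_zero_of_inner_pos hx
  have hn := norm_pos_iff.2 hx0
  have hpow := hasGradientAt_comp (Real.hasDerivAt_rpow_const (p := (-(N / 2) : ℝ))
    (Or.inl hn.ne')) (hasGradientAt_norm hx0)
  convert hasGradientAt_mul (hasGradientAt_inner_left ν x) hpow using 1
  · rfl
  · rw [halfspaceState, halfspaceField, logGrad, sub_zero, Real.rpow_sub_one hn.ne', smul_add,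
      smul_smul, smul_smul, smul_smul, smul_smul, smul_smul, add_comm]
    congr 2 <;> field_simp

lemma contDiffAt_halfspaceTrial (hf : ContDiff ℝ ∞ f) (hh : ContDiff ℝ ∞ h) (hx : 0 < ⟪ν, x⟫) :
    ContDiffAt ℝ ∞ (halfspaceTrial ν f h) x := by
  have hx0 := ne_zero_of_inner_pos hx
  have hlog : ContDiffAt ℝ ∞ (fun y : E N => Real.log ‖y‖) x := by
    simpa using contDiffAt_log_norm_sub (m := ∞) hx0
  have hstate : ContDiffAt ℝ ∞ (halfspaceState ν) x :=
    (contDiffAt_const.inner ℝ contDiffAt_id).mul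
      ((contDiffAt_norm ℝ hx0).rpow_const_of_ne (norm_ne_zero_iff.2 hx0))
  exact hstate.mul ((hf.contDiffAt.comp x hlog).mul
    (hh.contDiffAt.comp x (contDiffAt_angularCoord ν hx0)))

lemma exists_isCompact_halfspaceTrial_eq_zero (ν : E N) (hfc : HasCompactSupport f) {δ : ℝ}
    (hδ : 0 < δ) (h0 : ∀ s < δ, h s = 0) :
    ∃ K ⊆ {x | 0 < ⟪ν, x⟫}, IsCompact K ∧ ∀ x ∉ K, halfspaceTrial ν f h x = 0 := by
  obtain ⟨R, hR⟩ := hfc.isCompact.isBounded.subset_closedBall 0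
  refine ⟨{x | Real.exp (-R) ≤ ‖x‖} ∩ (Metric.closedBall 0 (Real.exp R) ∩
    {x | δ * ‖x‖ ≤ ⟪ν, x⟫}), ?_, ?_, ?_⟩
  · rintro x ⟨hx, -, hδx⟩
    exact (mul_pos hδ ((Real.exp_pos _).trans_le hx)).trans_le hδx
  · exact ((isCompact_closedBall _ _).inter_right (isClosed_le (by fun_prop) (by fun_prop))
      ).inter_left (isClosed_le (by fun_prop) (by fun_prop))
  · intro x hx
    rcases eq_or_ne x 0 with rfl | hx0
    · simp [halfspaceTrial, halfspaceState]
    have hn := norm_pos_iff.2 hx0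
    rcases lt_or_ge ⟪ν, x⟫ (δ * ‖x‖) with hlt | hge
    · have hang : angularCoord ν x < δ := by
        rwa [angularCoord, real_inner_smul_right, inv_mul_lt_iff₀ hn, mul_comm]
      simp [halfspaceTrial, h0 _ hang]
    · have hlog : Real.log ‖x‖ ∉ tsupport f := fun hmem => by
        have hle := hR hmem
        rw [Metric.mem_closedBall, Real.dist_eq, sub_zero, abs_le] at hle
        exact hx ⟨(Real.le_log_iff_exp_le hn).1 hle.1,
          by simpa using (Real.log_le_iff_le_exp hn).1 hle.2, hge⟩
      simp [halfspaceTrial, image_eq_zero_of_notMem_tsupport hlog]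

lemma isTestFunction_halfspaceTrial (ν : E N) (hf : ContDiff ℝ ∞ f) (hfc : HasCompactSupport f)
    (hh : ContDiff ℝ ∞ h) {δ : ℝ} (hδ : 0 < δ) (h0 : ∀ s < δ, h s = 0) :
    IsTestFunction {x | 0 < ⟪ν, x⟫} (halfspaceTrial ν f h) := by
  obtain ⟨K, hK, hKc, hK0⟩ := exists_isCompact_halfspaceTrial_eq_zero ν hfc hδ h0
  have hsupp : tsupport (halfspaceTrial ν f h) ⊆ K :=
    closure_minimal (fun x hx => by_contra fun hxK => hx (hK0 x hxK)) hKc.isClosed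
  exact ⟨contDiff_of_contDiffAt_tsupport fun x hx =>
    contDiffAt_halfspaceTrial hf hh (hK (hsupp hx)),
    HasCompactSupport.intro hKc hK0, hsupp.trans hK⟩

lemma inv_norm_sq_mul_halfspaceTrial_sq (ν : E N) (f h : ℝ → ℝ) (x : E N) :
    (‖x‖ ^ 2)⁻¹ * halfspaceTrial ν f h x ^ 2 =
      (‖x‖ ^ N)⁻¹ * (f (Real.log ‖x‖) ^ 2 * (angularCoord ν x ^ 2 * h (angularCoord ν x) ^ 2)) := by
  have hpow : (‖x‖ ^ (-(N / 2) : ℝ)) ^ 2 = (‖x‖ ^ N)⁻¹ := by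
    rw [← Real.rpow_natCast, ← Real.rpow_mul (norm_nonneg x), ← Real.rpow_natCast ‖x‖ N,
      ← Real.rpow_neg (norm_nonneg x)]
    congr 1
    push_cast
    ring
  rw [halfspaceTrial, halfspaceState, mul_pow, mul_pow, mul_pow, hpow, angularCoord,
    real_inner_smul_right, mul_pow, inv_pow]
  ring

lemma integral_inv_norm_sq_mul_halfspaceTrial_sq (hN : N ≠ 0) (ν : E N) (f h : ℝ → ℝ) :
    ∫ x, (‖x‖ ^ 2)⁻¹ * halfspaceTrial ν f h x ^ 2 =
      (∫ θ : Metric.sphere (0 : E N) 1, ⟪ν, (θ : E N)⟫ ^ 2 * h ⟪ν, (θ : E N)⟫ ^ 2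
        ∂(volume : Measure (E N)).toSphere) * ∫ s, f s ^ 2 := by
  have : NeZero N := ⟨hN⟩
  simp only [inv_norm_sq_mul_halfspaceTrial_sq]
  simpa [angularCoord] using integral_inv_norm_pow_finrank_mul (volume : Measure (E N))
    (fun s => f s ^ 2) (fun y => ⟪ν, y⟫ ^ 2 * h ⟪ν, y⟫ ^ 2)

lemma norm_gradient_halfspaceTrial_sub_sq_le (hf : ContDiff ℝ ∞ f) (hh : ContDiff ℝ ∞ h)
    (hx : 0 < ⟪ν, x⟫) :
    ‖gradient (halfspaceTrial ν f h) x - halfspaceTrial ν f h x • halfspaceField ν x‖ ^ 2 ≤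
      (‖x‖ ^ 2)⁻¹ * halfspaceTrial ν (deriv f) h x ^ 2 +
        ‖ν‖ ^ 2 * ((‖x‖ ^ 2)⁻¹ * halfspaceTrial ν f (deriv h) x ^ 2) := by
  have hx0 := ne_zero_of_inner_pos hx
  set τ := ν - ⟪ν, x⟫ • logGrad 0 x
  have hlog : HasGradientAt (fun y : E N => Real.log ‖y‖) (logGrad 0 x) x := by
    simpa using hasGradientAt_log_norm_sub hx0
  have hdf := (hf.differentiable (by simp) (Real.log ‖x‖)).hasDerivAt
  have hdh := (hh.differentiable (by simp) (angularCoord ν x)).hasDerivAt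
  have hgrad := (hasGradientAt_mul (hasGradientAt_halfspaceState hx) (hasGradientAt_mul
    (hasGradientAt_comp hdf hlog) (hasGradientAt_comp hdh (hasGradientAt_angularCoord ν hx0))))
  have hsub : gradient (halfspaceTrial ν f h) x - halfspaceTrial ν f h x • halfspaceField ν x =
      (halfspaceTrial ν f (deriv h) x * ‖x‖⁻¹) • τ +
        halfspaceTrial ν (deriv f) h x • logGrad 0 x := by
    rw [show gradient (halfspaceTrial ν f h) x = _ from hgrad.gradient]
    simp only [halfspaceTrial]
    module
  -- The radial and the angular part of the gradient are orthogonal.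
  rw [hsub, norm_add_sq_real, real_inner_smul_left, real_inner_smul_right,
    inner_sub_inner_smul_logGrad ν hx0, norm_smul, norm_smul, mul_pow, mul_pow, norm_logGrad_sq,
    sub_zero, Real.norm_eq_abs, Real.norm_eq_abs, sq_abs, sq_abs, mul_pow, inv_pow]
  have hτ : ‖τ‖ ^ 2 ≤ ‖ν‖ ^ 2 := norm_sub_inner_smul_logGrad_sq_le ν x
  have hmul := mul_le_mul_of_nonneg_left hτ
    (by positivity : 0 ≤ (‖x‖ ^ 2)⁻¹ * halfspaceTrial ν f (deriv h) x ^ 2)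
  linarith

lemma contDiffOn_halfspaceField (ν : E N) :
    ContDiffOn ℝ 1 (halfspaceField ν) {x | 0 < ⟪ν, x⟫} := fun x (hx : 0 < ⟪ν, x⟫) =>
  ((((contDiffAt_const.inner ℝ contDiffAt_id).inv hx.ne').smul contDiffAt_const).add
    (.const_smul (-(N / 2) : ℝ) (contDiffAt_logGrad (ne_zero_of_inner_pos hx)))).contDiffWithinAt

lemma divergence_add_norm_sq_halfspaceField (hx : 0 < ⟪ν, x⟫) :
    divergence (halfspaceField ν) x + ‖halfspaceField ν x‖ ^ 2 =
      -((N : ℝ) ^ 2 / 4 * (‖x‖ ^ 2)⁻¹) := by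
  have hgrad : gradient (fun y : E N => ⟪ν, y⟫) = fun _ => ν :=
    funext fun y => (hasGradientAt_inner_left ν y).gradient
  have hdiv : divergence (fun _ : E N => ν) x = 0 := by simp [divergence]
  have h := divergence_add_norm_sq_inv_smul_gradient_sub_logGrad (σ := fun y => ⟪ν, y⟫)
    (contDiffAt_const.inner ℝ contDiffAt_id) hx.ne' (ne_zero_of_inner_pos hx)
  simp only [hgrad, hdiv, finrank_euclideanSpace_fin, sub_zero, sub_self] at h
  rw [mul_zero, zero_mul, sub_zero, mul_zero, zero_sub] at h
  exact h

lemma integral_norm_gradient_sq_eq_halfspace {u : E N → ℝ}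
    (hu : IsTestFunction {x | 0 < ⟪ν, x⟫} u) :
    ∫ x, ‖gradient u x‖ ^ 2 = (N : ℝ) ^ 2 / 4 * (∫ x, (‖x‖ ^ 2)⁻¹ * u x ^ 2) +
      ∫ x, ‖gradient u x - u x • halfspaceField ν x‖ ^ 2 := by
  have hpot : ∫ x, (divergence (halfspaceField ν) x + ‖halfspaceField ν x‖ ^ 2) * u x ^ 2 =
      -((N : ℝ) ^ 2 / 4 * ∫ x, (‖x‖ ^ 2)⁻¹ * u x ^ 2) := by
    rw [← integral_const_mul, ← integral_neg]
    refine integral_congr_ae (Eventually.of_forall fun x => ?_)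
    by_cases hx : 0 < ⟪ν, x⟫
    · simp only [divergence_add_norm_sq_halfspaceField hx, neg_mul, mul_assoc]
    · simp [hu.eq_zero_of_notMem hx]
  rw [integral_norm_gradient_sub_smul_sq (isOpen_inner_pos ν) hu (contDiffOn_halfspaceField ν),
    hpot]
  ring

lemma integral_norm_gradient_halfspaceTrial_sub_sq_le (ν : E N) (hf : ContDiff ℝ ∞ f)
    (hfc : HasCompactSupport f) (hh : ContDiff ℝ ∞ h) {δ : ℝ} (hδ : 0 < δ)
    (h0 : ∀ s < δ, h s = 0) :
    ∫ x, ‖gradient (halfspaceTrial ν f h) x - halfspaceTrial ν f h x • halfspaceField ν x‖ ^ 2 ≤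
      (∫ x, (‖x‖ ^ 2)⁻¹ * halfspaceTrial ν (deriv f) h x ^ 2) +
        ‖ν‖ ^ 2 * ∫ x, (‖x‖ ^ 2)⁻¹ * halfspaceTrial ν f (deriv h) x ^ 2 := by
  have hu := isTestFunction_halfspaceTrial ν hf hfc hh hδ h0
  have hderiv0 : ∀ s < δ, deriv h s = 0 := fun s hs => by
    have heq : h =ᶠ[𝓝 s] fun _ => 0 := by
      filter_upwards [gt_mem_nhds hs] with r hr using h0 r hr
    rw [heq.deriv_eq, deriv_const]
  have hirad := (isTestFunction_halfspaceTrial ν (contDiff_infty_iff_deriv.1 hf).2 hfc.deriv hh hδ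
    h0).integrable_mul_sq (isOpen_inner_pos ν) (continuousOn_inv_norm_sq ν)
  have hiang := (isTestFunction_halfspaceTrial ν hf hfc (contDiff_infty_iff_deriv.1 hh).2 hδ
    hderiv0).integrable_mul_sq (isOpen_inner_pos ν) (continuousOn_inv_norm_sq ν)
  rw [← integral_const_mul, ← integral_add hirad (hiang.const_mul _)]
  refine integral_mono_of_nonneg (Eventually.of_forall fun x => sq_nonneg _)
    (hirad.add (hiang.const_mul _)) (Eventually.of_forall fun x => ?_)
  by_cases hx : 0 < ⟪ν, x⟫
  · exact norm_gradient_halfspaceTrial_sub_sq_le hf hh hx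
  · simp only [hu.eq_zero_of_notMem hx, hu.gradient_eq_zero_of_notMem hx, zero_smul, sub_zero,
      norm_zero, zero_pow two_ne_zero]
    exact add_nonneg (by positivity) (by positivity)

lemma integral_sphere_max_inner_sq_pos (hν : ν ≠ 0) :
    0 < ∫ θ : Metric.sphere (0 : E N) 1, max ⟪ν, (θ : E N)⟫ 0 ^ 2
      ∂(volume : Measure (E N)).toSphere := by
  have hν' : 0 < ‖ν‖ := norm_pos_iff.2 hν
  refine Continuous.integral_pos_of_hasCompactSupport_nonneg_nonzero
    (x := (⟨‖ν‖⁻¹ • ν, by simp [norm_smul, hν'.ne']⟩ : Metric.sphere (0 : E N) 1)) (by fun_prop)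
    (HasCompactSupport.of_compactSpace _) (fun θ => sq_nonneg _) ?_
  simp only [real_inner_smul_right, real_inner_self_eq_norm_sq]
  exact pow_ne_zero 2 (lt_max_of_lt_left (by positivity)).ne'

lemma exists_halfspace_almost_optimal (hN : N ≠ 0) (hν : ν ≠ 0) {ε : ℝ} (hε : 0 < ε) :
    ∃ u : E N → ℝ, IsTestFunction {x | 0 < ⟪ν, x⟫} u ∧
      ∫ x, ‖gradient u x‖ ^ 2 < ((N : ℝ) ^ 2 / 4 + ε) * ∫ x, (‖x‖ ^ 2)⁻¹ * u x ^ 2 := by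
  have hmem : MemLp (fun θ : Metric.sphere (0 : E N) 1 => ⟪ν, (θ : E N)⟫) 2
      (volume : Measure (E N)).toSphere :=
    Continuous.memLp_of_hasCompactSupport (by fun_prop) (HasCompactSupport.of_compactSpace _)
  obtain ⟨f, hf, hfc, hfε⟩ := exists_hasCompactSupport_integral_deriv_sq_lt (half_pos hε)
  obtain ⟨δ, hδ, h, hh, h0, hhε⟩ := exists_integral_sq_mul_deriv_sq_lt hmem
    (integral_sphere_max_inner_sq_pos hν) (show 0 < ε / (2 * ‖ν‖ ^ 2) by positivity)
  have hu := isTestFunction_halfspaceTrial ν hf hfc hh hδ h0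
  have hdefect := integral_norm_gradient_halfspaceTrial_sub_sq_le ν hf hfc hh hδ h0
  refine ⟨halfspaceTrial ν f h, hu, ?_⟩
  rw [integral_norm_gradient_sq_eq_halfspace hu, add_mul]
  gcongr
  refine hdefect.trans_lt ?_
  simp only [integral_inv_norm_sq_mul_halfspaceTrial_sq hN]
  set A := ∫ θ : Metric.sphere (0 : E N) 1, ⟪ν, (θ : E N)⟫ ^ 2 * h ⟪ν, (θ : E N)⟫ ^ 2
    ∂(volume : Measure (E N)).toSphere
  set B := ∫ θ : Metric.sphere (0 : E N) 1, ⟪ν, (θ : E N)⟫ ^ 2 * deriv h ⟪ν, (θ : E N)⟫ ^ 2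
    ∂(volume : Measure (E N)).toSphere
  have hB : 0 ≤ B := integral_nonneg fun θ => by positivity
  have hA : 0 < A := (mul_pos_iff_of_pos_left (by positivity)).1 (hB.trans_lt hhε)
  have hf0 : 0 < ∫ s, f s ^ 2 := (mul_pos_iff_of_pos_left (half_pos hε)).1
    ((integral_nonneg fun s => sq_nonneg (deriv f s)).trans_lt hfε)
  calc (A * ∫ s, deriv f s ^ 2) + ‖ν‖ ^ 2 * (B * ∫ s, f s ^ 2)
      < A * (ε / 2 * ∫ s, f s ^ 2) + ‖ν‖ ^ 2 * (ε / (2 * ‖ν‖ ^ 2) * A * ∫ s, f s ^ 2) := by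
        gcongr
    _ = ε * (A * ∫ s, f s ^ 2) := by
        field_simp
        ring

end HalfspaceTrial

section Rescaling

variable {F : Type*} [NormedAddCommGroup F] [NormedSpace ℝ F]

lemma inv_smul_add_smul_sub (p x : F) {δ : ℝ} (hδ : δ ≠ 0) : δ⁻¹ • (p + δ • x - p) = x := by
  rw [add_sub_cancel_left, inv_smul_smul₀ hδ]

lemma integral_eq_pow_finrank_mul_integral_add_smul [FiniteDimensional ℝ F] [MeasurableSpace F]
    [BorelSpace F] (μ : Measure F) [μ.IsAddHaarMeasure] (g : F → ℝ) (p : F) {δ : ℝ} (hδ : 0 < δ) :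
    ∫ y, g y ∂μ = δ ^ Module.finrank ℝ F * ∫ x, g (p + δ • x) ∂μ := by
  rw [Measure.integral_comp_smul_of_nonneg μ (fun x => g (p + x)) δ (hR := hδ.le),
    integral_add_left_eq_self, smul_eq_mul, mul_inv_cancel_left₀ (by positivity)]

lemma eventually_forall_add_smul_mem {K : Set F} (hK : Bornology.IsBounded K) {p : F} {s : Set F}
    (hs : s ∈ 𝓝 p) : ∀ᶠ δ in 𝓝[>] (0 : ℝ), ∀ x ∈ K, p + δ • x ∈ s := by
  obtain ⟨R, hR0, hR⟩ := hK.exists_pos_norm_le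
  obtain ⟨r, hr, hrs⟩ := Metric.mem_nhds_iff.1 hs
  filter_upwards [Ioo_mem_nhdsGT (show 0 < r / R by positivity)] with δ hδ x hx
  refine hrs ?_
  rw [mem_ball_iff_norm, add_sub_cancel_left, norm_smul, Real.norm_of_nonneg hδ.1.le]
  calc δ * ‖x‖ ≤ δ * R := by gcongr; exacts [hδ.1.le, hR x hx]
    _ < r := (lt_div_iff₀ hR0).1 hδ.2

end Rescaling

lemma norm_gradient_comp_rescale {F : Type*} [NormedAddCommGroup F] [InnerProductSpace ℝ F]
    [CompleteSpace F] (u : F → ℝ) (p y : F) (δ : ℝ) :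
    ‖gradient (fun y => u (δ⁻¹ • (y - p))) y‖ = |δ|⁻¹ * ‖gradient u (δ⁻¹ • (y - p))‖ := by
  rw [norm_gradient, norm_gradient, fderiv_comp_sub (f := fun y => u (δ⁻¹ • y)), fderiv_comp_smul,
    norm_smul, norm_inv, Real.norm_eq_abs]

lemma IsTestFunction.comp_rescale {Ω Ω' : Set (E N)} {u : E N → ℝ} (hu : IsTestFunction Ω' u)
    {p : E N} {δ : ℝ} (hδ : δ ≠ 0) (h : ∀ x ∈ tsupport u, p + δ • x ∈ Ω) :
    IsTestFunction Ω fun y => u (δ⁻¹ • (y - p)) where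
  contDiff := hu.contDiff.comp (by fun_prop : ContDiff ℝ ∞ fun y => δ⁻¹ • (y - p))
  hasCompactSupport := hu.hasCompactSupport.comp_homeomorph
    ((Homeomorph.subRight p).trans (Homeomorph.smulOfNeZero δ⁻¹ (inv_ne_zero hδ)))
  tsupport_subset y hy := by
    have := h _ (tsupport_comp_subset_preimage u (f := fun y => δ⁻¹ • (y - p)) (by fun_prop) hy)
    rwa [smul_inv_smul₀ hδ, add_sub_cancel] at this

lemma IsC2BoundaryPoint.exists_eventually_forall_add_smul_mem {Ω : Set (E N)} {p : E N}
    (hp : IsC2BoundaryPoint Ω p) :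
    ∃ ν : E N, ν ≠ 0 ∧ ∀ K, IsCompact K → K ⊆ {x | 0 < ⟪ν, x⟫} →
      ∀ᶠ δ in 𝓝[>] (0 : ℝ), ∀ x ∈ K, p + δ • x ∈ Ω := by
  obtain ⟨ρ, hρ, hρp, hdρ, hρΩ⟩ := hp
  refine ⟨gradient ρ p, hdρ, fun K hK hKν => ?_⟩
  obtain ⟨m, hm, hmK⟩ := hK.exists_forall_le' (f := fun x => ⟪gradient ρ p, x⟫)
    (by fun_prop) (a := 0) hKν
  obtain ⟨R, hR0, hR⟩ := hK.isBounded.exists_pos_norm_le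
  have hlo := (hρ.differentiableAt (by simp)).hasFDerivAt.isLittleO.def
    (show 0 < m / (2 * R) by positivity)
  filter_upwards [eventually_forall_add_smul_mem hK.isBounded (hlo.and hρΩ),
    self_mem_nhdsWithin] with δ hδ (hδ0 : 0 < δ) x hx
  obtain ⟨hlin, hiff⟩ := hδ x hx
  refine hiff.2 ?_
  rw [hρp, add_sub_cancel_left, sub_zero, ← inner_gradient_left, real_inner_smul_right,
    Real.norm_eq_abs, norm_smul, Real.norm_of_nonneg hδ0.le] at hlin
  have herr : m / (2 * R) * (δ * ‖x‖) ≤ δ * m / 2 :=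
    calc m / (2 * R) * (δ * ‖x‖) ≤ m / (2 * R) * (δ * R) := by gcongr; exact hR x hx
      _ = δ * m / 2 := by field_simp
  have hmain : δ * m ≤ δ * ⟪gradient ρ p, x⟫ := by gcongr; exact hmK x hx
  linarith [(abs_le.1 hlin).1, mul_pos hδ0 hm]

lemma eventually_forall_inv_norm_sq_le_V {a : Fin n → E N} (ha : Function.Injective a) (k : Fin n)
    {c : ℝ} (hc : c < n - 1) {K : Set (E N)} (hK : Bornology.IsBounded K) :
    ∀ᶠ δ in 𝓝[>] (0 : ℝ), ∀ x ∈ K, x ≠ 0 →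
      c * (‖x‖ ^ 2)⁻¹ ≤ δ ^ 2 * V a (a k + δ • x) := by
  have h := eventually_nhdsWithin_iff.1
    ((tendsto_norm_sub_sq_mul_V ha k).eventually (lt_mem_nhds hc))
  filter_upwards [eventually_forall_add_smul_mem hK h, self_mem_nhdsWithin]
    with δ hδ (hδ0 : 0 < δ) x hx hx0
  have hne : a k + δ • x ≠ a k := by simp [hδ0.ne', hx0]
  have := hδ x hx hne
  rw [add_sub_cancel_left, norm_smul, mul_pow, Real.norm_of_nonneg hδ0.le] at this
  rw [← div_eq_mul_inv, div_le_iff₀ (by positivity)]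
  linarith

section Supercritical

variable {Ω : Set (E N)} {a : Fin n → E N} {u : E N → ℝ}

lemma integral_norm_gradient_sq_comp_rescale (u : E N → ℝ) (p : E N) {δ : ℝ} (hδ : 0 < δ) :
    δ ^ 2 * ∫ y, ‖gradient (fun y => u (δ⁻¹ • (y - p))) y‖ ^ 2 =
      δ ^ N * ∫ x, ‖gradient u x‖ ^ 2 := by
  simp only [norm_gradient_comp_rescale, mul_pow]
  rw [integral_const_mul, integral_eq_pow_finrank_mul_integral_add_smul _ _ p hδ]
  simp only [inv_smul_add_smul_sub p _ hδ.ne', finrank_euclideanSpace_fin, abs_of_pos hδ]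
  field_simp

lemma mul_integral_inv_norm_sq_le_integral_V_rescale (hΩ : IsOpen Ω) (haΩ : ∀ i, a i ∉ Ω)
    {k : Fin n} {δ c : ℝ} (hδ : 0 < δ) (hc : 0 ≤ c)
    (hu : IsTestFunction Ω fun y => u (δ⁻¹ • (y - a k))) (hu0 : u 0 = 0)
    (h : ∀ x ∈ tsupport u, x ≠ 0 → c * (‖x‖ ^ 2)⁻¹ ≤ δ ^ 2 * V a (a k + δ • x)) :
    δ ^ N * (c * ∫ x, (‖x‖ ^ 2)⁻¹ * u x ^ 2) ≤
      δ ^ 2 * ∫ y, V a y * u (δ⁻¹ • (y - a k)) ^ 2 := by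
  have hint := ((hu.integrable_mul_sq hΩ (continuousOn_V haΩ)).comp_add_left (a k)).comp_smul hδ.ne'
  rw [integral_eq_pow_finrank_mul_integral_add_smul _
      (fun y => V a y * u (δ⁻¹ • (y - a k)) ^ 2) (a k) hδ, mul_left_comm (δ ^ 2),
    finrank_euclideanSpace_fin,
    ← integral_const_mul c, ← integral_const_mul (δ ^ 2)]
  simp only [inv_smul_add_smul_sub _ _ hδ.ne'] at hint ⊢
  refine mul_le_mul_of_nonneg_left ?_ (by positivity)
  refine integral_mono_of_nonneg (.of_forall fun x => by positivity) (hint.const_mul _)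
    (.of_forall fun x => ?_)
  by_cases hx : u x = 0
  · simp [hx]
  · have hx0 : x ≠ 0 := fun h0 => hx (h0 ▸ hu0)
    simpa only [← mul_assoc] using
      mul_le_mul_of_nonneg_right (h x (subset_tsupport u hx) hx0) (sq_nonneg (u x))

theorem exists_hardy_supercritical (hN : N ≠ 0) (hΩ : IsOpen Ω) (ha : Function.Injective a)
    (haΩ : ∀ i, a i ∉ Ω) {k : Fin n} (hk : IsC2BoundaryPoint Ω (a k)) {μ : ℝ}
    (hμ : (N : ℝ) ^ 2 / 4 < μ * (n - 1)) (lam : ℝ) :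
    ∃ u : E N → ℝ, IsTestFunction Ω u ∧
      lam * (∫ x, u x ^ 2) + (∫ x, ‖gradient u x‖ ^ 2) < μ * ∫ x, V a x * u x ^ 2 := by
  have hn : (1 : ℝ) ≤ n := by exact_mod_cast Fin.pos k
  have hμ0 : 0 < μ := pos_of_mul_pos_left ((by positivity : (0 : ℝ) ≤ _).trans_lt hμ) (by linarith)
  obtain ⟨c, hc, hcn⟩ := exists_between ((div_lt_iff₀' hμ0).2 hμ)
  have hc0 : 0 ≤ c := le_trans (by positivity) hc.le
  obtain ⟨ν, hν, hmem⟩ := hk.exists_eventually_forall_add_smul_mem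
  obtain ⟨u, hu, hopt⟩ :=
    exists_halfspace_almost_optimal hN hν (sub_pos.2 ((div_lt_iff₀' hμ0).1 hc))
  rw [add_sub_cancel] at hopt
  have hsmall : ∀ᶠ δ in 𝓝[>] (0 : ℝ), δ ^ 2 * (lam * ∫ x, u x ^ 2) + (∫ x, ‖gradient u x‖ ^ 2) <
      μ * c * ∫ x, (‖x‖ ^ 2)⁻¹ * u x ^ 2 := by
    have hcont : Continuous fun δ : ℝ =>
        δ ^ 2 * (lam * ∫ x, u x ^ 2) + (∫ x, ‖gradient u x‖ ^ 2) := by fun_prop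
    exact nhdsWithin_le_nhds (hcont.continuousAt.eventually_lt continuousAt_const (by simpa))
  have hK := hu.hasCompactSupport.isCompact
  obtain ⟨δ, hδ : 0 < δ, hsub, hV, hlt⟩ := (eventually_mem_nhdsWithin.and
    ((hmem _ hK hu.tsupport_subset).and
      ((eventually_forall_inv_norm_sq_le_V ha k hcn hK.isBounded).and hsmall))).exists
  have hδu := hu.comp_rescale hδ.ne' hsub
  refine ⟨_, hδu, lt_of_mul_lt_mul_left ?_ (sq_nonneg δ)⟩
  have hu0 : u 0 = 0 := hu.eq_zero_of_notMem (by simp)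
  calc δ ^ 2 * (lam * (∫ y, u (δ⁻¹ • (y - a k)) ^ 2) +
        ∫ y, ‖gradient (fun y => u (δ⁻¹ • (y - a k))) y‖ ^ 2)
      = δ ^ N * (δ ^ 2 * (lam * ∫ x, u x ^ 2) + ∫ x, ‖gradient u x‖ ^ 2) := by
        rw [mul_add, integral_norm_gradient_sq_comp_rescale u (a k) hδ,
          integral_eq_pow_finrank_mul_integral_add_smul _ _ (a k) hδ, finrank_euclideanSpace_fin]
        simp only [inv_smul_add_smul_sub _ _ hδ.ne']
        ring
    _ < δ ^ N * (μ * c * ∫ x, (‖x‖ ^ 2)⁻¹ * u x ^ 2) := by gcongr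
    _ = μ * (δ ^ N * (c * ∫ x, (‖x‖ ^ 2)⁻¹ * u x ^ 2)) := by ring
    _ ≤ μ * (δ ^ 2 * ∫ y, V a y * u (δ⁻¹ • (y - a k)) ^ 2) := by
        refine mul_le_mul_of_nonneg_left ?_ hμ0.le
        exact mul_integral_inv_norm_sq_le_integral_V_rescale hΩ haΩ hδ hc0 hδu hu0 hV
    _ = δ ^ 2 * (μ * ∫ y, V a y * u (δ⁻¹ • (y - a k)) ^ 2) := mul_left_comm _ _ _

end Supercritical

/-! ### Limits of test functions in `H¹₀` -/

section Lp

variable {α F : Type*} [MeasurableSpace α] {ν : Measure α} [NormedAddCommGroup F] {p : ℝ≥0∞}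

lemma tendsto_eLpNorm_of_tendsto_eLpNorm_sub [Fact (1 ≤ p)] {ι : Type*} {l : Filter ι}
    {f : ι → α → F} {g : α → F} (hf : ∀ k, MemLp (f k) p ν) (hg : MemLp g p ν)
    (h : Tendsto (fun k => eLpNorm (fun x => f k x - g x) p ν) l (𝓝 0)) :
    Tendsto (fun k => eLpNorm (f k) p ν) l (𝓝 (eLpNorm g p ν)) := by
  simpa only [Lp.enorm_toLp] using ((Lp.tendsto_Lp_iff_tendsto_eLpNorm'' f hf g hg).2 h).enorm

lemma exists_tendsto_eLpNorm_sub_of_cauchy [Fact (1 ≤ p)] [CompleteSpace F] {f : ℕ → α → F}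
    (hf : ∀ k, MemLp (f k) p ν)
    (h : Tendsto (fun q : ℕ × ℕ => eLpNorm (fun x => f q.1 x - f q.2 x) p ν) atTop (𝓝 0)) :
    ∃ g, MemLp g p ν ∧ Tendsto (fun k => eLpNorm (fun x => f k x - g x) p ν) atTop (𝓝 0) := by
  have hc : CauchySeq fun k => (hf k).toLp (f k) := by
    rw [Lp.cauchySeq_Lp_iff_cauchySeq_eLpNorm]
    refine h.congr fun q => eLpNorm_congr_ae ?_
    exact ((hf q.1).coeFn_toLp.sub (hf q.2).coeFn_toLp).symm
  obtain ⟨g, hg⟩ := cauchySeq_tendsto_of_complete hc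
  exact ⟨g, Lp.memLp g, (Lp.tendsto_Lp_iff_tendsto_eLpNorm'' f hf g (Lp.memLp g)).1
    (by rwa [Lp.toLp_coeFn])⟩

lemma tendsto_integral_smul_of_tendsto_eLpNorm_sub [NormedSpace ℝ F] [CompleteSpace F]
    {q : ℝ≥0∞} [Fact (1 ≤ p)] [Fact (1 ≤ q)] [p.HolderConjugate q] {ι : Type*} {l : Filter ι}
    {f : ι → α → ℝ} {g : α → ℝ} {X : ι → α → F} {Y : α → F}
    (hf : ∀ k, MemLp (f k) p ν) (hg : MemLp g p ν) (hX : ∀ k, MemLp (X k) q ν) (hY : MemLp Y q ν)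
    (hfg : Tendsto (fun k => eLpNorm (fun x => f k x - g x) p ν) l (𝓝 0))
    (hXY : Tendsto (fun k => eLpNorm (fun x => X k x - Y x) q ν) l (𝓝 0)) :
    Tendsto (fun k => ∫ x, f k x • X k x ∂ν) l (𝓝 (∫ x, g x • Y x ∂ν)) := by
  let B := (ContinuousLinearMap.lsmul ℝ ℝ : ℝ →L[ℝ] F →L[ℝ] F).lpPairing ν p q
  have hB : ∀ {u : α → ℝ} {Z : α → F} (hu : MemLp u p ν) (hZ : MemLp Z q ν),
      B (hu.toLp u) (hZ.toLp Z) = ∫ x, u x • Z x ∂ν := fun hu hZ => by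
    rw [ContinuousLinearMap.lpPairing_eq_integral]
    refine integral_congr_ae ?_
    filter_upwards [hu.coeFn_toLp, hZ.coeFn_toLp] with x h1 h2
    simp [h1, h2]
  have ht := (B.continuous₂.tendsto (hg.toLp g, hY.toLp Y)).comp
    (((Lp.tendsto_Lp_iff_tendsto_eLpNorm'' f hf g hg).2 hfg).prodMk_nhds
      ((Lp.tendsto_Lp_iff_tendsto_eLpNorm'' X hX Y hY).2 hXY))
  simpa only [Function.comp_def, Function.uncurry_apply_pair, hB] using ht

lemma eLpNorm_two_sq_eq_lintegral (f : α → F) :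
    eLpNorm f 2 ν ^ 2 = ∫⁻ x, ENNReal.ofReal (‖f x‖ ^ 2) ∂ν := by
  have h := eLpNorm_nnreal_pow_eq_lintegral (f := f) (μ := ν) (p := 2) two_ne_zero
  simp only [NNReal.coe_ofNat, ENNReal.rpow_ofNat, ENNReal.coe_ofNat] at h
  simp only [h, ENNReal.ofReal_pow (norm_nonneg _), ofReal_norm]

lemma eLpNorm_two_sq_eq_ofReal_integral {f : α → F} (hf : Integrable (fun x => ‖f x‖ ^ 2) ν) :
    eLpNorm f 2 ν ^ 2 = ENNReal.ofReal (∫ x, ‖f x‖ ^ 2 ∂ν) := by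
  rw [eLpNorm_two_sq_eq_lintegral,
    ofReal_integral_eq_lintegral_ofReal hf (.of_forall fun x => by positivity)]

lemma tendsto_eLpNorm_two_zero {ι : Type*} {l : Filter ι} {f : ι → α → F}
    (hf : ∀ k, Integrable (fun x => ‖f k x‖ ^ 2) ν)
    (h : Tendsto (fun k => ∫ x, ‖f k x‖ ^ 2 ∂ν) l (𝓝 0)) :
    Tendsto (fun k => eLpNorm (f k) 2 ν) l (𝓝 0) := by
  have h2 := (ENNReal.tendsto_ofReal h).ennrpow_const (1 / 2 : ℝ)
  rw [ENNReal.ofReal_zero, ENNReal.zero_rpow_of_pos (by norm_num)] at h2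
  refine h2.congr fun k => ?_
  rw [← eLpNorm_two_sq_eq_ofReal_integral (hf k), ← ENNReal.rpow_natCast, ← ENNReal.rpow_mul]
  norm_num

lemma exists_strictMono_tendsto_ae (hp : p ≠ 0) {f : ℕ → α → F} {g : α → F}
    (hf : ∀ k, AEStronglyMeasurable (f k) ν) (hg : AEStronglyMeasurable g ν)
    (h : Tendsto (fun k => eLpNorm (fun x => f k x - g x) p ν) atTop (𝓝 0)) :
    ∃ s : ℕ → ℕ, StrictMono s ∧ ∀ᵐ x ∂ν, Tendsto (fun k => f (s k) x) atTop (𝓝 (g x)) :=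
  (tendstoInMeasure_of_tendsto_eLpNorm hp hf hg h).exists_seq_tendsto_ae

lemma lintegral_mul_sq_le_of_tendsto {f : ℕ → α → ℝ} {g w : α → ℝ}
    (hf : ∀ k, AEStronglyMeasurable (f k) ν) (hg : AEStronglyMeasurable g ν)
    (hw : AEMeasurable w ν) {b : ℕ → ℝ≥0∞} {c : ℝ≥0∞}
    (h : Tendsto (fun k => eLpNorm (fun x => f k x - g x) 2 ν) atTop (𝓝 0))
    (hb : ∀ k, ∫⁻ x, ENNReal.ofReal (w x * f k x ^ 2) ∂ν ≤ b k) (hbc : Tendsto b atTop (𝓝 c)) :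
    ∫⁻ x, ENNReal.ofReal (w x * g x ^ 2) ∂ν ≤ c := by
  obtain ⟨s, hs, hae⟩ := exists_strictMono_tendsto_ae two_ne_zero hf hg h
  calc ∫⁻ x, ENNReal.ofReal (w x * g x ^ 2) ∂ν
      = ∫⁻ x, liminf (fun k => ENNReal.ofReal (w x * f (s k) x ^ 2)) atTop ∂ν := by
        refine lintegral_congr_ae ?_
        filter_upwards [hae] with x hx
        exact (ENNReal.tendsto_ofReal ((hx.pow 2).const_mul (w x))).liminf_eq.symm
    _ ≤ liminf (fun k => ∫⁻ x, ENNReal.ofReal (w x * f (s k) x ^ 2) ∂ν) atTop :=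
        lintegral_liminf_le' fun k => (hw.mul ((hf _).aemeasurable.pow_const 2)).ennreal_ofReal
    _ ≤ liminf (fun k => b (s k)) atTop := liminf_le_liminf (.of_forall fun k => hb (s k))
    _ = c := (hbc.comp hs.tendsto_atTop).liminf_eq

lemma tendsto_eLpNorm_mul_of_cauchy [Fact (1 ≤ p)] {f : ℕ → α → ℝ} {g η : α → ℝ}
    (hf : ∀ k, AEStronglyMeasurable (f k) ν) (hg : AEStronglyMeasurable g ν)
    (h : Tendsto (fun k => eLpNorm (fun x => f k x - g x) p ν) atTop (𝓝 0))
    (hη : ∀ k, MemLp (fun x => η x * f k x) p ν)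
    (hc : Tendsto (fun q : ℕ × ℕ => eLpNorm (fun x => η x * f q.1 x - η x * f q.2 x) p ν)
      atTop (𝓝 0)) :
    Tendsto (fun k => eLpNorm (fun x => η x * f k x) p ν) atTop
      (𝓝 (eLpNorm (fun x => η x * g x) p ν)) := by
  have hp : p ≠ 0 := (one_pos.trans_le (Fact.out : 1 ≤ p)).ne'
  obtain ⟨G, hG, hlim⟩ := exists_tendsto_eLpNorm_sub_of_cauchy hη hc
  obtain ⟨s, hs, hae⟩ := exists_strictMono_tendsto_ae hp hf hg h
  obtain ⟨t, ht, hae'⟩ := exists_strictMono_tendsto_ae hp (fun k => (hη (s k)).1) hG.1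
    (hlim.comp hs.tendsto_atTop)
  have hGg : G =ᵐ[ν] fun x => η x * g x := by
    filter_upwards [hae, hae'] with x hx hx'
    exact tendsto_nhds_unique hx' ((hx.comp ht.tendsto_atTop).const_mul (η x))
  rw [← eLpNorm_congr_ae hGg]
  exact tendsto_eLpNorm_of_tendsto_eLpNorm_sub hη hG hlim

end Lp

section TestFunction

variable {Ω : Set (E N)} {u v : E N → ℝ} {G : E N → E N}

namespace IsTestFunction

lemma memLp (hu : IsTestFunction Ω u) : MemLp u 2 (volume.restrict Ω) :=
  (hu.continuous.memLp_of_hasCompactSupport hu.hasCompactSupport).restrict Ω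

lemma memLp_gradient (hu : IsTestFunction Ω u) : MemLp (gradient u) 2 (volume.restrict Ω) :=
  (memLp_two_iff_integrable_sq_norm hu.continuous_gradient.aestronglyMeasurable).2
    hu.integrable_norm_gradient_sq.restrict

lemma lintegral_mul_sq (hΩ : IsOpen Ω) (hu : IsTestFunction Ω u) {w : E N → ℝ}
    (hw : ContinuousOn w Ω) (hw0 : ∀ x ∈ Ω, 0 ≤ w x) :
    ∫⁻ x in Ω, ENNReal.ofReal (w x * u x ^ 2) = ENNReal.ofReal (∫ x, w x * u x ^ 2) := by
  rw [← hu.setIntegral_mul_sq, ofReal_integral_eq_lintegral_ofReal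
    (hu.integrable_mul_sq hΩ hw).restrict]
  exact ae_restrict_of_forall_mem hΩ.measurableSet fun x hx => mul_nonneg (hw0 x hx) (sq_nonneg _)

lemma lintegral_norm_gradient_sq (hu : IsTestFunction Ω u) :
    ∫⁻ x in Ω, ENNReal.ofReal (‖gradient u x‖ ^ 2) = ENNReal.ofReal (∫ x, ‖gradient u x‖ ^ 2) := by
  rw [← hu.setIntegral_norm_gradient_sq, ofReal_integral_eq_lintegral_ofReal
    hu.integrable_norm_gradient_sq.restrict (.of_forall fun x => by positivity)]

lemma hasWeakGradient (hu : IsTestFunction Ω u) : HasWeakGradient Ω u (gradient u) := by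
  intro φ hφ
  have hcu := hu.continuous
  have hcφ := hφ.continuous
  have hgu := hu.continuous_gradient
  have hgφ := hφ.continuous_gradient
  have hi1 : Integrable fun x => u x • gradient φ x :=
    Continuous.integrable_of_hasCompactSupport (by fun_prop) hu.hasCompactSupport.smul_right
  have hi2 : Integrable fun x => φ x • gradient u x :=
    Continuous.integrable_of_hasCompactSupport (by fun_prop) hφ.hasCompactSupport.smul_right
  have hi : Integrable fun x => u x • gradient φ x + φ x • gradient u x := hi1.add hi2
  rw [setIntegral_eq_integral_of_forall_compl_eq_zero fun x hx => by
      simp [hu.eq_zero_of_notMem hx],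
    setIntegral_eq_integral_of_forall_compl_eq_zero fun x hx => by
      simp [hφ.eq_zero_of_notMem hx],
    ← add_eq_zero_iff_eq_neg, ← integral_add hi1 hi2]
  refine ext_inner_left ℝ fun v => ?_
  rw [← integral_inner hi, inner_zero_right,
    ← integral_fderiv_apply_eq_zero volume (f := fun x => u x * φ x)
      ((hu.contDiff.mul hφ.contDiff).of_le (by simp)) hu.hasCompactSupport.mul_right v]
  congr 1 with x
  rw [← inner_gradient_left, (hasGradientAt_mul (hu.hasGradientAt x) (hφ.hasGradientAt x)).gradient,
    real_inner_comm]

lemma memH10 (hu : IsTestFunction Ω u) : MemH10 Ω u (gradient u) :=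
  ⟨hu.memLp, hu.memLp_gradient, hu.hasWeakGradient, fun _ => u, fun _ => hu, by simp, by simp⟩

end IsTestFunction

lemma memH10_of_tendsto {φ : ℕ → E N → ℝ} (hφ : ∀ k, IsTestFunction Ω (φ k))
    (hu : MemLp u 2 (volume.restrict Ω)) (hG : MemLp G 2 (volume.restrict Ω))
    (h0 : Tendsto (fun k => eLpNorm (fun x => φ k x - u x) 2 (volume.restrict Ω)) atTop (𝓝 0))
    (h1 : Tendsto (fun k => eLpNorm (fun x => gradient (φ k) x - G x) 2 (volume.restrict Ω))
      atTop (𝓝 0)) : MemH10 Ω u G := by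
  refine ⟨hu, hG, fun χ hχ => ?_, φ, hφ, h0, h1⟩
  have hlhs := tendsto_integral_smul_of_tendsto_eLpNorm_sub (fun k => (hφ k).memLp) hu
    (fun _ => hχ.memLp_gradient) hχ.memLp_gradient h0 (by simp)
  have hrhs := tendsto_integral_smul_of_tendsto_eLpNorm_sub (fun _ => hχ.memLp) hχ.memLp
    (fun k => (hφ k).memLp_gradient) hG (by simp) h1
  exact tendsto_nhds_unique hlhs (hrhs.neg.congr fun k => ((hφ k).hasWeakGradient χ hχ).symm)

lemma exists_memH10_of_cauchy {φ : ℕ → E N → ℝ} (hφ : ∀ k, IsTestFunction Ω (φ k))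
    (h0 : Tendsto (fun q : ℕ × ℕ => ∫ x, (φ q.1 x - φ q.2 x) ^ 2) atTop (𝓝 0))
    (h1 : Tendsto (fun q : ℕ × ℕ => ∫ x, ‖gradient (fun x => φ q.1 x - φ q.2 x) x‖ ^ 2)
      atTop (𝓝 0)) :
    ∃ u G, MemH10 Ω u G ∧
      Tendsto (fun k => eLpNorm (fun x => φ k x - u x) 2 (volume.restrict Ω)) atTop (𝓝 0) ∧
      Tendsto (fun k => eLpNorm (fun x => gradient (φ k) x - G x) 2 (volume.restrict Ω))
        atTop (𝓝 0) := by
  have hsub := fun q : ℕ × ℕ => (hφ q.1).sub (hφ q.2)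
  obtain ⟨u, hu, hul⟩ := exists_tendsto_eLpNorm_sub_of_cauchy (fun k => (hφ k).memLp)
    (tendsto_eLpNorm_two_zero (ν := volume.restrict Ω)
      (fun q => by simpa using (hsub q).integrable_sq.restrict)
      (h0.congr fun q => by simp [(hsub q).setIntegral_sq]))
  obtain ⟨G, hG, hGl⟩ := exists_tendsto_eLpNorm_sub_of_cauchy (fun k => (hφ k).memLp_gradient)
    ((tendsto_eLpNorm_two_zero (ν := volume.restrict Ω)
      (fun q => (hsub q).integrable_norm_gradient_sq.restrict)
      (h1.congr fun q => (hsub q).setIntegral_norm_gradient_sq.symm)).congr fun q => by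
        congr 1; ext x
        rw [gradient_fun_sub ((hφ q.1).differentiable x) ((hφ q.2).differentiable x)])
  exact ⟨u, G, memH10_of_tendsto hφ hu hG hul hGl, hul, hGl⟩

lemma MemH10.lintegral_mul_sq_le (hΩ : IsOpen Ω) (hu : MemH10 Ω u G) {w : E N → ℝ}
    (hw : ContinuousOn w Ω) (hw0 : ∀ x ∈ Ω, 0 ≤ w x)
    (h : ∀ φ, IsTestFunction Ω φ → ∫ x, w x * φ x ^ 2 ≤ ∫ x, ‖gradient φ x‖ ^ 2) :
    ∫⁻ x in Ω, ENNReal.ofReal (w x * u x ^ 2) ≤ ∫⁻ x in Ω, ENNReal.ofReal (‖G x‖ ^ 2) := by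
  obtain ⟨φ, hφ, h0, h1⟩ := hu.approx
  rw [← eLpNorm_two_sq_eq_lintegral]
  refine lintegral_mul_sq_le_of_tendsto (fun k => (hφ k).memLp.1) hu.memLp.1
    (hw.aemeasurable hΩ.measurableSet) h0 (fun k => ?_) (ENNReal.Tendsto.pow
      (tendsto_eLpNorm_of_tendsto_eLpNorm_sub (fun k => (hφ k).memLp_gradient) hu.memLp_grad h1))
  rw [(hφ k).lintegral_mul_sq hΩ hw hw0, eLpNorm_two_sq_eq_lintegral,
    (hφ k).lintegral_norm_gradient_sq]
  exact ENNReal.ofReal_le_ofReal (h _ (hφ k))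

lemma lintegral_mul_sq_ne_zero (hΩ : IsOpen Ω) (hu : AEStronglyMeasurable u (volume.restrict Ω))
    (hu0 : ¬ (u =ᵐ[volume.restrict Ω] 0)) {w : E N → ℝ} (hw : ContinuousOn w Ω)
    (hw0 : ∀ x ∈ Ω, 0 < w x) : ∫⁻ x in Ω, ENNReal.ofReal (w x * u x ^ 2) ≠ 0 := by
  refine fun h => hu0 ?_
  rw [lintegral_eq_zero_iff'
    (by exact ((hw.aemeasurable hΩ.measurableSet).mul
      (hu.aemeasurable.pow_const 2)).ennreal_ofReal)] at h
  filter_upwards [h, ae_restrict_mem hΩ.measurableSet] with x hx hxΩ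
  by_contra h'
  exact (ENNReal.ofReal_pos.2 (mul_pos (hw0 x hxΩ) (sq_pos_of_ne_zero h'))).ne' hx

lemma MemH10.lintegral_norm_sq_ne_top (hu : MemH10 Ω u G) :
    ∫⁻ x in Ω, ENNReal.ofReal (‖G x‖ ^ 2) ≠ ⊤ := by
  rw [← eLpNorm_two_sq_eq_lintegral]
  exact ENNReal.pow_ne_top hu.memLp_grad.eLpNorm_ne_top

end TestFunction

/-! ### The Hardy constant and its minimizers -/

section HardyConst

variable {Ω : Set (E N)} {a : Fin n → E N} {u v : E N → ℝ} {G : E N → E N}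

lemma hardyConst_le_hardyQuotient (h : Admissible Ω u G) :
    hardyConst Ω a ≤ hardyQuotient Ω a u G :=
  iInf_le_of_le u (iInf_le_of_le G (iInf_le _ h))

lemma MemH10.admissible {w : E N → ℝ} (hu : MemH10 Ω u G)
    (h : ∫⁻ x in Ω, ENNReal.ofReal (w x * u x ^ 2) ≠ 0) : Admissible Ω u G := by
  refine ⟨hu, fun h0 => h ?_⟩
  refine (lintegral_congr_ae ?_).trans lintegral_zero
  filter_upwards [h0] with x hx
  simp [hx]

lemma ofReal_le_hardyConst_iff (hn : 2 ≤ n) (ha : Function.Injective a) (hΩ : IsOpen Ω)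
    (haΩ : ∀ i, a i ∉ Ω) {t : ℝ} (ht : 0 ≤ t) :
    ENNReal.ofReal t ≤ hardyConst Ω a ↔
      ∀ u, IsTestFunction Ω u → t * (∫ x, V a x * u x ^ 2) ≤ ∫ x, ‖gradient u x‖ ^ 2 := by
  have hV : ContinuousOn (V a) Ω := continuousOn_V haΩ
  have hVpos : ∀ x ∈ Ω, 0 < V a x := fun x hx =>
    V_pos hn ha fun i => ne_of_mem_of_not_mem hx (haΩ i)
  constructor
  · intro h u hu
    have hG : 0 ≤ ∫ x, ‖gradient u x‖ ^ 2 := integral_nonneg fun x => by positivity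
    have hD := hu.lintegral_mul_sq hΩ hV fun x _ => V_nonneg a x
    rcases (integral_V_mul_sq_nonneg a u).eq_or_lt with h0 | h0
    · rwa [← h0, mul_zero]
    have hle := h.trans (hardyConst_le_hardyQuotient
      (hu.memH10.admissible (w := V a) (by simpa [hD] using h0)))
    rw [hardyQuotient, hu.lintegral_norm_gradient_sq, hD, ← ENNReal.ofReal_div_of_pos h0,
      ENNReal.ofReal_le_ofReal_iff (by positivity)] at hle
    exact (le_div_iff₀ h0).1 hle
  · refine fun h => le_iInf fun u => le_iInf fun G => le_iInf fun hu => ?_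
    have hD := lintegral_mul_sq_ne_zero hΩ hu.1.memLp.1 hu.2 hV hVpos
    have hle := hu.1.lintegral_mul_sq_le hΩ (hV.const_mul t)
      (fun x _ => mul_nonneg ht (V_nonneg a x)) fun φ hφ => by
        simpa only [mul_assoc, integral_const_mul] using h φ hφ
    simp only [mul_assoc, ENNReal.ofReal_mul ht] at hle
    rw [lintegral_const_mul' _ _ ENNReal.ofReal_ne_top] at hle
    exact (ENNReal.le_div_iff_mul_le (.inl hD) (.inr hu.1.lintegral_norm_sq_ne_top)).2 hle

lemma toReal_hardyConst_mul_le (hn : 2 ≤ n) (ha : Function.Injective a) (hΩ : IsOpen Ω)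
    (haΩ : ∀ i, a i ∉ Ω) (hu : IsTestFunction Ω u) :
    (hardyConst Ω a).toReal * (∫ x, V a x * u x ^ 2) ≤ ∫ x, ‖gradient u x‖ ^ 2 :=
  (ofReal_le_hardyConst_iff hn ha hΩ haΩ ENNReal.toReal_nonneg).1 ENNReal.ofReal_toReal_le u hu

lemma hardyConst_le_ofReal (hn : 2 ≤ n) (ha : Function.Injective a) (hΩ : IsOpen Ω)
    (haΩ : ∀ i, a i ∉ Ω) {t : ℝ} (ht : 0 ≤ t)
    (h : ∀ μ, t < μ → ∃ u, IsTestFunction Ω u ∧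
      ∫ x, ‖gradient u x‖ ^ 2 < μ * ∫ x, V a x * u x ^ 2) :
    hardyConst Ω a ≤ ENNReal.ofReal t := by
  by_contra! hlt
  obtain ⟨μ, -, htμ, hμ⟩ := ENNReal.lt_iff_exists_real_btwn.1 hlt
  obtain ⟨u, hu, hlt'⟩ := h μ (ENNReal.ofReal_lt_ofReal_iff'.1 htμ).1
  have hμ0 : 0 ≤ μ := ht.trans (ENNReal.ofReal_lt_ofReal_iff'.1 htμ).1.le
  exact hlt'.not_ge ((ofReal_le_hardyConst_iff hn ha hΩ haΩ hμ0).1 hμ.le u hu)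

lemma IsTestFunction.exists_normalized {t : ℝ} (hu : IsTestFunction Ω u)
    (h : ∫ x, ‖gradient u x‖ ^ 2 < t * ∫ x, V a x * u x ^ 2) :
    ∃ v, IsTestFunction Ω v ∧ ∫ x, V a x * v x ^ 2 = 1 ∧ ∫ x, ‖gradient v x‖ ^ 2 < t := by
  set D := ∫ x, V a x * u x ^ 2 with hD
  have hD0 : 0 < D := by
    refine (integral_V_mul_sq_nonneg a u).lt_of_ne fun h0 => h.not_ge ?_
    rw [hD, ← h0, mul_zero]
    positivity
  have hsq : (√D)⁻¹ ^ 2 = D⁻¹ := by rw [inv_pow, Real.sq_sqrt hD0.le]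
  refine ⟨_, hu.const_mul (√D)⁻¹, ?_, ?_⟩
  · simp only [mul_pow, hsq, mul_left_comm (V a _), integral_const_mul]
    exact inv_mul_cancel₀ hD0.ne'
  · simp only [gradient_fun_const_mul (hu.differentiable _), norm_smul, mul_pow, norm_inv,
      Real.norm_of_nonneg D.sqrt_nonneg, hsq, integral_const_mul]
    rwa [inv_mul_lt_iff₀ hD0, mul_comm]

lemma exists_minimizing_sequence (hn : 2 ≤ n) (ha : Function.Injective a) (hΩ : IsOpen Ω)
    (haΩ : ∀ i, a i ∉ Ω) (hfin : hardyConst Ω a ≠ ⊤) :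
    ∃ φ : ℕ → E N → ℝ, (∀ k, IsTestFunction Ω (φ k)) ∧ (∀ k, ∫ x, V a x * φ k x ^ 2 = 1) ∧
      Tendsto (fun k => ∫ x, ‖gradient (φ k) x‖ ^ 2) atTop (𝓝 (hardyConst Ω a).toReal) := by
  set m := (hardyConst Ω a).toReal
  have hex : ∀ k : ℕ, ∃ u, IsTestFunction Ω u ∧ ∫ x, V a x * u x ^ 2 = 1 ∧
      ∫ x, ‖gradient u x‖ ^ 2 < m + 1 / ((k : ℝ) + 1) := by
    intro k
    have hk : (0 : ℝ) < 1 / ((k : ℝ) + 1) := by positivity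
    have hm0 : 0 ≤ m := ENNReal.toReal_nonneg
    have hlt := mt (ofReal_le_hardyConst_iff hn ha hΩ haΩ (add_nonneg hm0 hk.le)).2
      (by rw [not_le, ENNReal.lt_ofReal_iff_toReal_lt hfin]; exact lt_add_of_pos_right m hk)
    push Not at hlt
    obtain ⟨u, hu, hlt⟩ := hlt
    exact hu.exists_normalized hlt
  choose φ hφ hφV hφG using hex
  refine ⟨φ, hφ, hφV, tendsto_of_tendsto_of_tendsto_of_le_of_le tendsto_const_nhds
    (by simpa using tendsto_one_div_add_atTop_nhds_zero_nat.const_add m) (fun k => ?_)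
    fun k => (hφG k).le⟩
  simpa [hφV] using toReal_hardyConst_mul_le hn ha hΩ haΩ (hφ k)

lemma exists_strictMono_tendsto_integral_sq_sub_of_energy (hN : N ≠ 0) (hΩ : IsOpen Ω)
    (hb : Bornology.IsBounded Ω) {φ : ℕ → E N → ℝ} (hφ : ∀ k, IsTestFunction Ω (φ k)) {A : ℝ}
    (hA : ∀ k, ∫ x, ‖gradient (φ k) x‖ ^ 2 ≤ A) :
    ∃ s : ℕ → ℕ, StrictMono s ∧
      Tendsto (fun q : ℕ × ℕ => ∫ x, (φ (s q.1) x - φ (s q.2) x) ^ 2) atTop (𝓝 0) := by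
  obtain ⟨R, hR, hΩR⟩ := hb.exists_pos_norm_le
  have hc : 0 < ((N : ℝ) / (2 * R)) ^ 2 := by positivity
  have hL2 : ∀ k, ∫ x, φ k x ^ 2 ≤ (((N : ℝ) / (2 * R)) ^ 2)⁻¹ * A := fun k => by
    rw [le_inv_mul_iff₀ hc]
    exact (poincare_of_norm_le hΩ hΩR (hφ k)).trans (hA k)
  exact exists_strictMono_tendsto_integral_sq_sub hb hφ
    (fun k => (hL2 k).trans (le_max_left _ _)) fun k => (hA k).trans (le_max_right _ _)

lemma IsTestFunction.energy_parallelogram (hΩ : IsOpen Ω) (haΩ : ∀ i, a i ∉ Ω) (m : ℝ)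
    (hu : IsTestFunction Ω u) (hv : IsTestFunction Ω v) :
    ((∫ x, ‖gradient (fun x => u x + v x) x‖ ^ 2) - m * ∫ x, V a x * (u x + v x) ^ 2) +
      ((∫ x, ‖gradient (fun x => u x - v x) x‖ ^ 2) - m * ∫ x, V a x * (u x - v x) ^ 2) =
      2 * ((∫ x, ‖gradient u x‖ ^ 2) - m * ∫ x, V a x * u x ^ 2) +
      2 * ((∫ x, ‖gradient v x‖ ^ 2) - m * ∫ x, V a x * v x ^ 2) := by
  have hV : ContinuousOn (V a) Ω := continuousOn_V haΩ
  have hint : ∀ {w}, IsTestFunction Ω w →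
      Integrable fun x => ‖gradient w x‖ ^ 2 - m * (V a x * w x ^ 2) := fun hw =>
    hw.integrable_norm_gradient_sq.sub ((hw.integrable_mul_sq hΩ hV).const_mul m)
  have henergy : ∀ {w}, IsTestFunction Ω w →
      (∫ x, ‖gradient w x‖ ^ 2) - m * (∫ x, V a x * w x ^ 2) =
        ∫ x, (‖gradient w x‖ ^ 2 - m * (V a x * w x ^ 2)) := fun hw => by
    rw [integral_sub hw.integrable_norm_gradient_sq ((hw.integrable_mul_sq hΩ hV).const_mul m),
      integral_const_mul]
  rw [henergy hu, henergy hv, henergy (hu.add hv), henergy (hu.sub hv),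
    ← integral_add (hint (hu.add hv)) (hint (hu.sub hv)), ← integral_const_mul,
    ← integral_const_mul, ← integral_add ((hint hu).const_mul 2) ((hint hv).const_mul 2)]
  congr 1
  ext x
  rw [gradient_fun_add (hu.differentiable x) (hv.differentiable x),
    gradient_fun_sub (hu.differentiable x) (hv.differentiable x)]
  linear_combination parallelogram_law_with_norm ℝ (gradient u x) (gradient v x)

lemma tendsto_integral_sub_of_minimizing (hΩ : IsOpen Ω) (haΩ : ∀ i, a i ∉ Ω) {m μ c : ℝ}
    (hm : ∀ u, IsTestFunction Ω u → m * (∫ x, V a x * u x ^ 2) ≤ ∫ x, ‖gradient u x‖ ^ 2)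
    (hmμ : m < μ) (hμ : ∀ u, IsTestFunction Ω u →
      μ * (∫ x, V a x * u x ^ 2) ≤ c * (∫ x, u x ^ 2) + ∫ x, ‖gradient u x‖ ^ 2)
    {φ : ℕ → E N → ℝ} (hφ : ∀ k, IsTestFunction Ω (φ k)) (hφV : ∀ k, ∫ x, V a x * φ k x ^ 2 = 1)
    (hφG : Tendsto (fun k => ∫ x, ‖gradient (φ k) x‖ ^ 2) atTop (𝓝 m))
    (h0 : Tendsto (fun q : ℕ × ℕ => ∫ x, (φ q.1 x - φ q.2 x) ^ 2) atTop (𝓝 0)) :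
    Tendsto (fun q : ℕ × ℕ => ∫ x, V a x * (φ q.1 x - φ q.2 x) ^ 2) atTop (𝓝 0) ∧
      Tendsto (fun q : ℕ × ℕ => ∫ x, ‖gradient (fun x => φ q.1 x - φ q.2 x) x‖ ^ 2)
        atTop (𝓝 0) := by
  set d : ℕ × ℕ → ℝ := fun q => ∫ x, (φ q.1 x - φ q.2 x) ^ 2
  set dV : ℕ × ℕ → ℝ := fun q => ∫ x, V a x * (φ q.1 x - φ q.2 x) ^ 2
  set dG : ℕ × ℕ → ℝ := fun q => ∫ x, ‖gradient (fun x => φ q.1 x - φ q.2 x) x‖ ^ 2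
  set e : ℕ × ℕ → ℝ := fun q => 2 * ((∫ x, ‖gradient (φ q.1) x‖ ^ 2) - m) +
    2 * ((∫ x, ‖gradient (φ q.2) x‖ ^ 2) - m)
  have he : Tendsto e atTop (𝓝 0) := by
    rw [← prod_atTop_atTop_eq]
    simpa using ((hφG.comp tendsto_fst).sub_const m |>.const_mul 2).add
      ((hφG.comp tendsto_snd).sub_const m |>.const_mul 2)
  have hgap : ∀ q, dG q - m * dV q ≤ e q := fun q => by
    have h := (hφ q.1).energy_parallelogram hΩ haΩ m (hφ q.2)
    rw [hφV, hφV, mul_one] at h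
    linarith [hm _ ((hφ q.1).add (hφ q.2))]
  have hVle : ∀ q, dV q ≤ (μ - m)⁻¹ * (c * d q + e q) := fun q => by
    rw [le_inv_mul_iff₀ (sub_pos.2 hmμ)]
    linarith [hμ _ ((hφ q.1).sub (hφ q.2)), hgap q]
  have hdV : Tendsto dV atTop (𝓝 0) :=
    squeeze_zero (fun q => integral_V_mul_sq_nonneg a _) hVle
      (by simpa using ((h0.const_mul c).add he).const_mul (μ - m)⁻¹)
  refine ⟨hdV, squeeze_zero (g := fun q => e q + m * dV q)
    (fun q => integral_nonneg fun x => by positivity) (fun q => by linarith [hgap q]) ?_⟩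
  simpa using he.add (hdV.const_mul m)

lemma tendsto_lintegral_V_mul_sq (hΩ : IsOpen Ω) (haΩ : ∀ i, a i ∉ Ω) {φ : ℕ → E N → ℝ}
    (hφ : ∀ k, IsTestFunction Ω (φ k)) (hu : AEStronglyMeasurable u (volume.restrict Ω))
    (hlim : Tendsto (fun k => eLpNorm (fun x => φ k x - u x) 2 (volume.restrict Ω)) atTop (𝓝 0))
    (hc : Tendsto (fun q : ℕ × ℕ => ∫ x, V a x * (φ q.1 x - φ q.2 x) ^ 2) atTop (𝓝 0)) :
    Tendsto (fun k => ∫⁻ x in Ω, ENNReal.ofReal (V a x * φ k x ^ 2)) atTop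
      (𝓝 (∫⁻ x in Ω, ENNReal.ofReal (V a x * u x ^ 2))) := by
  have hV : ContinuousOn (V a) Ω := continuousOn_V haΩ
  have hsq : ∀ x r, ‖√(V a x) * r‖ ^ 2 = V a x * r ^ 2 := fun x r => by
    rw [Real.norm_eq_abs, sq_abs, mul_pow, Real.sq_sqrt (V_nonneg a x)]
  have hint : ∀ {w}, IsTestFunction Ω w →
      Integrable (fun x => ‖√(V a x) * w x‖ ^ 2) (volume.restrict Ω) := fun hw => by
    simpa only [hsq] using (hw.integrable_mul_sq hΩ hV).restrict
  have hmem : ∀ k, MemLp (fun x => √(V a x) * φ k x) 2 (volume.restrict Ω) := fun k =>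
    (memLp_two_iff_integrable_sq_norm ((measurable_V a).sqrt.aestronglyMeasurable.mul
      (hφ k).continuous.aestronglyMeasurable)).2 (hint (hφ k))
  have hsub := fun q : ℕ × ℕ => (hφ q.1).sub (hφ q.2)
  have h := ENNReal.Tendsto.pow (n := 2) (tendsto_eLpNorm_mul_of_cauchy
    (fun k => (hφ k).memLp.1) hu hlim hmem
    ((tendsto_eLpNorm_two_zero (fun q => hint (hsub q)) (hc.congr fun q => by
      simp only [hsq, (hsub q).setIntegral_mul_sq])).congr fun q => by
        simp only [mul_sub]))
  simpa only [eLpNorm_two_sq_eq_lintegral, hsq] using h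

end HardyConst

section Attainment

variable {Ω : Set (E N)} {a : Fin n → E N}

lemma exists_normalized_minimizer (hN : N ≠ 0) (hn : 2 ≤ n) (ha : Function.Injective a)
    (hΩ : IsOpen Ω) (hb : Bornology.IsBounded Ω) (haΩ : ∀ i, a i ∉ Ω) {μ c : ℝ}
    (hμ : ∀ u, IsTestFunction Ω u →
      μ * (∫ x, V a x * u x ^ 2) ≤ c * (∫ x, u x ^ 2) + ∫ x, ‖gradient u x‖ ^ 2)
    (hlt : hardyConst Ω a < ENNReal.ofReal μ) :
    ∃ u G, MemH10 Ω u G ∧ ∫⁻ x in Ω, ENNReal.ofReal (V a x * u x ^ 2) = 1 ∧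
      ∫⁻ x in Ω, ENNReal.ofReal (‖G x‖ ^ 2) = hardyConst Ω a := by
  have hfin := hlt.ne_top
  obtain ⟨φ, hφ, hφV, hφG⟩ := exists_minimizing_sequence hn ha hΩ haΩ hfin
  obtain ⟨A, hA⟩ := hφG.bddAbove_range
  obtain ⟨s, hs, hL2⟩ := exists_strictMono_tendsto_integral_sq_sub_of_energy hN hΩ hb hφ
    fun k => hA ⟨k, rfl⟩
  have hsG := hφG.comp hs.tendsto_atTop
  obtain ⟨hVc, hGc⟩ := tendsto_integral_sub_of_minimizing hΩ haΩ
    (fun _ => toReal_hardyConst_mul_le hn ha hΩ haΩ)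
    ((ENNReal.lt_ofReal_iff_toReal_lt hfin).1 hlt) hμ (fun k => hφ (s k)) (fun k => hφV (s k))
    hsG hL2
  obtain ⟨u, G, hu, hul, hGl⟩ := exists_memH10_of_cauchy (fun k => hφ (s k)) hL2 hGc
  refine ⟨u, G, hu, ?_, ?_⟩
  · refine tendsto_nhds_unique
      (tendsto_lintegral_V_mul_sq hΩ haΩ (fun k => hφ (s k)) hu.memLp.1 hul hVc) ?_
    simp only [(hφ _).lintegral_mul_sq hΩ (continuousOn_V haΩ) fun x _ => V_nonneg a x, hφV,
      ENNReal.ofReal_one, tendsto_const_nhds]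
  · rw [← eLpNorm_two_sq_eq_lintegral, ← ENNReal.ofReal_toReal hfin]
    refine tendsto_nhds_unique (ENNReal.Tendsto.pow (tendsto_eLpNorm_of_tendsto_eLpNorm_sub
      (fun k => (hφ (s k)).memLp_gradient) hu.memLp_grad hGl)) ((ENNReal.tendsto_ofReal hsG).congr
        fun k => ?_)
    rw [eLpNorm_two_sq_eq_lintegral, (hφ (s k)).lintegral_norm_gradient_sq, Function.comp_apply]

lemma exists_minimizer (hN : N ≠ 0) (hn : 2 ≤ n) (ha : Function.Injective a)
    (hΩ : IsOpen Ω) (hb : Bornology.IsBounded Ω) (haΩ : ∀ i, a i ∉ Ω) {μ c : ℝ}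
    (hμ : ∀ u, IsTestFunction Ω u →
      μ * (∫ x, V a x * u x ^ 2) ≤ c * (∫ x, u x ^ 2) + ∫ x, ‖gradient u x‖ ^ 2)
    (hlt : hardyConst Ω a < ENNReal.ofReal μ) :
    ∃ u G, Admissible Ω u G ∧ hardyQuotient Ω a u G = hardyConst Ω a := by
  obtain ⟨u, G, hu, hV, hG⟩ := exists_normalized_minimizer hN hn ha hΩ hb haΩ hμ hlt
  exact ⟨u, G, hu.admissible (hV ▸ one_ne_zero), by rw [hardyQuotient, hV, hG, div_one]⟩

lemma ofReal_lt_hardyConst (hN : N ≠ 0) (hn : 2 ≤ n) (ha : Function.Injective a)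
    (hΩ : IsOpen Ω) (hb : Bornology.IsBounded Ω) (haΩ : ∀ i, a i ∉ Ω) {β μ c : ℝ} (hβ : 0 ≤ β)
    (hβμ : β < μ) (hμ : ∀ u, IsTestFunction Ω u →
      μ * (∫ x, V a x * u x ^ 2) ≤ c * (∫ x, u x ^ 2) + ∫ x, ‖gradient u x‖ ^ 2)
    {w : E N → ℝ} (hw : ContinuousOn w Ω) (hw0 : ∀ x ∈ Ω, 0 < w x)
    (hβw : ∀ u, IsTestFunction Ω u →
      β * (∫ x, V a x * u x ^ 2) + (∫ x, w x * u x ^ 2) ≤ ∫ x, ‖gradient u x‖ ^ 2) :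
    ENNReal.ofReal β < hardyConst Ω a := by
  rcases le_or_gt (ENNReal.ofReal μ) (hardyConst Ω a) with hle | hlt
  · exact ((ENNReal.ofReal_lt_ofReal_iff (hβ.trans_lt hβμ)).2 hβμ).trans_le hle
  obtain ⟨u, G, hu, hV1, hG⟩ := exists_normalized_minimizer hN hn ha hΩ hb haΩ hμ hlt
  have hV : ContinuousOn (V a) Ω := continuousOn_V haΩ
  have hpos : ∫⁻ x in Ω, ENNReal.ofReal (w x * u x ^ 2) ≠ 0 :=
    lintegral_mul_sq_ne_zero hΩ hu.memLp.1 (hu.admissible (hV1 ▸ one_ne_zero)).2 hw hw0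
  have hmeas : AEMeasurable (fun x => ENNReal.ofReal (V a x * u x ^ 2)) (volume.restrict Ω) :=
    ((measurable_V a).aemeasurable.mul (hu.memLp.1.aemeasurable.pow_const 2)).ennreal_ofReal
  have hsplit : ∫⁻ x in Ω, ENNReal.ofReal ((β * V a x + w x) * u x ^ 2) =
      ENNReal.ofReal β + ∫⁻ x in Ω, ENNReal.ofReal (w x * u x ^ 2) := by
    rw [← mul_one (ENNReal.ofReal β), ← hV1, ← lintegral_const_mul' _ _ ENNReal.ofReal_ne_top,
      ← lintegral_add_left' (hmeas.const_mul _)]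
    refine setLIntegral_congr_fun hΩ.measurableSet fun x hx => ?_
    rw [← ENNReal.ofReal_mul hβ, ← ENNReal.ofReal_add
      (mul_nonneg hβ (mul_nonneg (V_nonneg a x) (sq_nonneg _)))
      (mul_nonneg (hw0 x hx).le (sq_nonneg _)), add_mul, mul_assoc]
  calc ENNReal.ofReal β
      < ENNReal.ofReal β + ∫⁻ x in Ω, ENNReal.ofReal (w x * u x ^ 2) :=
        ENNReal.lt_add_right ENNReal.ofReal_ne_top hpos
    _ = ∫⁻ x in Ω, ENNReal.ofReal ((β * V a x + w x) * u x ^ 2) := hsplit.symm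
    _ ≤ ∫⁻ x in Ω, ENNReal.ofReal (‖G x‖ ^ 2) := by
        refine hu.lintegral_mul_sq_le hΩ ((hV.const_mul β).add hw)
          (fun x hx => add_nonneg (mul_nonneg hβ (V_nonneg a x)) (hw0 x hx).le) fun φ hφ => ?_
        simp only [add_mul, mul_assoc]
        rw [integral_add ((hφ.integrable_mul_sq hΩ hV).const_mul β) (hφ.integrable_mul_sq hΩ hw),
          integral_const_mul]
        exact hβw φ hφ
    _ = hardyConst Ω a := hG

lemma sub_two_sq_div_lt (hN : 2 ≤ N) (hn : 2 ≤ n) :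
    ((N : ℝ) - 2) ^ 2 / (n : ℝ) ^ 2 < (N : ℝ) ^ 2 / (4 * n - 4) := by
  have hN2 : (2 : ℝ) ≤ N := by exact_mod_cast hN
  have hn2 : (2 : ℝ) ≤ n := by exact_mod_cast hn
  have hn4 : 4 * (n : ℝ) - 4 ≤ (n : ℝ) ^ 2 := by linarith [sq_nonneg ((n : ℝ) - 2)]
  calc ((N : ℝ) - 2) ^ 2 / (n : ℝ) ^ 2 < (N : ℝ) ^ 2 / (n : ℝ) ^ 2 := by gcongr; linarith
    _ ≤ (N : ℝ) ^ 2 / (4 * n - 4) := by gcongr; linarith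

lemma IsSmoothBoundedDomain.isC2BoundaryPoint (hΩ : IsSmoothBoundedDomain Ω) {p : E N}
    (hp : p ∈ frontier Ω) : IsC2BoundaryPoint Ω p := by
  obtain ⟨U, ρ, hU, hpU, hρ, hρp, hdρ, hmem⟩ := hΩ.smooth_boundary p hp
  have hUp := hU.mem_nhds hpU
  refine ⟨ρ, (hρ.contDiffAt hUp).of_le (by norm_cast), hρp, ?_,
    eventually_of_mem hUp hmem⟩
  rwa [gradient, map_ne_zero_iff _ (LinearIsometryEquiv.injective _)]

end Attainment

end MultipolarHardy

end

open MultipolarHardy in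
theorem theorem4_general (N n : ℕ) (hN : 2 ≤ N) (hn : 2 ≤ n) (Ω : Set (E N)) (hΩ : IsOpen Ω)
    (hb : Bornology.IsBounded Ω) (a : Fin n → E N) (ha : Function.Injective a)
    (haΩ : ∀ i, IsC2BoundaryPoint Ω (a i)) :
    (ENNReal.ofReal (((N : ℝ) - 2) ^ 2 / (n : ℝ) ^ 2) < hardyConst Ω a ∧
      hardyConst Ω a ≤ ENNReal.ofReal ((N : ℝ) ^ 2 / (4 * (n : ℝ) - 4))) ∧
    (∀ μ : ℝ, μ < (N : ℝ) ^ 2 / (4 * (n : ℝ) - 4) →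
      ∃ c : ℝ, ∀ u : E N → ℝ, IsTestFunction Ω u →
        μ * (∫ x in Ω, V a x * u x ^ 2) ≤
          c * (∫ x in Ω, u x ^ 2) + (∫ x in Ω, ‖gradient u x‖ ^ 2)) ∧
    (∀ μ : ℝ, (N : ℝ) ^ 2 / (4 * (n : ℝ) - 4) < μ → ∀ lam : ℝ,
      ∃ u : E N → ℝ, IsTestFunction Ω u ∧
        lam * (∫ x in Ω, u x ^ 2) + (∫ x in Ω, ‖gradient u x‖ ^ 2) <
          μ * (∫ x in Ω, V a x * u x ^ 2)) ∧
    (hardyConst Ω a < ENNReal.ofReal ((N : ℝ) ^ 2 / (4 * (n : ℝ) - 4)) →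
      ∃ (u : E N → ℝ) (G : E N → E N),
        Admissible Ω u G ∧ hardyQuotient Ω a u G = hardyConst Ω a) := by
  have hn1 : (0 : ℝ) < n - 1 := by linarith [show (2 : ℝ) ≤ n by exact_mod_cast hn]
  have hN0 : N ≠ 0 := by lia
  have haΩ' := fun i => (haΩ i).notMem
  have hτ : (N : ℝ) ^ 2 / (4 * n - 4) = (N : ℝ) ^ 2 / 4 / (n - 1) := by
    rw [div_div, mul_sub, mul_one]
  have hsub := fun μ hμ => exists_hardy_subcritical hΩ ha haΩ
    ((lt_div_iff₀ hn1).1 (hτ ▸ hμ : μ < _))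
  have hsup := fun μ hμ => exists_hardy_supercritical hN0 hΩ ha haΩ' (haΩ ⟨0, by lia⟩)
    ((div_lt_iff₀ hn1).1 (hτ ▸ hμ : _ < μ))
  refine ⟨⟨?_, ?_⟩, fun μ hμ => ?_, fun μ hμ lam => ?_, fun hlt => ?_⟩
  · obtain ⟨μ, hβμ, hμτ⟩ := exists_between (sub_two_sq_div_lt hN hn)
    obtain ⟨c, hc⟩ := hsub μ hμτ
    obtain ⟨w, hw, hw0, hβw⟩ := exists_multipolar_hardy_remainder hN (by lia) hΩ hb haΩ'
    exact ofReal_lt_hardyConst hN0 hn ha hΩ hb haΩ' (by positivity) hβμ hc hw hw0 hβw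
  · refine hardyConst_le_ofReal hn ha hΩ haΩ' (by rw [hτ]; positivity) fun μ hμ => ?_
    simpa only [zero_mul, zero_add] using hsup μ hμ 0
  · obtain ⟨c, hc⟩ := hsub μ hμ
    refine ⟨c, fun u hu => ?_⟩
    simpa only [hu.setIntegral_mul_sq, hu.setIntegral_sq, hu.setIntegral_norm_gradient_sq]
      using hc u hu
  · obtain ⟨u, hu, h⟩ := hsup μ hμ lam
    refine ⟨u, hu, ?_⟩
    rwa [hu.setIntegral_mul_sq, hu.setIntegral_sq, hu.setIntegral_norm_gradient_sq]
  · obtain ⟨μ, -, hμ, hμτ⟩ := ENNReal.lt_iff_exists_real_btwn.1 hlt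
    obtain ⟨c, hc⟩ := hsub μ (ENNReal.ofReal_lt_ofReal_iff'.1 hμτ).1
    exact exists_minimizer hN0 hn ha hΩ hb haΩ' hc hμ

theorem theorem4 (N n : ℕ) (hN : 2 ≤ N) (hn : 2 ≤ n)
    (Ω : Set (MultipolarHardy.E N)) (hΩ : MultipolarHardy.IsSmoothBoundedDomain Ω)
    (a : Fin n → MultipolarHardy.E N) (ha : Function.Injective a)
    (haΩ : ∀ i, a i ∈ frontier Ω) :
    (ENNReal.ofReal (((N : ℝ) - 2) ^ 2 / (n : ℝ) ^ 2) < MultipolarHardy.hardyConst Ω a ∧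
      MultipolarHardy.hardyConst Ω a ≤ ENNReal.ofReal ((N : ℝ) ^ 2 / (4 * (n : ℝ) - 4))) ∧
    (∀ μ : ℝ, μ < (N : ℝ) ^ 2 / (4 * (n : ℝ) - 4) →
      ∃ c : ℝ, ∀ u : MultipolarHardy.E N → ℝ, MultipolarHardy.IsTestFunction Ω u →
        μ * (∫ x in Ω, MultipolarHardy.V a x * u x ^ 2) ≤
          c * (∫ x in Ω, u x ^ 2) + (∫ x in Ω, ‖gradient u x‖ ^ 2)) ∧
    (∀ μ : ℝ, (N : ℝ) ^ 2 / (4 * (n : ℝ) - 4) < μ → ∀ lam : ℝ,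
      ∃ u : MultipolarHardy.E N → ℝ, MultipolarHardy.IsTestFunction Ω u ∧
        lam * (∫ x in Ω, u x ^ 2) + (∫ x in Ω, ‖gradient u x‖ ^ 2) <
          μ * (∫ x in Ω, MultipolarHardy.V a x * u x ^ 2)) ∧
    (MultipolarHardy.hardyConst Ω a < ENNReal.ofReal ((N : ℝ) ^ 2 / (4 * (n : ℝ) - 4)) →
      ∃ (u : MultipolarHardy.E N → ℝ) (G : MultipolarHardy.E N → MultipolarHardy.E N),
        MultipolarHardy.Admissible Ω u G ∧
        MultipolarHardy.hardyQuotient Ω a u G = MultipolarHardy.hardyConst Ω a) :=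
  theorem4_general N n hN hn Ω hΩ.isOpen hΩ.isBounded a ha
    fun i => hΩ.isC2BoundaryPoint (haΩ i)
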